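/- **Setting.** Let $p$ be an odd prime, $e_p(x)=e^{2\pi i x/p}$, and $d\ge 0$. On row vectors $\vec n=(\vec n_1,\vec n_2)\in\mathbb F_p^{2d}$ let $\omega(\vec m,\vec n)=\vec m_1\cdot\vec n_2-\vec m_2\cdot\vec n_1$, and let $\mathrm{Sp}(2d,\mathbb F_p)$ act on the right, $\vec n\mapsto \vec nB$. On $L^2(\mathbb F_p^d)$ put $T_p^{(d)}(\vec n)\psi(\vec y)=e_p(\tfrac12\vec n_1\cdot\vec n_2)\,e_p(\vec n_2\cdot\vec y)\,\psi(\vec y+\vec n_1)$. A *quantization* is a unitary representation $U_p^{(d)}$ of $\mathrm{Sp}(2d,\mathbb F_p)$ on $L^2(\mathbb F_p^d)$ with $U_p^{(d)}(B)^{-1}T_p^{(d)}(\vec n)U_p^{(d)}(B)=T_p^{(d)}(\vec nB)$ for all $B,\vec n$. A quantization exists for every $d$; fix one for each $d$. Let $A\in\mathrm{Sp}(2d,\mathbb F_p)$ have $2d$ distinct eigenvalues in $\overline{\mathbb F}_p$, let $C_p(A)$ be its centralizer in $\mathrm{Sp}(2d,\mathbb F_p)$, and for a character $\chi$ of $C_p(A)$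 let $\mathcal H_\chi=\{\psi : U_p^{(d)}(B)\psi=\chi(B)\psi\ \ \forall B\in C_p(A)\}$. For a Galois orbit $\vartheta$ over $\mathbb F_p$ of eigenvalues of $A$ let $\vartheta^*=\{\lambda^{-1}:\lambda\in\vartheta\}$; the set $\bar\vartheta=\vartheta\cup\vartheta^*$ is a *symplectic orbit*, *symmetric* if $\vartheta=\vartheta^*$ and *nonsymmetric* otherwise. A *quadratic character* is a character of order exactly $2$. **(1) One orbit.** Suppose $A$ has exactly one symplectic orbit. Then $C_p(A)$ has a unique quadratic character $\chi_2$. For every character $\chi\ne\chi_2$, $\dim\mathcal H_\chi=1$. If the orbit is symmetric then $\dim\mathcal H_{\chi_2}=0$; if it is nonsymmetric then $\dim\mathcal H_{\chi_2}=2$. **(2) General case.** Let $E_{\bar\vartheta}\subseteq\mathbb F_p^{2d}$ be the $A$-invariant subspace of the vectors which over $\overline{\mathbb F}_p$ lie in the sum of the eigenspaces of $A$ for the eigenvalues in $\bar\vartheta$, and let $2d_{\bar\vartheta}=|\bar\vartheta|$. Then $\mathbb F_p^{2d}=\bigoplus_{\bar\vartheta}E_{\bar\vartheta}$ is an orthogonal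 decomposition into symplectic subspaces with $\dim E_{\bar\vartheta}=2d_{\bar\vartheta}$. Choose any symplectic basis of each $E_{\bar\vartheta}$; write $\vec n_{\bar\vartheta}\in\mathbb F_p^{2d_{\bar\vartheta}}$ for the coordinates of the projection of $\vec n$ to $E_{\bar\vartheta}$ and $B_{\bar\vartheta}\in\mathrm{Sp}(2d_{\bar\vartheta},\mathbb F_p)$ for the matrix of the restriction to $E_{\bar\vartheta}$ of $B\in C_p(A)$. Each $C_p(A_{\bar\vartheta})$ has a unique quadratic character, every character $\chi$ of $C_p(A)$ can be written uniquely as $\chi(B)=\prod_{\bar\vartheta}\chi_{\bar\vartheta}(B_{\bar\vartheta})$ with characters $\chi_{\bar\vartheta}$ of $C_p(A_{\bar\vartheta})$, and there is a unitary map $\mathcal U:L^2(\mathbb F_p^d)\to\bigotimes_{\bar\vartheta}L^2(\mathbb F_p^{d_{\bar\vartheta}})$ with $\mathcal U\,T_p^{(d)}(\vec n)\,\mathcal U^{-1}=\bigotimes_{\bar\vartheta}T_p^{(d_{\bar\vartheta})}(\vec n_{\bar\vartheta})$ for all $\vec n$. Let $\mathcal H^{\bar\vartheta}_{\chi_{\bar\vartheta}}\subseteq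 L^2(\mathbb F_p^{d_{\bar\vartheta}})$ be the joint eigenspace of $U_p^{(d_{\bar\vartheta})}(B)$, $B\in C_p(A_{\bar\vartheta})$, for $\chi_{\bar\vartheta}$. For $\chi=\prod\chi_{\bar\vartheta}$: * if no $\chi_{\bar\vartheta}$ is quadratic, then $\dim\mathcal H_\chi=1$; * if $\chi_{\bar\vartheta}$ is quadratic for some symmetric $\bar\vartheta$, then $\dim\mathcal H_\chi=0$; * otherwise (every $\bar\vartheta$ with $\chi_{\bar\vartheta}$ quadratic is nonsymmetric) $\dim\mathcal H_\chi=2^k$, where $k$ is the number of $\bar\vartheta$ for which $\chi_{\bar\vartheta}$ is quadratic. Moreover, in this case, for every such $\mathcal U$, every choice of nonzero vectors $\psi^{\bar\vartheta}_{\chi_{\bar\vartheta}}\in\mathcal H^{\bar\vartheta}_{\chi_{\bar\vartheta}}$ for the $\bar\vartheta$ with $\chi_{\bar\vartheta}$ not quadratic, and every choice of bases $\{\psi^{\bar\vartheta}_0,\psi^{\bar\vartheta}_1\}$ of $\mathcal H^{\bar\vartheta}_{\chi_{\bar\vartheta}}$ for the $\bar\vartheta$ with $\chi_{\bar\vartheta}$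 quadratic, the vectors $$\psi_\chi^\eta=\mathcal U^{-1}\Big(\bigotimes_{\chi_{\bar\vartheta}\text{ not quadratic}}\psi^{\bar\vartheta}_{\chi_{\bar\vartheta}}\otimes\bigotimes_{\chi_{\bar\vartheta}\text{ quadratic}}\psi^{\bar\vartheta}_{\eta_{\bar\vartheta}}\Big),\qquad \eta\in(\mathbb Z/2\mathbb Z)^k,$$ form a basis of $\mathcal H_\chi$. -/

import Mathlib

open Matrix

noncomputable section

/-- The state space `L²(𝔽_p^d)`. The factor `p^{-d}` in the usual inner product of this space is
left out: it changes neither unitarity nor any eigenspace. -/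
abbrev HilbertP (p d : ℕ) [Fact p.Prime] : Type := EuclideanSpace ℂ (Fin d → ZMod p)

/-- Phase space vectors `n = (n₁, n₂) ∈ 𝔽_p^{2d}`, as row vectors. -/
abbrev PhaseP (p d : ℕ) : Type := Fin d ⊕ Fin d → ZMod p

/-- The symplectic group `Sp(2d, 𝔽_p)`; matrices act on row vectors, `n ↦ n B`. -/
abbrev SpP (p d : ℕ) : Type := Matrix.symplecticGroup (Fin d) (ZMod p)

/-- `ω(m, n) = m₁ · n₂ - m₂ · n₁`. -/
def sympForm {p d : ℕ} (m n : PhaseP p d) : ZMod p :=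
  (m ∘ Sum.inl) ⬝ᵥ (n ∘ Sum.inr) - (m ∘ Sum.inr) ⬝ᵥ (n ∘ Sum.inl)

theorem sympForm_eq {p d : ℕ} (m n : PhaseP p d) :
    sympForm m n = -(m ⬝ᵥ (J (Fin d) (ZMod p) *ᵥ n)) := by
  have h : J (Fin d) (ZMod p) *ᵥ n = Sum.elim (-(n ∘ Sum.inr)) (n ∘ Sum.inl) := by
    rw [J, fromBlocks_mulVec, zero_mulVec, zero_mulVec, zero_add, add_zero, neg_mulVec,
      one_mulVec, one_mulVec]
  rw [h]
  simp only [sympForm, dotProduct, Fintype.sum_sum_type, Function.comp_apply, Sum.elim_inl,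
    Sum.elim_inr, Pi.neg_apply, mul_neg, Finset.sum_neg_distrib]
  ring

theorem sympForm_vecMul {p d : ℕ} (B : Matrix (Fin d ⊕ Fin d) (Fin d ⊕ Fin d) (ZMod p))
    (m n : PhaseP p d) :
    sympForm (m ᵥ* B) (n ᵥ* B) = -(m ⬝ᵥ ((B * J (Fin d) (ZMod p) * Bᵀ) *ᵥ n)) := by
  rw [sympForm_eq, ← mulVec_transpose B n, mulVec_mulVec, ← dotProduct_mulVec, mulVec_mulVec,
    Matrix.mul_assoc]

theorem mem_symplecticGroup_iff {p d : ℕ}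
    (B : Matrix (Fin d ⊕ Fin d) (Fin d ⊕ Fin d) (ZMod p)) :
    B ∈ symplecticGroup (Fin d) (ZMod p) ↔
      ∀ m n : PhaseP p d, sympForm (m ᵥ* B) (n ᵥ* B) = sympForm m n := by
  rw [SymplecticGroup.mem_iff]
  constructor
  · intro h m n
    rw [sympForm_vecMul, h, sympForm_eq]
  · intro h
    ext i j
    have := h (Pi.single i 1) (Pi.single j 1)
    rw [sympForm_vecMul, sympForm_eq, neg_inj] at this
    simpa using this

/-! ### Quantization -/

section Quantization

variable {p : ℕ} [Fact p.Prime]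

/-- The elementary operator
`T_p(n) ψ(y) = e_p(½ n₁·n₂) e_p(n₂·y) ψ(y + n₁)`, where `e_p(x) = exp(2πi x / p)` and `½` is the
inverse of `2` in `𝔽_p` (`p` odd). -/
def elemOp {d : ℕ} (n : PhaseP p d) : HilbertP p d →ₗ[ℂ] HilbertP p d where
  toFun ψ := WithLp.toLp 2 fun y =>
    ZMod.stdAddChar (N := p) (2⁻¹ * ((n ∘ Sum.inl) ⬝ᵥ (n ∘ Sum.inr))) *
      ZMod.stdAddChar (N := p) ((n ∘ Sum.inr) ⬝ᵥ y) * ψ (y + n ∘ Sum.inl)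
  map_add' ψ φ := by
    ext y
    simp [mul_add]
  map_smul' c ψ := by
    ext y
    simp only [PiLp.smul_apply, smul_eq_mul, RingHom.id_apply]
    ring

/-- A quantization of `Sp(2d, 𝔽_p)`: a unitary representation `U` on `L²(𝔽_p^d)` with
`U(B)⁻¹ T_p(n) U(B) = T_p(n B)` for all `B` and `n`. -/
def IsQuantization {d : ℕ} (U : SpP p d →* (HilbertP p d ≃ₗᵢ[ℂ] HilbertP p d)) : Prop :=
  ∀ (B : SpP p d) (n : PhaseP p d) (ψ : HilbertP p d),
    (U B)⁻¹ (elemOp n (U B ψ)) = elemOp (n ᵥ* B.1) ψ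

/-- The Hecke group `C_p(A)`: the centralizer of `A` in `Sp(2d, 𝔽_p)`. -/
abbrev heckeGroup {d : ℕ} (A : SpP p d) : Subgroup (SpP p d) := Subgroup.centralizer {A}

/-- The joint eigenspace `ℋ_χ` of the Hecke operators `U(B)`, `B ∈ C_p(A)`. -/
def heckeEigenspace {d : ℕ} (U : SpP p d →* (HilbertP p d ≃ₗᵢ[ℂ] HilbertP p d)) (A : SpP p d)
    (χ : heckeGroup A →* ℂˣ) : Submodule ℂ (HilbertP p d) where
  carrier := {ψ | ∀ B : heckeGroup A, U B.1 ψ = (χ B : ℂ) • ψ}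
  add_mem' h₁ h₂ B := by rw [map_add, h₁ B, h₂ B, smul_add]
  zero_mem' B := by simp
  smul_mem' c ψ h B := by rw [map_smul, h B, smul_comm]

end Quantization

/-! ### Orbits of eigenvalues and the corresponding subspaces -/

section Orbits

/-- The Galois (Frobenius) orbit of `x` over `𝔽_p`. -/
def galOrbit (p : ℕ) [Fact p.Prime] (x : AlgebraicClosure (ZMod p)) :
    Set (AlgebraicClosure (ZMod p)) :=
  MulAction.orbit (AlgebraicClosure (ZMod p) ≃ₐ[ZMod p] AlgebraicClosure (ZMod p)) x

/-- The symplectic orbit `ϑ ∪ ϑ*` of `x`, where `ϑ` is the orbit of `x` and `ϑ*` that of `x⁻¹`. -/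
def sympOrbit (p : ℕ) [Fact p.Prime] (x : AlgebraicClosure (ZMod p)) :
    Set (AlgebraicClosure (ZMod p)) :=
  galOrbit p x ∪ galOrbit p x⁻¹

variable {p : ℕ} [Fact p.Prime] {d : ℕ}

/-- The eigenvalues of `A` in the algebraic closure of `𝔽_p`, with algebraic multiplicity. -/
def eigenvaluesP (A : SpP p d) : Multiset (AlgebraicClosure (ZMod p)) :=
  A.1.charpoly.aroots (AlgebraicClosure (ZMod p))

open Classical in
/-- The set of symplectic orbits of the eigenvalues of `A`. -/
def sympOrbits (A : SpP p d) : Finset (Set (AlgebraicClosure (ZMod p))) :=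
  (eigenvaluesP A).toFinset.image (sympOrbit p)

/-- A symplectic orbit is symmetric if the orbit of each of its elements `x` is also the orbit
of `x⁻¹`. -/
def IsSymmetricOrbit (ϑ : Set (AlgebraicClosure (ZMod p))) : Prop :=
  ∀ x ∈ ϑ, x⁻¹ ∈ galOrbit p x

/-- Half the size of a symplectic orbit. -/
def halfDim (ϑ : Set (AlgebraicClosure (ZMod p))) : ℕ := ϑ.ncard / 2

/-- The invariant subspace `E_ϑ ⊆ 𝔽_p^{2d}` of the vectors that lie, over the algebraic closure, in
the sum of the eigenspaces of `A` for the eigenvalues in `ϑ`. -/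
def orbitSpace (A : Matrix (Fin d ⊕ Fin d) (Fin d ⊕ Fin d) (ZMod p))
    (ϑ : Set (AlgebraicClosure (ZMod p))) : Submodule (ZMod p) (PhaseP p d) :=
  ((⨆ x ∈ ϑ, Module.End.eigenspace
      (A.map (algebraMap (ZMod p) (AlgebraicClosure (ZMod p)))).vecMulLinear x).restrictScalars
    (ZMod p)).comap
    ((Algebra.linearMap (ZMod p) (AlgebraicClosure (ZMod p))).compLeft (Fin d ⊕ Fin d))

theorem vecMul_mem_orbitSpace {A B : Matrix (Fin d ⊕ Fin d) (Fin d ⊕ Fin d) (ZMod p)}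
    (h : A * B = B * A) {ϑ : Set (AlgebraicClosure (ZMod p))} {n : PhaseP p d}
    (hn : n ∈ orbitSpace A ϑ) : n ᵥ* B ∈ orbitSpace A ϑ := by
  set f := algebraMap (ZMod p) (AlgebraicClosure (ZMod p))
  have hAB : A.map f * B.map f = B.map f * A.map f := by
    rw [← Matrix.map_mul, ← Matrix.map_mul, h]
  have key : (⨆ x ∈ ϑ, Module.End.eigenspace (A.map f).vecMulLinear x) ≤
      (⨆ x ∈ ϑ, Module.End.eigenspace (A.map f).vecMulLinear x).comap
        (B.map f).vecMulLinear := by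
    refine iSup₂_le fun x hx v hv => ?_
    refine Submodule.mem_iSup_of_mem x (Submodule.mem_iSup_of_mem hx ?_)
    rw [Module.End.mem_eigenspace_iff] at hv ⊢
    simp only [vecMulLinear_apply] at hv ⊢
    rw [vecMul_vecMul, ← hAB, ← vecMul_vecMul, hv, smul_vecMul]
  have h2 : (Algebra.linearMap (ZMod p) (AlgebraicClosure (ZMod p))).compLeft
      (Fin d ⊕ Fin d) (n ᵥ* B) =
      (B.map f).vecMulLinear ((Algebra.linearMap (ZMod p) (AlgebraicClosure (ZMod p))).compLeft
      (Fin d ⊕ Fin d) n) := by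
    ext i
    simp [vecMul, dotProduct, f]
  change (Algebra.linearMap (ZMod p) (AlgebraicClosure (ZMod p))).compLeft
      (Fin d ⊕ Fin d) (n ᵥ* B) ∈ ⨆ x ∈ ϑ, Module.End.eigenspace (A.map f).vecMulLinear x
  rw [h2]
  exact key hn

/-- A choice of a symplectic basis in each `E_ϑ`, recorded as the coordinate isomorphism
`n ↦ (n_ϑ)_ϑ`: the vector `n_ϑ ∈ 𝔽_p^{2d_ϑ}` consists of the coordinates of the projection of `n`
to `E_ϑ`. -/
structure SympDecomposition (A : SpP p d) where
  coord : PhaseP p d ≃ₗ[ZMod p] ((ϑ : sympOrbits A) → PhaseP p (halfDim ϑ.1))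
  mem_iff : ∀ (ϑ : sympOrbits A) (n : PhaseP p d),
    n ∈ orbitSpace A.1 ϑ.1 ↔ ∀ ϑ' : sympOrbits A, ϑ' ≠ ϑ → coord n ϑ' = 0
  form_eq : ∀ m n : PhaseP p d, sympForm m n = ∑ ϑ, sympForm (coord m ϑ) (coord n ϑ)

namespace SympDecomposition

variable {A : SpP p d} (S : SympDecomposition A)

open Classical in
/-- The embedding of `𝔽_p^{2d_ϑ}` onto `E_ϑ` given by the symplectic basis. -/
def incl (ϑ : sympOrbits A) : PhaseP p (halfDim ϑ.1) →ₗ[ZMod p] PhaseP p d :=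
  S.coord.symm.toLinearMap ∘ₗ
    LinearMap.single (ZMod p) (fun ϑ : sympOrbits A => PhaseP p (halfDim ϑ.1)) ϑ

theorem coord_incl_self (ϑ : sympOrbits A) (v : PhaseP p (halfDim ϑ.1)) :
    S.coord (S.incl ϑ v) ϑ = v := by
  simp [incl]

theorem coord_incl_ne {ϑ ϑ' : sympOrbits A} (h : ϑ' ≠ ϑ) (v : PhaseP p (halfDim ϑ.1)) :
    S.coord (S.incl ϑ v) ϑ' = 0 := by
  simp [incl, h]

theorem incl_mem (ϑ : sympOrbits A) (v : PhaseP p (halfDim ϑ.1)) :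
    S.incl ϑ v ∈ orbitSpace A.1 ϑ.1 :=
  (S.mem_iff ϑ _).2 fun _ h => S.coord_incl_ne h v

theorem incl_coord {ϑ : sympOrbits A} {n : PhaseP p d} (hn : n ∈ orbitSpace A.1 ϑ.1) :
    S.incl ϑ (S.coord n ϑ) = n := by
  apply S.coord.injective
  funext ϑ'
  by_cases h : ϑ' = ϑ
  · subst h
    exact S.coord_incl_self _ _
  · rw [S.coord_incl_ne h, (S.mem_iff ϑ n).1 hn ϑ' h]

theorem sympForm_eq_of_mem {ϑ : sympOrbits A} {m : PhaseP p d} (hm : m ∈ orbitSpace A.1 ϑ.1)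
    (n : PhaseP p d) : sympForm m n = sympForm (S.coord m ϑ) (S.coord n ϑ) := by
  rw [S.form_eq, Finset.sum_eq_single ϑ]
  · intro ϑ' _ h
    rw [(S.mem_iff ϑ m).1 hm ϑ' h]
    simp [sympForm, dotProduct]
  · simp

/-- The matrix of the restriction of `B` to `E_ϑ` in the symplectic basis (for `B` that leaves
`E_ϑ` invariant). -/
def compMatrix (B : Matrix (Fin d ⊕ Fin d) (Fin d ⊕ Fin d) (ZMod p)) (ϑ : sympOrbits A) :
    Matrix (Fin (halfDim ϑ.1) ⊕ Fin (halfDim ϑ.1)) (Fin (halfDim ϑ.1) ⊕ Fin (halfDim ϑ.1))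
      (ZMod p) :=
  Matrix.of fun i j => S.coord (S.incl ϑ (Pi.single i 1) ᵥ* B) ϑ j

theorem vecMul_compMatrix (B : Matrix (Fin d ⊕ Fin d) (Fin d ⊕ Fin d) (ZMod p))
    (ϑ : sympOrbits A) (v : PhaseP p (halfDim ϑ.1)) :
    v ᵥ* S.compMatrix B ϑ = S.coord (S.incl ϑ v ᵥ* B) ϑ := by
  let L : PhaseP p (halfDim ϑ.1) →ₗ[ZMod p] PhaseP p (halfDim ϑ.1) :=
    LinearMap.proj ϑ ∘ₗ S.coord.toLinearMap ∘ₗ B.vecMulLinear ∘ₗ S.incl ϑ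
  have h : (S.compMatrix B ϑ).vecMulLinear = L := by
    refine LinearMap.pi_ext' fun i => LinearMap.ext_ring ?_
    ext j
    simp [L, compMatrix]
  exact LinearMap.congr_fun h v

/-- For `B` commuting with `A`, the coordinates satisfy `(n B)_ϑ = n_ϑ B_ϑ` on `E_ϑ`. -/
theorem incl_vecMul {B : Matrix (Fin d ⊕ Fin d) (Fin d ⊕ Fin d) (ZMod p)}
    (h : A.1 * B = B * A.1) (ϑ : sympOrbits A) (v : PhaseP p (halfDim ϑ.1)) :
    S.incl ϑ v ᵥ* B = S.incl ϑ (v ᵥ* S.compMatrix B ϑ) := by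
  rw [vecMul_compMatrix, S.incl_coord (vecMul_mem_orbitSpace h (S.incl_mem ϑ v))]

theorem compMatrix_mul {B C : Matrix (Fin d ⊕ Fin d) (Fin d ⊕ Fin d) (ZMod p)}
    (h : A.1 * B = B * A.1) (ϑ : sympOrbits A) :
    S.compMatrix (B * C) ϑ = S.compMatrix B ϑ * S.compMatrix C ϑ := by
  refine Matrix.ext_of_single_vecMul fun i => ?_
  rw [← vecMul_vecMul, vecMul_compMatrix, vecMul_compMatrix S C, ← S.incl_vecMul h,
    vecMul_vecMul]

theorem compMatrix_one (ϑ : sympOrbits A) : S.compMatrix 1 ϑ = 1 := by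
  refine Matrix.ext_of_single_vecMul fun i => ?_
  rw [vecMul_compMatrix, vecMul_one, vecMul_one, coord_incl_self]

theorem compMatrix_mem {B : SpP p d} (h : A.1 * B.1 = B.1 * A.1) (ϑ : sympOrbits A) :
    S.compMatrix B.1 ϑ ∈ symplecticGroup (Fin (halfDim ϑ.1)) (ZMod p) := by
  rw [mem_symplecticGroup_iff]
  intro m n
  rw [vecMul_compMatrix, vecMul_compMatrix,
    ← S.sympForm_eq_of_mem (vecMul_mem_orbitSpace h (S.incl_mem ϑ m)),
    (mem_symplecticGroup_iff B.1).1 B.2, S.sympForm_eq_of_mem (S.incl_mem ϑ m),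
    coord_incl_self, coord_incl_self]

/-- `A_ϑ ∈ Sp(2d_ϑ, 𝔽_p)`: the restriction of `A` to `E_ϑ` in the symplectic basis. -/
def comp (ϑ : sympOrbits A) : SpP p (halfDim ϑ.1) :=
  ⟨S.compMatrix A.1 ϑ, S.compMatrix_mem rfl ϑ⟩

theorem heckeGroup_comm (B : heckeGroup A) : A.1 * B.1.1 = B.1.1 * A.1 :=
  congrArg Subtype.val (Subgroup.mem_centralizer_singleton_iff.1 B.2).symm

/-- The homomorphism `C_p(A) → C_p(A_ϑ)`, `B ↦ B_ϑ`. -/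
def heckeComp (ϑ : sympOrbits A) : heckeGroup A →* heckeGroup (S.comp ϑ) where
  toFun B := ⟨⟨S.compMatrix B.1.1 ϑ, S.compMatrix_mem (heckeGroup_comm B) ϑ⟩, by
    rw [Subgroup.mem_centralizer_singleton_iff]
    apply Subtype.ext
    change S.compMatrix B.1.1 ϑ * S.compMatrix A.1 ϑ = S.compMatrix A.1 ϑ * S.compMatrix B.1.1 ϑ
    rw [← S.compMatrix_mul (heckeGroup_comm B), ← S.compMatrix_mul rfl, heckeGroup_comm B]⟩
  map_one' := Subtype.ext (Subtype.ext (S.compMatrix_one ϑ))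
  map_mul' B C := Subtype.ext (Subtype.ext (S.compMatrix_mul (heckeGroup_comm B) ϑ))

/-- The character `χ = ∏_ϑ χ_ϑ` of `C_p(A)`, that is `χ(B) = ∏_ϑ χ_ϑ(B_ϑ)`. -/
def prodChar (χ : (ϑ : sympOrbits A) → heckeGroup (S.comp ϑ) →* ℂˣ) : heckeGroup A →* ℂˣ :=
  ∏ ϑ, (χ ϑ).comp (S.heckeComp ϑ)

open scoped TensorProduct in
/-- A unitary map `𝒰 : L²(𝔽_p^d) → ⨂_ϑ L²(𝔽_p^{d_ϑ})` with `𝒰 T_p(n) 𝒰⁻¹ = ⨂_ϑ T_p(n_ϑ)` for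
all `n`. Unitarity is expressed on pure tensors, which span, through
`⟨⨂ φ_ϑ, ⨂ φ'_ϑ⟩ = ∏ ⟨φ_ϑ, φ'_ϑ⟩`. -/
structure IsTensorIntertwiner
    (𝒰 : HilbertP p d ≃ₗ[ℂ] (⨂[ℂ] ϑ : sympOrbits A, HilbertP p (halfDim ϑ.1))) : Prop where
  unitary : ∀ φ φ' : (ϑ : sympOrbits A) → HilbertP p (halfDim ϑ.1),
    inner ℂ (𝒰.symm (PiTensorProduct.tprod ℂ φ)) (𝒰.symm (PiTensorProduct.tprod ℂ φ')) =
      ∏ ϑ, inner ℂ (φ ϑ) (φ' ϑ)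
  intertwines : ∀ (n : PhaseP p d) (ψ : HilbertP p d),
    𝒰 (elemOp n ψ) = PiTensorProduct.map (fun ϑ => elemOp (S.coord n ϑ)) (𝒰 ψ)

end SympDecomposition

end Orbits

end

/-!
The `p ^ (2d)` operators `T(n)` span `End L²(𝔽_p^d)`, so that a unitary `U` with
`U⁻¹ T(n) U = T(nB)` is unique up to a scalar. It commutes with `ψ(y) ↦ ψ(-y)`, and its
determinants on the even and the odd functions scale with consecutive powers of the scalar;
requiring them to be equal therefore picks one `U` for every `B`, and these `U` form a
representation.

Transvections generate `Sp` and have order dividing `p`, so every character of `Sp` is trivial on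
the centralizer `C` of `A`, whose order is prime to `p`. Hence `det U = 1` on `C`, and `U`
restricted to `C` is the tensor product of the quantizations of the components `A_ϑ`. This reduces
everything to one orbit.

There `C` is identified, through its action on one eigenvector, with the multiplicative group of
`𝔽_{p^d}` (nonsymmetric orbit) or with the group of elements of norm one of `𝔽_{p^{2d}}` over
`𝔽_{p^d}` (symmetric orbit), and no `B ≠ 1` in `C` fixes a nonzero vector. Twirling by the `T(n)`
gives `tr U(B) tr U(B⁻¹) = 1` for such `B`, so that the multiplicities `m_χ` satisfy
`∑ (m_χ - 1)² = 1` and `∑ (m_χ - 1) = p ^ d - |C| = ±1`: all of them are `1` up to a single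
exception. As `det U = ∏ χ ^ m_χ` is trivial on `C`, the exceptional character is the product of all
the characters of the cyclic group `C`, which is the quadratic one.
-/

noncomputable section

section SymplecticForm

variable {p d : ℕ}

theorem phaseP_ext {m n : PhaseP p d} (hl : m ∘ Sum.inl = n ∘ Sum.inl)
    (hr : m ∘ Sum.inr = n ∘ Sum.inr) : m = n :=
  (Sum.elim_comp_inl_inr m).symm.trans ((congrArg₂ Sum.elim hl hr).trans (Sum.elim_comp_inl_inr n))

theorem sympForm_vecMul_vecMul (B : SpP p d) (m n : PhaseP p d) :
    sympForm (m ᵥ* B.1) (n ᵥ* B.1) = sympForm m n :=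
  (mem_symplecticGroup_iff B.1).1 B.2 m n

theorem sympForm_self (m : PhaseP p d) : sympForm m m = 0 := by
  rw [sympForm, dotProduct_comm, sub_self]

variable [Fact p.Prime]

theorem inv_two_add_inv_two (hp : p ≠ 2) : (2⁻¹ : ZMod p) + 2⁻¹ = 1 := by
  have : NeZero ((2 : ℕ) : ZMod p) :=
    ⟨fun h => hp ((Nat.prime_dvd_prime_iff_eq Fact.out Nat.prime_two).1
      ((ZMod.natCast_eq_zero_iff 2 p).1 h))⟩
  rw [← two_mul, mul_inv_cancel₀ (mod_cast this.out)]

/-- The symplectic form `ω` as a bilinear form. -/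
def sympBilin (p d : ℕ) [Fact p.Prime] : LinearMap.BilinForm (ZMod p) (PhaseP p d) :=
  LinearMap.mk₂ (ZMod p) sympForm
    (fun _ _ _ => by simp only [sympForm_eq, add_dotProduct, neg_add])
    (fun _ _ _ => by simp only [sympForm_eq, smul_dotProduct, smul_neg])
    (fun _ _ _ => by simp only [sympForm_eq, mulVec_add, dotProduct_add, neg_add])
    (fun _ _ _ => by simp only [sympForm_eq, mulVec_smul, dotProduct_smul, smul_neg])

theorem sympBilin_apply (m n : PhaseP p d) : sympBilin p d m n = sympForm m n := rfl

theorem sympForm_add_left (l m n : PhaseP p d) :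
    sympForm (l + m) n = sympForm l n + sympForm m n :=
  (sympBilin p d).map_add₂ l m n

theorem sympForm_add_right (l m n : PhaseP p d) :
    sympForm l (m + n) = sympForm l m + sympForm l n :=
  map_add (sympBilin p d l) m n

theorem sympForm_sub_right (l m n : PhaseP p d) :
    sympForm l (m - n) = sympForm l m - sympForm l n :=
  map_sub (sympBilin p d l) m n

theorem sympForm_smul_left (a : ZMod p) (m n : PhaseP p d) :
    sympForm (a • m) n = a * sympForm m n :=
  (sympBilin p d).map_smul₂ a m n

theorem sympForm_smul_right (a : ZMod p) (m n : PhaseP p d) :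
    sympForm m (a • n) = a * sympForm m n :=
  map_smul (sympBilin p d m) a n

theorem sympForm_neg_left (m n : PhaseP p d) : sympForm (-m) n = -sympForm m n :=
  (sympBilin p d).map_neg₂ m n

theorem sympForm_neg_right (m n : PhaseP p d) : sympForm m (-n) = -sympForm m n :=
  map_neg (sympBilin p d m) n

theorem isAlt_sympBilin (p d : ℕ) [Fact p.Prime] : (sympBilin p d).IsAlt := sympForm_self

theorem sympForm_swap (m n : PhaseP p d) : sympForm m n = -sympForm n m :=
  ((isAlt_sympBilin p d).neg_eq n m).symm

theorem sympForm_single_inl (n : PhaseP p d) (i : Fin d) :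
    sympForm n (Pi.single (Sum.inl i) 1) = -n (Sum.inr i) := by
  simp [sympForm, dotProduct, Pi.single_apply]

theorem sympForm_single_inr (n : PhaseP p d) (i : Fin d) :
    sympForm n (Pi.single (Sum.inr i) 1) = n (Sum.inl i) := by
  simp [sympForm, dotProduct, Pi.single_apply]

theorem eq_zero_of_sympForm_eq_zero {m : PhaseP p d} (h : ∀ n, sympForm m n = 0) : m = 0 := by
  refine funext (Sum.rec (fun i => ?_) fun i => ?_)
  · rw [← sympForm_single_inr m i, h, Pi.zero_apply]
  · rw [Pi.zero_apply, ← neg_eq_zero, ← h (Pi.single (Sum.inl i) 1), sympForm_single_inl]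

theorem sum_stdAddChar_linearMap {V : Type*} [AddCommGroup V] [Module (ZMod p) V] [Fintype V]
    (f : V →ₗ[ZMod p] ZMod p) [Decidable (f = 0)] :
    ∑ v, ZMod.stdAddChar (f v) = if f = 0 then (Fintype.card V : ℂ) else 0 := by
  classical
  have trivial_iff :
      (ZMod.stdAddChar (N := p)).compAddMonoidHom (f : V →+ ZMod p) = 0 ↔ f = 0 := by
    constructor
    · refine fun h => LinearMap.ext fun v => ZMod.injective_stdAddChar ?_
      rw [LinearMap.zero_apply, AddChar.map_zero_eq_one]
      exact DFunLike.congr_fun h v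
    · rintro rfl
      exact DFunLike.ext _ _ fun _ => AddChar.map_zero_eq_one (ZMod.stdAddChar (N := p))
  refine (AddChar.sum_eq_ite
    ((ZMod.stdAddChar (N := p)).compAddMonoidHom (f : V →+ ZMod p))).trans ?_
  simp only [trivial_iff]

theorem card_phaseP (p d : ℕ) [Fact p.Prime] : Fintype.card (PhaseP p d) = p ^ d * p ^ d := by
  simp [ZMod.card, pow_add]

theorem sum_stdAddChar_sympForm (n : PhaseP p d) :
    ∑ m, ZMod.stdAddChar (sympForm n m) = if n = 0 then (p ^ d * p ^ d : ℂ) else 0 := by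
  classical
  have sympBilin_eq_zero_iff : sympBilin p d n = 0 ↔ n = 0 :=
    ⟨fun h => eq_zero_of_sympForm_eq_zero (DFunLike.congr_fun h), by rintro rfl; exact map_zero _⟩
  refine (sum_stdAddChar_linearMap (sympBilin p d n)).trans ?_
  simp only [sympBilin_eq_zero_iff, card_phaseP, Nat.cast_mul, Nat.cast_pow]

end SymplecticForm

section ElementaryOperators

variable {p : ℕ} [Fact p.Prime] {d : ℕ}

theorem elemOp_apply (n : PhaseP p d) (ψ : HilbertP p d) (y : Fin d → ZMod p) :
    elemOp n ψ y = ZMod.stdAddChar (2⁻¹ * ((n ∘ Sum.inl) ⬝ᵥ (n ∘ Sum.inr)) +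
      (n ∘ Sum.inr) ⬝ᵥ y) * ψ (y + n ∘ Sum.inl) := by
  rw [AddChar.map_add_eq_mul]
  rfl

theorem elemOp_zero : elemOp (0 : PhaseP p d) = (1 : Module.End ℂ (HilbertP p d)) := by
  ext1 ψ
  ext1 y
  have inl : (0 : PhaseP p d) ∘ Sum.inl = 0 := rfl
  have inr : (0 : PhaseP p d) ∘ Sum.inr = 0 := rfl
  simp [elemOp_apply, inl, inr]

theorem elemOp_mul (hp : p ≠ 2) (m n : PhaseP p d) :
    (elemOp m * elemOp n : Module.End ℂ (HilbertP p d)) =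
      ZMod.stdAddChar (2⁻¹ * sympForm m n) • elemOp (m + n) := by
  ext1 ψ
  ext1 y
  have inl : (m + n) ∘ Sum.inl = m ∘ Sum.inl + n ∘ Sum.inl := rfl
  have inr : (m + n) ∘ Sum.inr = m ∘ Sum.inr + n ∘ Sum.inr := rfl
  rw [Module.End.mul_apply, LinearMap.smul_apply, PiLp.smul_apply, smul_eq_mul, elemOp_apply,
    elemOp_apply, elemOp_apply, ← mul_assoc, ← mul_assoc, ← AddChar.map_add_eq_mul,
    ← AddChar.map_add_eq_mul, add_assoc y, inl]
  congr 2
  simp only [sympForm, inr, dotProduct_add, add_dotProduct]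
  rw [dotProduct_comm (n ∘ Sum.inr) (m ∘ Sum.inl), dotProduct_comm (m ∘ Sum.inr) (n ∘ Sum.inl)]
  linear_combination (-((m ∘ Sum.inl) ⬝ᵥ (n ∘ Sum.inr))) * inv_two_add_inv_two hp

theorem elemOp_mul_neg (hp : p ≠ 2) (n : PhaseP p d) :
    (elemOp n * elemOp (-n) : Module.End ℂ (HilbertP p d)) = 1 := by
  rw [elemOp_mul hp, sympForm_neg_right, sympForm_self, add_neg_cancel, elemOp_zero, neg_zero,
    mul_zero, AddChar.map_zero_eq_one, one_smul]

theorem elemOp_mul_mul_neg (hp : p ≠ 2) (n m : PhaseP p d) :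
    (elemOp n * elemOp m * elemOp (-n) : Module.End ℂ (HilbertP p d)) =
      ZMod.stdAddChar (sympForm n m) • elemOp m := by
  rw [elemOp_mul hp, smul_mul_assoc, elemOp_mul hp, smul_smul, ← AddChar.map_add_eq_mul,
    add_neg_cancel_comm, sympForm_neg_right, sympForm_add_left, sympForm_self, zero_add,
    sympForm_swap m n, neg_neg, ← add_mul, inv_two_add_inv_two hp, one_mul]

theorem inner_elemOp_elemOp (n : PhaseP p d) (φ ψ : HilbertP p d) :
    inner ℂ (elemOp n φ) (elemOp n ψ) = inner ℂ φ ψ := by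
  simp only [PiLp.inner_apply]
  refine Fintype.sum_equiv (Equiv.addRight (n ∘ Sum.inl)) _ _ fun y => ?_
  rw [elemOp_apply, elemOp_apply, RCLike.inner_apply, map_mul, mul_mul_mul_comm,
    ← AddChar.map_neg_eq_conj, ← AddChar.map_add_eq_mul, add_neg_cancel,
    AddChar.map_zero_eq_one, one_mul]
  rfl

theorem star_elemOp (hp : p ≠ 2) (n : PhaseP p d) :
    star (elemOp n : Module.End ℂ (HilbertP p d)) = elemOp (-n) := by
  refine (LinearMap.eq_adjoint_iff _ _).2 (fun φ ψ => ?_) |>.symm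
  rw [← inner_elemOp_elemOp n, ← Module.End.mul_apply, elemOp_mul_neg hp, Module.End.one_apply]

theorem trace_elemOp (n : PhaseP p d) :
    LinearMap.trace ℂ (HilbertP p d) (elemOp n) = if n = 0 then (p : ℂ) ^ d else 0 := by
  classical
  rw [LinearMap.trace_eq_sum_inner _ (EuclideanSpace.basisFun (Fin d → ZMod p) ℂ)]
  simp only [EuclideanSpace.basisFun_apply, EuclideanSpace.inner_single_left, map_one, one_mul,
    elemOp_apply, PiLp.single_apply, add_eq_left]
  by_cases hl : n ∘ Sum.inl = 0
  · have n_eq_zero_iff : dotProductBilin (ZMod p) (ZMod p) (n ∘ Sum.inr) = 0 ↔ n = 0 :=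
      ⟨fun h => phaseP_ext hl (dotProduct_eq_zero _ fun v => DFunLike.congr_fun h v),
        by rintro rfl; exact map_zero _⟩
    have := sum_stdAddChar_linearMap (dotProductBilin (ZMod p) (ZMod p) (n ∘ Sum.inr))
    simp only [n_eq_zero_iff] at this
    simpa [hl, ZMod.card] using this
  · have : n ≠ 0 := by rintro rfl; exact hl rfl
    simp only [hl, this, if_false, mul_zero, Finset.sum_const_zero]

theorem trace_elemOp_mul_neg (hp : p ≠ 2) (m n : PhaseP p d) :
    LinearMap.trace ℂ (HilbertP p d) (elemOp m * elemOp (-n)) =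
      if m = n then (p : ℂ) ^ d else 0 := by
  rw [elemOp_mul hp, map_smul, trace_elemOp]
  rcases eq_or_ne m n with rfl | h
  · simp [sympForm_neg_right, sympForm_self]
  · rw [if_neg h, if_neg (by rwa [← sub_eq_add_neg, sub_eq_zero]), smul_zero]

theorem pow_prime_ne_zero (p d : ℕ) [Fact p.Prime] : (p : ℂ) ^ d ≠ 0 :=
  pow_ne_zero _ (Nat.cast_ne_zero.2 (Fact.out : p.Prime).ne_zero)

theorem linearIndependent_elemOp (hp : p ≠ 2) :
    LinearIndependent ℂ (elemOp : PhaseP p d → Module.End ℂ (HilbertP p d)) := by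
  refine Fintype.linearIndependent_iff.2 fun c hc n => ?_
  have := congrArg (fun X => LinearMap.trace ℂ (HilbertP p d) (X * elemOp (-n))) hc
  simp only [Finset.sum_mul, smul_mul_assoc, map_sum, map_smul, trace_elemOp_mul_neg hp,
    smul_eq_mul, mul_ite, mul_zero, Finset.sum_ite_eq', Finset.mem_univ, if_true, zero_mul,
    map_zero] at this
  exact (mul_eq_zero.1 this).resolve_right (pow_prime_ne_zero p d)

theorem span_range_elemOp (hp : p ≠ 2) :
    Submodule.span ℂ (Set.range (elemOp : PhaseP p d → Module.End ℂ (HilbertP p d))) = ⊤ := by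
  refine (linearIndependent_elemOp hp).span_eq_top_of_card_eq_finrank' ?_
  rw [Module.finrank_linearMap, finrank_euclideanSpace, card_phaseP, Fintype.card_fun, ZMod.card,
    Fintype.card_fin]

theorem sum_elemOp_mul_mul_elemOp_neg (hp : p ≠ 2) (X : Module.End ℂ (HilbertP p d)) :
    ∑ n : PhaseP p d, elemOp n * X * elemOp (-n) =
      ((p : ℂ) ^ d * LinearMap.trace ℂ _ X) • (1 : Module.End ℂ (HilbertP p d)) := by
  have X_mem : X ∈ Submodule.span ℂ (Set.range elemOp) := by
    rw [span_range_elemOp hp]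
    trivial
  induction X_mem using Submodule.span_induction with
  | mem _ h =>
    obtain ⟨m, rfl⟩ := h
    simp only [elemOp_mul_mul_neg hp, ← Finset.sum_smul, sympForm_swap _ m, trace_elemOp]
    rw [← Equiv.sum_comp (Equiv.neg (PhaseP p d))]
    simp only [Equiv.neg_apply, sympForm_neg_right, neg_neg, sum_stdAddChar_sympForm]
    split_ifs with h
    · rw [h, elemOp_zero]
    · simp only [zero_smul, mul_zero]
  | zero => simp only [mul_zero, zero_mul, Finset.sum_const_zero, map_zero, zero_smul]
  | add X Y _ _ hX hY =>
    simp only [mul_add, add_mul, Finset.sum_add_distrib, hX, hY, map_add, add_smul]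
  | smul c X _ hX =>
    simp only [mul_smul_comm, smul_mul_assoc, ← Finset.smul_sum, hX, map_smul, smul_smul,
      smul_eq_mul, mul_left_comm c]

theorem exists_eq_smul_one_of_commute_elemOp (hp : p ≠ 2) {X : Module.End ℂ (HilbertP p d)}
    (h : ∀ n : PhaseP p d, Commute (elemOp n : Module.End ℂ (HilbertP p d)) X) :
    ∃ c : ℂ, X = c • (1 : Module.End ℂ (HilbertP p d)) := by
  have twirl := sum_elemOp_mul_mul_elemOp_neg hp X
  simp only [(h _).eq, mul_assoc, elemOp_mul_neg hp, mul_one, Finset.sum_const,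
    Finset.card_univ, ← Nat.cast_smul_eq_nsmul ℂ] at twirl
  have card_ne_zero : (Fintype.card (PhaseP p d) : ℂ) ≠ 0 :=
    Nat.cast_ne_zero.2 Fintype.card_ne_zero
  exact ⟨_, by rw [← inv_smul_smul₀ card_ne_zero X, twirl, smul_smul]⟩

end ElementaryOperators

section DeterminantOnRange

variable {K V : Type*} [Field K] [AddCommGroup V] [Module K V] {e : Module.End K V}

theorem det_smul_add_one_sub_of_isIdempotentElem [FiniteDimensional K V]
    (he : IsIdempotentElem e) (c : K) :
    LinearMap.det (c • e + (1 - e)) = c ^ Module.finrank K (LinearMap.range e) := by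
  have proj := (LinearMap.isProj_range_iff_isIdempotentElem e).2 he
  set E := (LinearMap.range e).prodEquivOfIsCompl (LinearMap.ker e) proj.isCompl
  have conj_eq : c • e + (1 - e) =
      E.conj (LinearMap.prodMap (c • LinearMap.id) LinearMap.id) := by
    have block_eq : (LinearMap.prodMap (c • LinearMap.id) LinearMap.id :
        Module.End K (LinearMap.range e × LinearMap.ker e)) =
        c • LinearMap.prodMap LinearMap.id 0 +
          (LinearMap.id - LinearMap.prodMap LinearMap.id 0) := by
      ext <;> simp
    rw [block_eq, map_add, map_sub, map_smul, ← proj.eq_conj_prodMap, LinearEquiv.conj_id]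
    rfl
  rw [conj_eq, LinearEquiv.conj_apply, LinearMap.comp_assoc, LinearMap.det_conj,
    LinearMap.det_prodMap, LinearMap.det_smul, LinearMap.det_id, LinearMap.det_id, mul_one, mul_one]

/-- The determinant on the range of an idempotent `e` of an endomorphism `U` commuting with `e`,
computed by extending the restriction of `U` by the identity on the kernel of `e`. -/
def detOn (e U : Module.End K V) : K := LinearMap.det (U * e + (1 - e))

theorem detOn_one (e : Module.End K V) : detOn e 1 = 1 := by
  rw [detOn, one_mul, add_sub_cancel, map_one]

theorem detOn_mul (he : IsIdempotentElem e) (U : Module.End K V) {W : Module.End K V}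
    (hW : Commute W e) : detOn e (U * W) = detOn e U * detOn e W := by
  rw [detOn, detOn, detOn, ← map_mul, add_mul, mul_add, mul_add, he.one_sub.eq, mul_assoc U e,
    mul_assoc U e, he.mul_one_sub_self, hW.eq, ← mul_assoc (1 - e), he.one_sub_mul_self,
    ← mul_assoc e, he.eq, mul_assoc U, hW.eq, zero_mul, mul_zero, add_zero, zero_add]

theorem detOn_ne_zero (he : IsIdempotentElem e) {U : Module.End K V} (hU : IsUnit U)
    (hUe : Commute U e) : detOn e U ≠ 0 := by
  obtain ⟨W, hW⟩ := hU.exists_left_inv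
  refine right_ne_zero_of_mul_eq_one (a := detOn e W) ?_
  rw [← detOn_mul he W hUe, hW, detOn_one]

theorem detOn_smul [FiniteDimensional K V] (he : IsIdempotentElem e) (c : K)
    (U : Module.End K V) :
    detOn e (c • U) = c ^ Module.finrank K (LinearMap.range e) * detOn e U := by
  have : detOn e (c • (1 : Module.End K V)) = c ^ Module.finrank K (LinearMap.range e) := by
    rw [← det_smul_add_one_sub_of_isIdempotentElem he c, detOn, smul_one_mul]
  rw [← this, mul_comm, ← detOn_mul he U ((Commute.one_left e).smul_left c), mul_smul_comm,
    mul_one]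

theorem exists_detOn_smul_of_trace_eq_add_one [FiniteDimensional K V] [CharZero K]
    (he : IsIdempotentElem e)
    (htr : LinearMap.trace K V e = LinearMap.trace K V (1 - e) + 1) :
    ∃ k : ℕ, ∀ (c : K) (U : Module.End K V), detOn e (c • U) = c ^ (k + 1) * detOn e U ∧
      detOn (1 - e) (c • U) = c ^ k * detOn (1 - e) U := by
  have trace_eq {f : Module.End K V} (hf : IsIdempotentElem f) :
      LinearMap.trace K V f = Module.finrank K (LinearMap.range f) :=
    ((LinearMap.isProj_range_iff_isIdempotentElem f).2 hf).trace
  rw [trace_eq he, trace_eq he.one_sub] at htr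
  refine ⟨_, fun c U => ⟨?_, detOn_smul he.one_sub c U⟩⟩
  rw [detOn_smul he, ← Nat.cast_injective (R := K) (htr.trans (Nat.cast_add_one _).symm)]

end DeterminantOnRange

section AdjointDeterminant

variable {V : Type*} [NormedAddCommGroup V] [InnerProductSpace ℂ V] [FiniteDimensional ℂ V]

theorem det_star (U : Module.End ℂ V) : LinearMap.det (star U) = star (LinearMap.det U) := by
  let b := (stdOrthonormalBasis ℂ V)
  rw [← LinearMap.det_toMatrix b.toBasis, ← LinearMap.det_toMatrix b.toBasis,
    LinearMap.star_eq_adjoint, LinearMap.toMatrix_adjoint b b, det_conjTranspose]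

theorem detOn_star {e U : Module.End ℂ V} (hs : IsSelfAdjoint e) (hU : Commute U e) :
    detOn e (star U) = star (detOn e U) := by
  rw [detOn, detOn, ← det_star, star_add, star_sub, star_one, hU.eq, star_mul, hs.star_eq]

end AdjointDeterminant

section Intertwiners

theorem vecMul_inv_vecMul {p d : ℕ} [Fact p.Prime] (g : SpP p d) (m : PhaseP p d) :
    (m ᵥ* (g⁻¹).1) ᵥ* g.1 = m := by
  rw [vecMul_vecMul]
  exact (congrArg (m ᵥ* ·) (congrArg Subtype.val (inv_mul_cancel g))).trans (vecMul_one m)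

variable {p : ℕ} [Fact p.Prime] {d : ℕ}

/-- The intertwining relation `U⁻¹ T(m) U = T(m g)` of a quantization, written without the inverse
so that it makes sense for every endomorphism `U`. -/
def Intertwines (g : SpP p d) (U : Module.End ℂ (HilbertP p d)) : Prop :=
  ∀ m : PhaseP p d, elemOp m * U = U * elemOp (m ᵥ* g.1)

theorem intertwines_one : Intertwines (1 : SpP p d) 1 := fun m => by
  rw [OneMemClass.coe_one, vecMul_one, mul_one, one_mul]

theorem intertwines_one_iff_commute {U : Module.End ℂ (HilbertP p d)} :
    Intertwines (1 : SpP p d) U ↔ ∀ n : PhaseP p d, Commute (elemOp n) U := by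
  simp only [Intertwines, OneMemClass.coe_one, vecMul_one]
  rfl

namespace Intertwines

variable {g h : SpP p d} {U V : Module.End ℂ (HilbertP p d)}

theorem mul (hU : Intertwines g U) (hV : Intertwines h V) : Intertwines (g * h) (U * V) := by
  intro m
  rw [← mul_assoc, hU m, mul_assoc, hV, mul_assoc, vecMul_vecMul]
  rfl

theorem smul (hU : Intertwines g U) (c : ℂ) : Intertwines g (c • U) := fun m => by
  rw [mul_smul_comm, hU, smul_mul_assoc]

theorem star (hp : p ≠ 2) (hU : Intertwines g U) : Intertwines g⁻¹ (star U) := by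
  intro m
  have := congrArg Star.star (hU (-(m ᵥ* (g⁻¹).1)))
  rwa [star_mul, star_mul, star_elemOp hp, neg_neg, star_elemOp hp, neg_vecMul, neg_neg,
    vecMul_inv_vecMul, eq_comm] at this

theorem exists_star_mul_self_eq_smul (hp : p ≠ 2) (hU : Intertwines g U) :
    ∃ c : ℂ, Star.star U * U = c • (1 : Module.End ℂ (HilbertP p d)) := by
  have := (hU.star hp).mul hU
  rw [inv_mul_cancel, intertwines_one_iff_commute] at this
  exact exists_eq_smul_one_of_commute_elemOp hp this

theorem isUnit (hp : p ≠ 2) (hU : Intertwines g U) (h0 : U ≠ 0) : IsUnit U := by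
  obtain ⟨c, hc⟩ := hU.exists_star_mul_self_eq_smul hp
  have c_ne_zero : c ≠ 0 := by
    rintro rfl
    refine h0 (LinearMap.ext fun ψ => ?_)
    rw [LinearMap.zero_apply, ← inner_self_eq_zero (𝕜 := ℂ), ← LinearMap.adjoint_inner_left,
      ← LinearMap.star_eq_adjoint, ← Module.End.mul_apply, hc, zero_smul, LinearMap.zero_apply,
      inner_zero_left]
  refine IsUnit.of_mul_eq_one_right (c⁻¹ • Star.star U) ?_
  rw [smul_mul_assoc, hc, inv_smul_smul₀ c_ne_zero]

theorem exists_eq_smul (hp : p ≠ 2) (hU : Intertwines g U) (h0 : U ≠ 0)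
    (hV : Intertwines g V) : ∃ c : ℂ, V = c • U := by
  obtain ⟨W, hWU⟩ := (hU.isUnit hp h0).exists_left_inv
  have mul_W : U * W = 1 := mul_eq_one_comm.1 hWU
  have W_intertwines : Intertwines g⁻¹ W := by
    intro m
    have := congrArg (fun X => W * X * W) (hU (m ᵥ* (g⁻¹).1))
    simpa only [mul_assoc, mul_W, mul_one, ← mul_assoc W U, hWU, one_mul,
      vecMul_inv_vecMul]
      using this.symm
  have := W_intertwines.mul hV
  rw [inv_mul_cancel, intertwines_one_iff_commute] at this
  obtain ⟨c, hc⟩ := exists_eq_smul_one_of_commute_elemOp hp this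
  exact ⟨c, by rw [← one_mul V, ← mul_W, mul_assoc, hc, mul_smul_comm, mul_one]⟩

end Intertwines

theorem intertwines_sum_elemOp_mul_mul_elemOp (hp : p ≠ 2) (g : SpP p d)
    (X : Module.End ℂ (HilbertP p d)) :
    Intertwines g (∑ n : PhaseP p d, elemOp n * X * elemOp (-n ᵥ* g.1)) := by
  intro m
  rw [Finset.mul_sum, Finset.sum_mul]
  refine Fintype.sum_equiv (Equiv.addLeft m) _ _ fun n => ?_
  rw [Equiv.coe_addLeft, ← mul_assoc, ← mul_assoc, elemOp_mul hp,
    mul_assoc _ (elemOp _) (elemOp (m ᵥ* g.1)), elemOp_mul hp, sympForm_vecMul_vecMul,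
    sympForm_neg_left, sympForm_add_left, sympForm_self, zero_add, ← add_vecMul,
    smul_mul_assoc, smul_mul_assoc, mul_smul_comm, sympForm_swap n m,
    neg_neg, neg_add_rev, add_assoc, neg_add_cancel, add_zero]

theorem exists_intertwines_ne_zero (hp : p ≠ 2) (g : SpP p d) :
    ∃ U : Module.End ℂ (HilbertP p d), U ≠ 0 ∧ Intertwines g U := by
  obtain ⟨v, hv⟩ := exists_ne (0 : HilbertP p d)
  -- Otherwise averaging annihilates all operators of rank one, against the linear independence
  -- of the `T(n)`.
  by_contra! h
  have sum_eq_zero (u : HilbertP p d) :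
      ∑ n : PhaseP p d, inner ℂ v (elemOp (-n ᵥ* g.1) v) • (elemOp n) u = 0 := by
    have : ∑ n : PhaseP p d, elemOp n * (innerₛₗ ℂ v).smulRight u * elemOp (-n ᵥ* g.1) = 0 :=
      of_not_not fun h0 => h _ h0 (intertwines_sum_elemOp_mul_mul_elemOp hp g _)
    simpa only [LinearMap.sum_apply, Module.End.mul_apply, LinearMap.smulRight_apply, map_smul,
      innerₛₗ_apply_apply, LinearMap.zero_apply] using congrArg (· v) this
  have coeff_eq_zero := Fintype.linearIndependent_iff.1 (linearIndependent_elemOp hp)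
    (fun n => inner ℂ v (elemOp (-n ᵥ* g.1) v))
    (LinearMap.ext fun u => by
      simpa only [LinearMap.sum_apply, LinearMap.smul_apply, LinearMap.zero_apply]
        using sum_eq_zero u) 0
  rw [neg_zero, zero_vecMul, elemOp_zero, Module.End.one_apply, inner_self_eq_zero] at coeff_eq_zero
  exact hv coeff_eq_zero

end Intertwiners

section Parity

variable {p : ℕ} [Fact p.Prime] {d : ℕ}

/-- The parity operator `ψ(y) ↦ ψ(-y)`. -/
def parityOp (p d : ℕ) [Fact p.Prime] : Module.End ℂ (HilbertP p d) :=
  (LinearIsometryEquiv.piLpCongrLeft 2 ℂ ℂ (Equiv.neg (Fin d → ZMod p))).toLinearEquiv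

theorem parityOp_apply (ψ : HilbertP p d) (y : Fin d → ZMod p) : parityOp p d ψ y = ψ (-y) := rfl

theorem parityOp_mul_self : parityOp p d * parityOp p d = 1 := by
  ext1 ψ
  ext1 y
  rw [Module.End.mul_apply, parityOp_apply, parityOp_apply, neg_neg, Module.End.one_apply]

theorem isSelfAdjoint_parityOp : IsSelfAdjoint (parityOp p d) := by
  refine (LinearMap.eq_adjoint_iff _ _).2 (fun φ ψ => ?_) |>.symm
  simp only [PiLp.inner_apply]
  refine Fintype.sum_equiv (Equiv.neg _) _ _ fun y => ?_
  rw [parityOp_apply, parityOp_apply, Equiv.neg_apply, neg_neg]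

theorem trace_parityOp (hp : p ≠ 2) : LinearMap.trace ℂ _ (parityOp p d) = 1 := by
  have neg_eq_self_iff (y : Fin d → ZMod p) : -y = y ↔ y = 0 := by
    refine ⟨fun h => funext fun i => ?_, by rintro rfl; exact neg_zero⟩
    have : 2⁻¹ * y i + 2⁻¹ * y i = 0 := by
      rw [← mul_add, add_eq_zero_iff_neg_eq.2 (congrFun h i), mul_zero]
    rwa [← add_mul, inv_two_add_inv_two hp, one_mul] at this
  rw [LinearMap.trace_eq_sum_inner _ (EuclideanSpace.basisFun (Fin d → ZMod p) ℂ)]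
  simp only [EuclideanSpace.basisFun_apply, EuclideanSpace.inner_single_left, map_one, one_mul,
    parityOp_apply, PiLp.single_apply, neg_eq_self_iff, Finset.sum_ite_eq', Finset.mem_univ,
    if_true]

theorem parityOp_mul_elemOp (n : PhaseP p d) :
    parityOp p d * elemOp n = elemOp (-n) * parityOp p d := by
  ext1 ψ
  ext1 y
  have inl : (-n) ∘ Sum.inl = -(n ∘ Sum.inl) := rfl
  have inr : (-n) ∘ Sum.inr = -(n ∘ Sum.inr) := rfl
  rw [Module.End.mul_apply, Module.End.mul_apply, parityOp_apply, elemOp_apply, elemOp_apply,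
    parityOp_apply, inl, inr, neg_dotProduct_neg, neg_dotProduct, dotProduct_neg, neg_add, neg_neg]

theorem Intertwines.commute_parityOp (hp : p ≠ 2) {g : SpP p d} {U : Module.End ℂ (HilbertP p d)}
    (hU : Intertwines g U) : Commute U (parityOp p d) := by
  rcases eq_or_ne U 0 with rfl | h0
  · exact Commute.zero_left _
  have conj_intertwines : Intertwines g (parityOp p d * U * parityOp p d) := by
    intro m
    rw [← mul_assoc, ← mul_assoc, ← neg_neg m, ← parityOp_mul_elemOp, mul_assoc (parityOp p d),
      hU, neg_vecMul, neg_neg, mul_assoc, mul_assoc, ← neg_neg (m ᵥ* g.1), ← parityOp_mul_elemOp,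
      neg_neg, mul_assoc, mul_assoc]
  obtain ⟨c, hc⟩ := hU.exists_eq_smul hp h0 conj_intertwines
  have parity_mul : parityOp p d * U = c • (U * parityOp p d) := by
    rw [← smul_mul_assoc, ← hc, mul_assoc, parityOp_mul_self, mul_one]
  obtain ⟨W, hW⟩ := (hU.isUnit hp h0).exists_right_inv
  -- `P` and `U P U⁻¹` have the same nonzero trace.
  have c_eq_one : c = 1 := by
    have := congrArg (fun X => LinearMap.trace ℂ _ (X * W)) parity_mul
    rwa [mul_assoc, hW, mul_one, smul_mul_assoc, map_smul, LinearMap.trace_mul_comm, ← mul_assoc,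
      mul_eq_one_comm.1 hW, one_mul, trace_parityOp hp, smul_eq_mul, mul_one, eq_comm] at this
  rw [c_eq_one, one_smul] at parity_mul
  exact parity_mul.symm

/-- The orthogonal projection onto the even functions. -/
def evenProj (p d : ℕ) [Fact p.Prime] : Module.End ℂ (HilbertP p d) :=
  (2⁻¹ : ℂ) • (1 + parityOp p d)

theorem isIdempotentElem_evenProj : IsIdempotentElem (evenProj p d) := by
  have : (1 + parityOp p d) * (1 + parityOp p d) = (2 : ℂ) • (1 + parityOp p d) := by
    rw [add_mul, mul_add, mul_add, parityOp_mul_self, two_smul, one_mul, one_mul, mul_one,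
      add_comm 1 (parityOp p d)]
  rw [IsIdempotentElem, evenProj, smul_mul_assoc, mul_smul_comm, this, inv_smul_smul₀ two_ne_zero]

theorem isSelfAdjoint_evenProj : IsSelfAdjoint (evenProj p d) := by
  have : star (2⁻¹ : ℂ) = 2⁻¹ := by simp
  rw [isSelfAdjoint_iff, evenProj, star_smul, star_add, star_one, isSelfAdjoint_parityOp.star_eq,
    this]

/-- The orthogonal projection onto the odd functions. -/
def oddProj (p d : ℕ) [Fact p.Prime] : Module.End ℂ (HilbertP p d) := 1 - evenProj p d

theorem isIdempotentElem_oddProj : IsIdempotentElem (oddProj p d) :=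
  isIdempotentElem_evenProj.one_sub

theorem isSelfAdjoint_oddProj : IsSelfAdjoint (oddProj p d) := by
  rw [isSelfAdjoint_iff, oddProj, star_sub, star_one, isSelfAdjoint_evenProj.star_eq]

theorem exists_detOn_evenProj_smul (hp : p ≠ 2) : ∃ k : ℕ, ∀ (c : ℂ)
    (U : Module.End ℂ (HilbertP p d)),
    detOn (evenProj p d) (c • U) = c ^ (k + 1) * detOn (evenProj p d) U ∧
      detOn (oddProj p d) (c • U) = c ^ k * detOn (oddProj p d) U := by
  refine exists_detOn_smul_of_trace_eq_add_one isIdempotentElem_evenProj ?_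
  rw [map_sub, evenProj, map_smul, map_add, trace_parityOp hp, smul_eq_mul]
  ring

theorem Intertwines.commute_evenProj (hp : p ≠ 2) {g : SpP p d} {U : Module.End ℂ (HilbertP p d)}
    (hU : Intertwines g U) : Commute U (evenProj p d) :=
  ((Commute.one_right U).add_right (hU.commute_parityOp hp)).smul_right _

theorem Intertwines.commute_oddProj (hp : p ≠ 2) {g : SpP p d} {U : Module.End ℂ (HilbertP p d)}
    (hU : Intertwines g U) : Commute U (oddProj p d) :=
  (Commute.one_right U).sub_right (hU.commute_evenProj hp)

end Parity

section WeilRepresentation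

variable {p : ℕ} [Fact p.Prime] {d : ℕ} {g h : SpP p d} {U V : Module.End ℂ (HilbertP p d)}

/-- Intertwiners normalised to have the same determinant on the even and on the odd functions.
Scaling by `c` changes the quotient of the two determinants by the factor `c`, since the spaces of
even and odd functions differ in dimension by one. -/
structure IsNormalIntertwiner (g : SpP p d) (U : Module.End ℂ (HilbertP p d)) : Prop where
  intertwines : Intertwines g U
  ne_zero : U ≠ 0
  detOn_eq : detOn (evenProj p d) U = detOn (oddProj p d) U

theorem Intertwines.detOn_evenProj_ne_zero (hp : p ≠ 2) (hU : Intertwines g U) (h0 : U ≠ 0) :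
    detOn (evenProj p d) U ≠ 0 :=
  detOn_ne_zero isIdempotentElem_evenProj (hU.isUnit hp h0) (hU.commute_evenProj hp)

theorem Intertwines.detOn_oddProj_ne_zero (hp : p ≠ 2) (hU : Intertwines g U) (h0 : U ≠ 0) :
    detOn (oddProj p d) U ≠ 0 :=
  detOn_ne_zero isIdempotentElem_oddProj (hU.isUnit hp h0) (hU.commute_oddProj hp)

theorem exists_isNormalIntertwiner (hp : p ≠ 2) (g : SpP p d) :
    ∃ U, IsNormalIntertwiner g U := by
  obtain ⟨U, h0, hU⟩ := exists_intertwines_ne_zero hp g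
  have even_ne_zero := hU.detOn_evenProj_ne_zero hp h0
  have odd_ne_zero := hU.detOn_oddProj_ne_zero hp h0
  obtain ⟨k, hk⟩ := exists_detOn_evenProj_smul (d := d) hp
  refine ⟨(detOn (oddProj p d) U / detOn (evenProj p d) U) • U, hU.smul _,
    smul_ne_zero (div_ne_zero odd_ne_zero even_ne_zero) h0, ?_⟩
  rw [(hk _ U).1, (hk _ U).2, pow_succ, mul_assoc, div_mul_cancel₀ _ even_ne_zero]

namespace IsNormalIntertwiner

theorem unique (hp : p ≠ 2) (hU : IsNormalIntertwiner g U) (hV : IsNormalIntertwiner g V) :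
    V = U := by
  obtain ⟨c, rfl⟩ := hU.intertwines.exists_eq_smul hp hU.ne_zero hV.intertwines
  have c_ne_zero : c ≠ 0 := left_ne_zero_of_smul hV.ne_zero
  obtain ⟨k, hk⟩ := exists_detOn_evenProj_smul (d := d) hp
  have := hV.detOn_eq
  rw [(hk _ U).1, (hk _ U).2, ← hU.detOn_eq, pow_succ, mul_assoc] at this
  have := mul_left_cancel₀ (pow_ne_zero _ c_ne_zero) this
  rw [(mul_eq_right₀ (hU.intertwines.detOn_evenProj_ne_zero hp hU.ne_zero)).1 this, one_smul]

theorem one : IsNormalIntertwiner (1 : SpP p d) 1 :=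
  ⟨intertwines_one, one_ne_zero, by rw [detOn_one, detOn_one]⟩

theorem mul (hp : p ≠ 2) (hU : IsNormalIntertwiner g U) (hV : IsNormalIntertwiner h V) :
    IsNormalIntertwiner (g * h) (U * V) := by
  refine ⟨hU.intertwines.mul hV.intertwines, ?_, ?_⟩
  · exact ((hU.intertwines.isUnit hp hU.ne_zero).mul (hV.intertwines.isUnit hp hV.ne_zero)).ne_zero
  · rw [detOn_mul isIdempotentElem_evenProj _ (hV.intertwines.commute_evenProj hp),
      detOn_mul isIdempotentElem_oddProj _ (hV.intertwines.commute_oddProj hp), hU.detOn_eq,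
      hV.detOn_eq]

theorem star (hp : p ≠ 2) (hU : IsNormalIntertwiner g U) : IsNormalIntertwiner g⁻¹ (star U) := by
  refine ⟨hU.intertwines.star hp, star_ne_zero.2 hU.ne_zero, ?_⟩
  rw [detOn_star isSelfAdjoint_evenProj (hU.intertwines.commute_evenProj hp),
    detOn_star isSelfAdjoint_oddProj (hU.intertwines.commute_oddProj hp), hU.detOn_eq]

theorem star_mul_self (hp : p ≠ 2) (hU : IsNormalIntertwiner g U) : Star.star U * U = 1 :=
  one.unique hp (inv_mul_cancel g ▸ (hU.star hp).mul hp hU)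

end IsNormalIntertwiner

theorem exists_monoidHom_isNormalIntertwiner (hp : p ≠ 2) (d : ℕ) :
    ∃ W : SpP p d →* Module.End ℂ (HilbertP p d), ∀ g, IsNormalIntertwiner g (W g) := by
  choose W hW using exists_isNormalIntertwiner (p := p) (d := d) hp
  exact ⟨⟨⟨W, IsNormalIntertwiner.one.unique hp (hW 1)⟩,
    fun g h => ((hW g).mul hp (hW h)).unique hp (hW (g * h))⟩, hW⟩

theorem exists_isQuantization (hp : p ≠ 2) (d : ℕ) :
    ∃ U : SpP p d →* (HilbertP p d ≃ₗᵢ[ℂ] HilbertP p d), IsQuantization U := by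
  obtain ⟨W, hW⟩ := exists_monoidHom_isNormalIntertwiner hp d
  let L : SpP p d →* (HilbertP p d ≃ₗ[ℂ] HilbertP p d) :=
    (LinearMap.GeneralLinearGroup.generalLinearEquiv ℂ (HilbertP p d)).toMonoidHom.comp W.toHomUnits
  have inner_L (g : SpP p d) (φ ψ : HilbertP p d) : inner ℂ (L g φ) (L g ψ) = inner ℂ φ ψ := by
    change inner ℂ (W g φ) (W g ψ) = _
    rw [← LinearMap.adjoint_inner_left, ← LinearMap.star_eq_adjoint, ← Module.End.mul_apply,
      (hW g).star_mul_self hp, Module.End.one_apply]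
  refine ⟨⟨⟨fun g => (L g).isometryOfInner (inner_L g), ?_⟩, fun g h => ?_⟩, fun g n ψ => ?_⟩
  · ext1 ψ
    exact LinearEquiv.congr_fun (map_one L) ψ
  · ext1 ψ
    exact LinearEquiv.congr_fun (map_mul L g h) ψ
  · rw [LinearIsometryEquiv.inv_def, LinearIsometryEquiv.symm_apply_eq]
    exact LinearMap.congr_fun ((hW g).intertwines n) ψ

end WeilRepresentation

section Transvections

theorem vecMul_toMatrix'_transpose {K ι : Type*} [CommRing K] [Fintype ι] [DecidableEq ι]
    (f : (ι → K) →ₗ[K] (ι → K)) (v : ι → K) : v ᵥ* (LinearMap.toMatrix' f)ᵀ = f v := by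
  rw [vecMul_transpose, LinearMap.toMatrix'_mulVec]

variable {p d : ℕ}

theorem spP_ext {B C : SpP p d} (h : ∀ v : PhaseP p d, v ᵥ* B.1 = v ᵥ* C.1) : B = C :=
  Subtype.ext (Matrix.ext_of_single_vecMul fun _ => h _)

theorem vecMul_mul_spP (v : PhaseP p d) (B C : SpP p d) :
    v ᵥ* (B * C).1 = (v ᵥ* B.1) ᵥ* C.1 :=
  (vecMul_vecMul v B.1 C.1).symm

theorem vecMul_one_spP (v : PhaseP p d) : v ᵥ* (1 : SpP p d).1 = v := vecMul_one v

/-- The symplectic matrix of a linear map that preserves the symplectic form. -/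
def spOfLinearMap (f : PhaseP p d →ₗ[ZMod p] PhaseP p d)
    (hf : ∀ m n, sympForm (f m) (f n) = sympForm m n) : SpP p d :=
  ⟨(LinearMap.toMatrix' f)ᵀ, (mem_symplecticGroup_iff _).2 fun m n => by
    rw [vecMul_toMatrix'_transpose, vecMul_toMatrix'_transpose, hf]⟩

theorem vecMul_spOfLinearMap (f : PhaseP p d →ₗ[ZMod p] PhaseP p d)
    (hf : ∀ m n, sympForm (f m) (f n) = sympForm m n) (v : PhaseP p d) :
    v ᵥ* (spOfLinearMap f hf).1 = f v :=
  vecMul_toMatrix'_transpose f v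

variable [Fact p.Prime]

/-- The symplectic transvection `v ↦ v + a ω(v, u) u`. -/
def sympTransvection (u : PhaseP p d) (a : ZMod p) : SpP p d :=
  spOfLinearMap (LinearMap.id + (a • LinearMap.flip (sympBilin p d) u).smulRight u) fun m n => by
    simp only [LinearMap.add_apply, LinearMap.id_apply, LinearMap.smulRight_apply,
      LinearMap.smul_apply, LinearMap.flip_apply, sympBilin_apply, sympForm_add_left,
      sympForm_add_right, sympForm_smul_left, sympForm_smul_right, sympForm_self, sympForm_swap u n,
      smul_eq_mul]
    ring

theorem vecMul_sympTransvection (u : PhaseP p d) (a : ZMod p) (v : PhaseP p d) :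
    v ᵥ* (sympTransvection u a).1 = v + (a * sympForm v u) • u :=
  vecMul_spOfLinearMap _ _ v

theorem sympTransvection_pow (u : PhaseP p d) (a : ZMod p) (k : ℕ) :
    sympTransvection u a ^ k = sympTransvection u (k * a) := by
  induction k with
  | zero =>
    refine spP_ext fun v => ?_
    rw [pow_zero, vecMul_one_spP, vecMul_sympTransvection, Nat.cast_zero, zero_mul, zero_mul,
      zero_smul, add_zero]
  | succ k ih =>
    refine spP_ext fun v => ?_
    rw [pow_succ, vecMul_mul_spP, ih, vecMul_sympTransvection, vecMul_sympTransvection,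
      vecMul_sympTransvection, sympForm_add_left, sympForm_smul_left, sympForm_self, mul_zero,
      add_zero, add_assoc, ← add_smul, ← add_mul, Nat.cast_succ, add_one_mul (k : ZMod p)]

theorem sympTransvection_pow_prime (u : PhaseP p d) (a : ZMod p) :
    sympTransvection u a ^ p = 1 := by
  refine spP_ext fun v => ?_
  rw [sympTransvection_pow, CharP.cast_eq_zero, zero_mul, vecMul_sympTransvection, zero_mul,
    zero_smul, add_zero, vecMul_one_spP]

theorem vecMul_sympTransvection_sub {v w : PhaseP p d} (h : sympForm v w ≠ 0) :
    v ᵥ* (sympTransvection (w - v) (sympForm v w)⁻¹).1 = w := by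
  rw [vecMul_sympTransvection, sympForm_sub_right, sympForm_self, sub_zero,
    inv_mul_cancel₀ h, one_smul, add_sub_cancel]

/-- The vectors fixed by a symplectic matrix. -/
def fixedSpace (g : SpP p d) : Submodule (ZMod p) (PhaseP p d) :=
  LinearMap.eqLocus (Matrix.vecMulLinear g.1) LinearMap.id

theorem mem_fixedSpace {g : SpP p d} {v : PhaseP p d} : v ∈ fixedSpace g ↔ v ᵥ* g.1 = v := Iff.rfl

theorem fixedSpace_le_fixedSpace_mul_sympTransvection (g : SpP p d) (v : PhaseP p d) (a : ZMod p) :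
    fixedSpace g ≤ fixedSpace (g * sympTransvection (v - v ᵥ* g.1) a) := fun w hw => by
  have orthogonal : sympForm w (v - v ᵥ* g.1) = 0 := by
    rw [sympForm_sub_right, sub_eq_zero, ← sympForm_vecMul_vecMul g w v, mem_fixedSpace.1 hw]
  rw [mem_fixedSpace, vecMul_mul_spP, mem_fixedSpace.1 hw, vecMul_sympTransvection, orthogonal,
    mul_zero, zero_smul, add_zero]

theorem exists_fixedSpace_lt_of_sympForm_ne_zero {g : SpP p d} {v : PhaseP p d}
    (hv : sympForm (v ᵥ* g.1) v ≠ 0) :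
    ∃ u a, fixedSpace g < fixedSpace (g * sympTransvection u a) := by
  refine ⟨v - v ᵥ* g.1, (sympForm (v ᵥ* g.1) v)⁻¹, SetLike.lt_iff_le_and_exists.2
    ⟨fixedSpace_le_fixedSpace_mul_sympTransvection g v _, v, ?_, fun h => hv ?_⟩⟩
  · rw [mem_fixedSpace, vecMul_mul_spP, vecMul_sympTransvection_sub hv]
  · rw [mem_fixedSpace.1 h, sympForm_self]

-- If `ω(v g, v)` vanishes identically, a transvection along `Im (1 - g) = Fix(g)^⊥` destroys this
-- without moving the fixed vectors.
theorem exists_fixedSpace_le_sympForm_ne_zero {g : SpP p d} (hg : g ≠ 1)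
    (h0 : ∀ v, sympForm (v ᵥ* g.1) v = 0) :
    ∃ u w, fixedSpace g ≤ fixedSpace (g * sympTransvection u 1) ∧
      sympForm (w ᵥ* (g * sympTransvection u 1).1) w ≠ 0 := by
  obtain ⟨v, hv⟩ : ∃ v : PhaseP p d, v - v ᵥ* g.1 ≠ 0 := by
    by_contra! h
    exact hg (spP_ext fun v => (sub_eq_zero.1 (h v)).symm.trans (vecMul_one_spP v).symm)
  obtain ⟨w, hw⟩ : ∃ w, sympForm (v - v ᵥ* g.1) w ≠ 0 := by
    by_contra! h
    exact hv (eq_zero_of_sympForm_eq_zero h)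
  refine ⟨v - v ᵥ* g.1, w, fixedSpace_le_fixedSpace_mul_sympTransvection g v 1, ?_⟩
  have polar : sympForm (w ᵥ* g.1) v = sympForm w (v ᵥ* g.1) := by
    have := h0 (v + w)
    rw [add_vecMul, sympForm_add_left, sympForm_add_right, sympForm_add_right, h0, h0, zero_add,
      add_zero, sympForm_swap, neg_add_eq_zero] at this
    exact this.symm
  have pairing : sympForm (w ᵥ* g.1) (v - v ᵥ* g.1) = sympForm (v - v ᵥ* g.1) w := by
    rw [sympForm_swap _ w, sympForm_sub_right, sympForm_sub_right, sympForm_vecMul_vecMul, polar,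
      neg_sub]
  rw [vecMul_mul_spP, vecMul_sympTransvection, sympForm_add_left, h0, zero_add, one_mul,
    sympForm_smul_left, pairing]
  exact mul_ne_zero hw hw

theorem mem_of_forall_sympTransvection_mem {N : Subgroup (SpP p d)}
    (hN : ∀ u a, sympTransvection u a ∈ N) (g : SpP p d) : g ∈ N := by
  induction hF : fixedSpace g using WellFoundedGT.induction generalizing g with
  | ind F ih =>
    subst hF
    have mem_of_fixedSpace_le {h : SpP p d} (hle : fixedSpace g ≤ fixedSpace h) {v : PhaseP p d}
        (hv : sympForm (v ᵥ* h.1) v ≠ 0) : h ∈ N := by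
      obtain ⟨u, a, hlt⟩ := exists_fixedSpace_lt_of_sympForm_ne_zero hv
      exact (N.mul_mem_cancel_right (hN u a)).1 (ih _ (hle.trans_lt hlt) _ rfl)
    by_cases hg : g = 1
    · exact hg ▸ one_mem N
    by_cases h0 : ∀ v, sympForm (v ᵥ* g.1) v = 0
    · obtain ⟨u, w, hle, hw⟩ := exists_fixedSpace_le_sympForm_ne_zero hg h0
      exact (N.mul_mem_cancel_right (hN u 1)).1 (mem_of_fixedSpace_le hle hw)
    · obtain ⟨v, hv⟩ := not_forall.1 h0
      exact mem_of_fixedSpace_le le_rfl hv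

theorem map_spP_pow_prime_eq_one {M : Type*} [CommGroup M] (f : SpP p d →* M) (g : SpP p d) :
    f g ^ p = 1 := by
  have mem_ker : g ∈ ((powMonoidHom p).comp f).ker :=
    mem_of_forall_sympTransvection_mem (fun u a => by
      rw [MonoidHom.mem_ker, MonoidHom.comp_apply, powMonoidHom_apply, ← map_pow,
        sympTransvection_pow_prime, map_one]) g
  exact MonoidHom.mem_ker.1 mem_ker

end Transvections

section OrthogonalIdempotents

variable {ι K V : Type*} [Field K] [AddCommGroup V] [Module K V] [FiniteDimensional K V]
  {e : ι → Module.End K V}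

theorem det_sum_smul_add_one_sub_of_orthogonalIdempotents (he : OrthogonalIdempotents e)
    (c : ι → K) (s : Finset ι) :
    LinearMap.det (∑ i ∈ s, c i • e i + (1 - ∑ i ∈ s, e i)) =
      ∏ i ∈ s, c i ^ Module.finrank K (LinearMap.range (e i)) := by
  classical
  induction s using Finset.induction_on with
  | empty => simp
  | insert j s hj ih =>
    have mul_sum_smul : e j * ∑ i ∈ s, c i • e i = 0 := by
      rw [Finset.mul_sum]
      refine Finset.sum_eq_zero fun i hi => ?_
      rw [mul_smul_comm, he.ortho (ne_of_mem_of_not_mem hi hj).symm, smul_zero]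
    rw [Finset.prod_insert hj, ← ih, ← det_smul_add_one_sub_of_isIdempotentElem (he.idem j),
      ← map_mul, Finset.sum_insert hj, Finset.sum_insert hj]
    congr 1
    simp only [mul_add, mul_sub, add_mul, sub_mul, one_mul, mul_one, smul_mul_assoc,
      mul_sum_smul, he.mul_sum_of_notMem hj, smul_zero]
    abel

theorem det_sum_smul_of_completeOrthogonalIdempotents [Fintype ι]
    (he : CompleteOrthogonalIdempotents e) (c : ι → K) :
    LinearMap.det (∑ i, c i • e i) = ∏ i, c i ^ Module.finrank K (LinearMap.range (e i)) := by
  rw [← det_sum_smul_add_one_sub_of_orthogonalIdempotents he.1 c Finset.univ, he.complete,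
    sub_self, add_zero]

end OrthogonalIdempotents

section JointEigenspaces

section Group

variable {G V : Type*} [Group G] [AddCommGroup V] [Module ℂ V]

/-- The joint eigenspace of a representation for a linear character. -/
def jointEigenspace (ρ : G →* Module.End ℂ V) (χ : G →* ℂˣ) : Submodule ℂ V :=
  ⨅ g, (ρ g).eigenspace (χ g : ℂ)

theorem mem_jointEigenspace {ρ : G →* Module.End ℂ V} {χ : G →* ℂˣ} {v : V} :
    v ∈ jointEigenspace ρ χ ↔ ∀ g, ρ g v = (χ g : ℂ) • v := by
  simp only [jointEigenspace, Submodule.mem_iInf, Module.End.mem_eigenspace_iff]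

variable [Fintype G] (ρ : G →* Module.End ℂ V) (χ : G →* ℂˣ)

/-- The projection onto a joint eigenspace, obtained by averaging. -/
def charProj : Module.End ℂ V :=
  (Fintype.card G : ℂ)⁻¹ • ∑ g : G, (χ g : ℂ) • ρ g⁻¹

theorem mul_charProj (h : G) : ρ h * charProj ρ χ = (χ h : ℂ) • charProj ρ χ := by
  rw [charProj, mul_smul_comm, smul_comm, Finset.mul_sum, Finset.smul_sum (r := (χ h : ℂ)),
    ← Equiv.sum_comp (Equiv.mulRight h) fun g => ρ h * (χ g : ℂ) • ρ g⁻¹]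
  refine congrArg _ (Finset.sum_congr rfl fun g _ => ?_)
  rw [Equiv.coe_mulRight, mul_smul_comm, ← map_mul, _root_.mul_inv_rev, mul_inv_cancel_left,
    map_mul, Units.val_mul, mul_comm, mul_smul]

theorem isProj_charProj : LinearMap.IsProj (jointEigenspace ρ χ) (charProj ρ χ) where
  map_mem v := mem_jointEigenspace.2 fun g => LinearMap.congr_fun (mul_charProj ρ χ g) v
  map_id v hv := by
    have (g : G) : (χ g : ℂ) • ρ g⁻¹ v = v := by
      rw [mem_jointEigenspace.1 hv, smul_smul, ← Units.val_mul, ← map_mul, mul_inv_cancel, map_one,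
        Units.val_one, one_smul]
    rw [charProj, LinearMap.smul_apply, LinearMap.sum_apply]
    simp only [LinearMap.smul_apply, this]
    rw [Finset.sum_const, Finset.card_univ, ← Nat.cast_smul_eq_nsmul ℂ,
      inv_smul_smul₀ (Nat.cast_ne_zero.2 Fintype.card_ne_zero)]

theorem trace_charProj [FiniteDimensional ℂ V] :
    LinearMap.trace ℂ V (charProj ρ χ) = Module.finrank ℂ (jointEigenspace ρ χ) :=
  (isProj_charProj ρ χ).trace

end Group

section CommGroup

variable {G V : Type*} [CommGroup G] [Fintype G] [Fintype (G →* ℂˣ)]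

theorem card_monoidHom_units : Fintype.card (G →* ℂˣ) = Fintype.card G :=
  Fintype.card_congr (CommGroup.monoidHom_mulEquiv_of_hasEnoughRootsOfUnity G ℂ).some.toEquiv

theorem sum_monoidHom_units_apply [DecidableEq G] (g : G) :
    ∑ χ : G →* ℂˣ, (χ g : ℂ) = if g = 1 then (Fintype.card G : ℂ) else 0 := by
  split_ifs with hg
  · simp only [hg, map_one, Units.val_one, Finset.sum_const, Finset.card_univ,
      card_monoidHom_units, nsmul_eq_mul, mul_one]
  · obtain ⟨ψ, hψ⟩ := CommGroup.exists_apply_ne_one_of_hasEnoughRootsOfUnity G ℂ hg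
    refine sum_hom_units_eq_zero ((Units.coeHom ℂ).comp (MonoidHom.eval g)) fun h => hψ ?_
    exact Units.ext (DFunLike.congr_fun h ψ)

variable [AddCommGroup V] [Module ℂ V] (ρ : G →* Module.End ℂ V)

omit [Fintype (G →* ℂˣ)] in
theorem charProj_mul_of_ne {χ χ' : G →* ℂˣ} (h : χ ≠ χ') :
    charProj ρ χ * charProj ρ χ' = 0 := by
  obtain ⟨g, hg⟩ := DFunLike.ne_iff.1 h
  have commute : Commute (ρ g) (charProj ρ χ) := by
    refine Commute.smul_right (Commute.sum_right _ _ _ fun k _ => Commute.smul_right ?_ _) _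
    rw [commute_iff_eq, ← map_mul, ← map_mul, mul_comm]
  have smul_eq_smul : (χ g : ℂ) • (charProj ρ χ * charProj ρ χ') =
      (χ' g : ℂ) • (charProj ρ χ * charProj ρ χ') := by
    rw [← smul_mul_assoc, ← mul_charProj, commute.eq, mul_assoc, mul_charProj, mul_smul_comm]
  exact of_not_not fun h0 => hg (Units.ext (smul_left_injective ℂ h0 smul_eq_smul))

theorem sum_smul_charProj (h : G) : ∑ χ : G →* ℂˣ, (χ h : ℂ) • charProj ρ χ = ρ h := by
  classical
  have coeff (g : G) : ∑ χ : G →* ℂˣ, (χ h : ℂ) * (χ g : ℂ) =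
      if h = g⁻¹ then (Fintype.card G : ℂ) else 0 := by
    simp only [← Units.val_mul, ← map_mul, sum_monoidHom_units_apply, mul_eq_one_iff_eq_inv]
  simp only [charProj, smul_comm _ (Fintype.card G : ℂ)⁻¹, Finset.smul_sum (r := Units.val _),
    smul_smul (Units.val _), ← Finset.smul_sum]
  rw [Finset.sum_comm]
  simp only [← Finset.sum_smul, coeff, ite_smul, zero_smul, ← inv_eq_iff_eq_inv (a := h)]
  rw [Finset.sum_ite_eq Finset.univ, if_pos (Finset.mem_univ _), inv_inv,
    inv_smul_smul₀ (Nat.cast_ne_zero.2 Fintype.card_ne_zero)]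

theorem completeOrthogonalIdempotents_charProj :
    CompleteOrthogonalIdempotents (charProj ρ) := by
  refine CompleteOrthogonalIdempotents.iff_ortho_complete.2
    ⟨fun χ χ' => charProj_mul_of_ne ρ, ?_⟩
  simpa only [map_one, Units.val_one, one_smul] using sum_smul_charProj ρ 1

end CommGroup

section Multiplicities

variable {G V : Type*} [CommGroup G] [Fintype (G →* ℂˣ)] [AddCommGroup V] [Module ℂ V]
  [FiniteDimensional ℂ V] (ρ : G →* Module.End ℂ V)

theorem trace_eq_sum_finrank_jointEigenspace_mul [Finite G] (g : G) :
    LinearMap.trace ℂ V (ρ g) =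
      ∑ χ : G →* ℂˣ, (Module.finrank ℂ (jointEigenspace ρ χ) : ℂ) * (χ g : ℂ) := by
  have := Fintype.ofFinite G
  rw [← sum_smul_charProj ρ g, map_sum]
  exact Finset.sum_congr rfl fun χ _ => by rw [map_smul, trace_charProj, smul_eq_mul, mul_comm]

theorem sum_finrank_jointEigenspace [Finite G] :
    ∑ χ, Module.finrank ℂ (jointEigenspace ρ χ) = Module.finrank ℂ V := by
  have := trace_eq_sum_finrank_jointEigenspace_mul ρ 1
  simp only [map_one, LinearMap.trace_one, Units.val_one, mul_one] at this
  exact_mod_cast this.symm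

theorem card_mul_sum_finrank_jointEigenspace_sq [Fintype G] :
    (Fintype.card G : ℂ) * ∑ χ, (Module.finrank ℂ (jointEigenspace ρ χ) : ℂ) ^ 2 =
      ∑ g, LinearMap.trace ℂ V (ρ g) * LinearMap.trace ℂ V (ρ g⁻¹) := by
  have sum_mul_trace (χ : G →* ℂˣ) : ∑ g, (χ g : ℂ) * LinearMap.trace ℂ V (ρ g⁻¹) =
      Fintype.card G * (Module.finrank ℂ (jointEigenspace ρ χ) : ℂ) := by
    rw [← trace_charProj, charProj, map_smul, map_sum, smul_eq_mul,
      mul_inv_cancel_left₀ (Nat.cast_ne_zero.2 Fintype.card_ne_zero)]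
    simp only [map_smul, smul_eq_mul]
  have trace_mul (g : G) : LinearMap.trace ℂ V (ρ g) * LinearMap.trace ℂ V (ρ g⁻¹) =
      ∑ χ : G →* ℂˣ, (Module.finrank ℂ (jointEigenspace ρ χ) : ℂ) *
        ((χ g : ℂ) * LinearMap.trace ℂ V (ρ g⁻¹)) := by
    simp only [trace_eq_sum_finrank_jointEigenspace_mul ρ g, Finset.sum_mul, mul_assoc]
  simp only [trace_mul]
  rw [Finset.sum_comm, Finset.mul_sum]
  refine Finset.sum_congr rfl fun χ _ => ?_
  rw [← Finset.mul_sum, sum_mul_trace]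
  ring

theorem det_eq_prod_pow_finrank_jointEigenspace [Finite G] (g : G) :
    LinearMap.det (ρ g) =
      ∏ χ : G →* ℂˣ, (χ g : ℂ) ^ Module.finrank ℂ (jointEigenspace ρ χ) := by
  have := Fintype.ofFinite G
  rw [← sum_smul_charProj ρ g,
    det_sum_smul_of_completeOrthogonalIdempotents (completeOrthogonalIdempotents_charProj ρ)]
  exact Finset.prod_congr rfl fun χ _ => by rw [(isProj_charProj ρ χ).range]

theorem prod_pow_finrank_jointEigenspace_eq_one [Finite G]
    (hdet : ∀ g, LinearMap.det (ρ g) = 1) :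
    ∏ χ : G →* ℂˣ, χ ^ Module.finrank ℂ (jointEigenspace ρ χ) = 1 := by
  ext g
  simp only [MonoidHom.finsetProd_apply, MonoidHom.pow_apply, Units.coe_prod,
    Units.val_pow_eq_pow_val, ← det_eq_prod_pow_finrank_jointEigenspace, hdet,
    MonoidHom.one_apply, Units.val_one]

end Multiplicities

end JointEigenspaces

section UniqueInvolution

variable {H : Type*} [CommGroup H] [Fintype H] {z : H}

theorem prod_univ_eq_of_orderOf_eq_two_iff (hz : ∀ x : H, orderOf x = 2 ↔ x = z) :
    ∏ x : H, x = z := by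
  classical
  have orderOf_z : orderOf z = 2 := (hz z).2 rfl
  have inv_z : z⁻¹ = z := inv_eq_self_of_orderOf_eq_two orderOf_z
  rw [← Finset.mul_prod_erase Finset.univ (fun x => x) (Finset.mem_univ z),
    Finset.prod_involution (fun x _ => x⁻¹), mul_one]
  · exact fun x _ => mul_inv_cancel x
  · intro x hx hx1 hinv
    refine (Finset.mem_erase.1 hx).1 ((hz x).1 (orderOf_eq_prime ?_ hx1))
    rw [sq, ← eq_inv_iff_mul_eq_one, hinv]
  · intro x hx
    refine Finset.mem_erase.2 ⟨fun h => (Finset.mem_erase.1 hx).1 ?_, Finset.mem_univ _⟩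
    rw [← inv_inv x, h, inv_z]
  · exact fun x _ => inv_inv x

theorem eq_of_prod_pow_eq_one (hz : ∀ x : H, orderOf x = 2 ↔ x = z) {n : H → ℕ} {y : H}
    (hn : ∀ x, x ≠ y → n x = 1) (hy : n y = 0 ∨ n y = 2) (hprod : ∏ x, x ^ n x = 1) : y = z := by
  classical
  have prod_erase_mul := prod_univ_eq_of_orderOf_eq_two_iff hz
  rw [← Finset.mul_prod_erase _ _ (Finset.mem_univ y)] at prod_erase_mul hprod
  rw [Finset.prod_congr rfl fun x hx => by
    rw [hn x (Finset.ne_of_mem_erase hx), pow_one]] at hprod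
  rcases hy with hy | hy
  · rw [hy, pow_zero, one_mul] at hprod
    rwa [hprod, mul_one] at prod_erase_mul
  · rw [hy, sq, mul_assoc, prod_erase_mul] at hprod
    rw [← inv_eq_self_of_orderOf_eq_two ((hz z).2 rfl), ← mul_eq_one_iff_eq_inv, hprod]

end UniqueInvolution

theorem exists_forall_ne_eq_zero_of_sum_sq_eq_one {ι : Type*} [Fintype ι] {f : ι → ℤ}
    (hf : ∑ i, f i ^ 2 = 1) : ∃ i, ∀ j ≠ i, f j = 0 := by
  classical
  obtain ⟨i, -, hi⟩ := Finset.exists_ne_zero_of_sum_ne_zero (hf ▸ one_ne_zero)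
  refine ⟨i, fun j hj => pow_eq_zero_iff two_ne_zero |>.1 <| le_antisymm ?_ (sq_nonneg (f j))⟩
  have one_le : 1 ≤ f i ^ 2 := (sq_nonneg (f i)).lt_of_ne' hi
  have le_one : f i ^ 2 + f j ^ 2 ≤ 1 := by
    rw [← hf, ← Finset.sum_pair (f := fun k => f k ^ 2) hj.symm]
    exact Finset.sum_le_univ_sum_of_nonneg fun k => sq_nonneg (f k)
  linarith

section AlmostRegular

variable {G V : Type*} [CommGroup G] [Fintype G] [AddCommGroup V] [Module ℂ V]
  [FiniteDimensional ℂ V] {ρ : G →* Module.End ℂ V} {ε : ℤ}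

theorem sum_finrank_jointEigenspace_sub_one [Fintype (G →* ℂˣ)]
    (hcard : (Fintype.card G : ℤ) = Module.finrank ℂ V - ε) :
    ∑ χ, ((Module.finrank ℂ (jointEigenspace ρ χ) : ℤ) - 1) = ε := by
  rw [Finset.sum_sub_distrib, Finset.sum_const, Finset.card_univ, card_monoidHom_units,
    nsmul_eq_mul, mul_one, ← Nat.cast_sum, sum_finrank_jointEigenspace, hcard, sub_sub_cancel]

theorem sum_finrank_jointEigenspace_sub_one_sq [Fintype (G →* ℂˣ)]
    (htrace : ∀ g ≠ 1, LinearMap.trace ℂ V (ρ g) * LinearMap.trace ℂ V (ρ g⁻¹) = 1)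
    (hε : ε = 1 ∨ ε = -1) (hcard : (Fintype.card G : ℤ) = Module.finrank ℂ V - ε) :
    ∑ χ, ((Module.finrank ℂ (jointEigenspace ρ χ) : ℤ) - 1) ^ 2 = 1 := by
  classical
  have card_mul_sum_sq : (Fintype.card G : ℂ) *
      ∑ χ, (Module.finrank ℂ (jointEigenspace ρ χ) : ℂ) ^ 2 =
        (Module.finrank ℂ V : ℂ) ^ 2 + (Fintype.card G - 1) := by
    rw [card_mul_sum_finrank_jointEigenspace_sq, ← Finset.add_sum_erase _ _ (Finset.mem_univ 1),
      Finset.sum_congr rfl fun g hg => htrace g (Finset.ne_of_mem_erase hg), Finset.sum_const,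
      Finset.card_erase_of_mem (Finset.mem_univ _), Finset.card_univ, inv_one, map_one,
      LinearMap.trace_one, nsmul_eq_mul, mul_one, Nat.cast_sub Fintype.card_pos, ← sq,
      Nat.cast_one]
  have card_mul_sum_sq_int : (Fintype.card G : ℤ) *
      ∑ χ, (Module.finrank ℂ (jointEigenspace ρ χ) : ℤ) ^ 2 =
        (Module.finrank ℂ V : ℤ) ^ 2 + (Fintype.card G - 1) := by exact_mod_cast card_mul_sum_sq
  have card_ne_zero : (Fintype.card G : ℤ) ≠ 0 := Nat.cast_ne_zero.2 Fintype.card_ne_zero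
  have ε_sq : ε ^ 2 = 1 := by rcases hε with rfl | rfl <;> rfl
  simp only [sub_sq, Finset.sum_sub_distrib, Finset.sum_add_distrib, ← Finset.mul_sum,
    Finset.sum_const, Finset.card_univ, card_monoidHom_units, ← Nat.cast_sum,
    sum_finrank_jointEigenspace, nsmul_eq_mul, mul_one, one_pow]
  refine mul_left_cancel₀ card_ne_zero ?_
  rw [mul_add, mul_sub, card_mul_sum_sq_int, hcard]
  linear_combination ε_sq

theorem exists_orderOf_eq_two_iff_and_finrank_jointEigenspace
    (hdet : ∀ g, LinearMap.det (ρ g) = 1)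
    (htrace : ∀ g ≠ 1, LinearMap.trace ℂ V (ρ g) * LinearMap.trace ℂ V (ρ g⁻¹) = 1)
    (hε : ε = 1 ∨ ε = -1) (hcard : (Fintype.card G : ℤ) = Module.finrank ℂ V - ε)
    {z : G} (hz : ∀ x : G, orderOf x = 2 ↔ x = z) :
    ∃ χ₂ : G →* ℂˣ, (∀ χ : G →* ℂˣ, orderOf χ = 2 ↔ χ = χ₂) ∧
      (∀ χ ≠ χ₂, Module.finrank ℂ (jointEigenspace ρ χ) = 1) ∧
      (Module.finrank ℂ (jointEigenspace ρ χ₂) : ℤ) = 1 + ε := by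
  have := Fintype.ofFinite (G →* ℂˣ)
  obtain ⟨χ₂, hχ₂⟩ := exists_forall_ne_eq_zero_of_sum_sq_eq_one
    (sum_finrank_jointEigenspace_sub_one_sq htrace hε hcard)
  have finrank_of_ne (χ) (h : χ ≠ χ₂) : Module.finrank ℂ (jointEigenspace ρ χ) = 1 := by
    have := hχ₂ χ h
    lia
  have finrank_self : (Module.finrank ℂ (jointEigenspace ρ χ₂) : ℤ) = 1 + ε := by
    rw [← sum_finrank_jointEigenspace_sub_one (ρ := ρ) hcard,
      Finset.sum_eq_single_of_mem χ₂ (Finset.mem_univ _) fun χ _ => hχ₂ χ, add_sub_cancel]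
  let e := (CommGroup.monoidHom_mulEquiv_of_hasEnoughRootsOfUnity G ℂ).some
  have orderOf_iff (χ : G →* ℂˣ) : orderOf χ = 2 ↔ χ = e.symm z := by
    rw [← e.orderOf_eq, hz, ← e.eq_symm_apply]
  obtain rfl : χ₂ = e.symm z := eq_of_prod_pow_eq_one orderOf_iff finrank_of_ne
    (by rcases hε with rfl | rfl <;> lia) (prod_pow_finrank_jointEigenspace_eq_one ρ hdet)
  exact ⟨e.symm z, orderOf_iff, finrank_of_ne, finrank_self⟩

end AlmostRegular

section SimpleSpectrum

open Polynomial

variable {K L ι : Type*} [Field K] [Field L] [Fintype ι] [DecidableEq ι]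

theorem exists_vecMul_eq_smul_of_mem_roots_charpoly {M : Matrix ι ι L} {a : L}
    (ha : a ∈ M.charpoly.roots) : ∃ v : ι → L, v ≠ 0 ∧ v ᵥ* M = a • v := by
  have hdet := (mem_roots'.1 ha).2
  rw [IsRoot.def, eval_charpoly, ← exists_vecMul_eq_zero_iff] at hdet
  obtain ⟨v, hv0, hv⟩ := hdet
  refine ⟨v, hv0, ?_⟩
  rw [vecMul_sub, sub_eq_zero] at hv
  rw [← hv, scalar_apply, ← smul_one_eq_diagonal, vecMul_smul, vecMul_one]

theorem exists_conj_eq_diagonal {M : Matrix ι ι L} (hsplit : M.charpoly.Splits)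
    (hnodup : M.charpoly.roots.Nodup) :
    ∃ (P : (Matrix ι ι L)ˣ) (x : ι → L), Function.Injective x ∧
      P.val * M * P⁻¹.val = diagonal x := by
  classical
  have hcard : Fintype.card ι = Fintype.card M.charpoly.roots.toFinset := by
    rw [Fintype.card_coe, Multiset.toFinset_card_of_nodup hnodup,
      ← hsplit.natDegree_eq_card_roots, charpoly_natDegree_eq_dim]
  let e : ι ≃ M.charpoly.roots.toFinset := Fintype.equivOfCardEq hcard
  choose v hv0 hv using fun i =>
    exists_vecMul_eq_smul_of_mem_roots_charpoly (Multiset.mem_toFinset.1 (e i).2)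
  have hinj : Function.Injective fun i => (e i : L) := Subtype.val_injective.comp e.injective
  have hP : IsUnit (Matrix.of v) := by
    rw [← linearIndependent_rows_iff_isUnit]
    exact Module.End.eigenvectors_linearIndependent' M.vecMulLinear _ hinj v fun i =>
      ⟨Module.End.mem_eigenspace_iff.2 (hv i), hv0 i⟩
  have hrows : Matrix.of v * M = diagonal (fun i => (e i : L)) * Matrix.of v := by
    ext i j
    rw [diagonal_mul]
    exact congrFun (hv i) j
  refine ⟨hP.unit, _, hinj, ?_⟩
  rw [Units.mul_inv_eq_iff_eq_mul]
  exact hrows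

theorem eq_diagonal_of_commute_diagonal {x : ι → L} (hx : Function.Injective x) {M : Matrix ι ι L}
    (hM : Commute (diagonal x) M) : M = diagonal fun i => M i i := by
  ext i j
  by_cases hij : i = j
  · rw [hij, diagonal_apply_eq]
  · have h := congrFun₂ hM.eq i j
    rw [diagonal_mul, mul_diagonal, mul_comm, ← sub_eq_zero, ← mul_sub] at h
    rw [diagonal_apply_ne _ hij]
    exact (mul_eq_zero.1 h).resolve_right (sub_ne_zero.2 fun h => hij (hx h))

theorem aeval_diagonal [Algebra K L] (x : ι → L) (h : K[X]) :
    aeval (diagonal x) h = diagonal fun i => aeval (x i) h := by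
  have := aeval_algHom_apply (diagonalAlgHom K (n := ι) (α := L)) x h
  rwa [aeval_pi_apply] at this

/- In diagonal form this is Lagrange interpolation. -/
theorem exists_aeval_eq_of_commute {P : (Matrix ι ι L)ˣ} {x : ι → L} (hx : Function.Injective x)
    {M N : Matrix ι ι L} (hM : P.val * M * P⁻¹.val = diagonal x) (hMN : Commute M N) :
    ∃ H : L[X], aeval M H = N := by
  let φ := MulSemiringAction.toAlgEquiv L (Matrix ι ι L) (ConjAct.toConjAct P)
  have hφM : φ M = diagonal x := hM
  have hφN := eq_diagonal_of_commute_diagonal hx (hφM ▸ hMN.map φ)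
  refine ⟨Lagrange.interpolate Finset.univ x fun i => φ N i i, φ.injective ?_⟩
  refine (aeval_algHom_apply φ M _).symm.trans ?_
  rw [hφM, aeval_diagonal]
  refine Eq.trans (congrArg diagonal (funext fun i => ?_)) hφN.symm
  rw [coe_aeval_eq_eval]
  exact Lagrange.eval_interpolate_at_node _ hx.injOn (Finset.mem_univ i)

/- Apply a `K`-linear retraction `L → K` to the coefficients of the polynomial. -/
theorem exists_aeval_eq_of_aeval_map_eq [Algebra K L] {A B : Matrix ι ι K} {H : L[X]}
    (hH : aeval (A.map (algebraMap K L)) H = B.map (algebraMap K L)) :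
    ∃ h : K[X], aeval A h = B := by
  obtain ⟨r, hr⟩ := LinearMap.exists_leftInverse_of_injective (Algebra.linearMap K L)
    (LinearMap.ker_eq_bot.2 (algebraMap K L).injective)
  have hr_mul (a : L) (b : K) : r (a * algebraMap K L b) = r a * b := by
    rw [mul_comm, ← Algebra.smul_def, map_smul, smul_eq_mul, mul_comm]
  have hpow (k : ℕ) : A.map (algebraMap K L) ^ k = (A ^ k).map (algebraMap K L) :=
    (map_pow (algebraMap K L).mapMatrix A k).symm
  refine ⟨∑ k ∈ Finset.range (H.natDegree + 1), monomial k (r (H.coeff k)), ?_⟩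
  ext i j
  have hentry := congrArg r (congrFun₂ hH i j)
  rw [Matrix.map_apply, ← Algebra.linearMap_apply, ← LinearMap.comp_apply, hr, LinearMap.id_apply,
    aeval_eq_sum_range, Matrix.sum_apply, map_sum] at hentry
  rw [← hentry, map_sum, Matrix.sum_apply]
  refine Finset.sum_congr rfl fun k _ => ?_
  rw [aeval_monomial, ← Algebra.smul_def, Matrix.smul_apply, smul_eq_mul, hpow, Matrix.smul_apply,
    Matrix.map_apply, smul_eq_mul, hr_mul]

theorem exists_map_eq_of_forall_map_eq [Algebra K L] [IsGalois K L] {H : L[X]}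
    (hH : ∀ σ : L ≃ₐ[K] L, H.map (σ : L →+* L) = H) :
    ∃ h : K[X], h.map (algebraMap K L) = H := by
  rw [← mem_lifts, lifts_iff_coeff_lifts]
  intro k
  have hk : H.coeff k ∈ (⊥ : IntermediateField K L) := by
    rw [InfiniteGalois.mem_bot_iff_fixed]
    intro σ
    have hcoeff := congrArg (fun q => coeff q k) (hH σ)
    rwa [coeff_map] at hcoeff
  exact IntermediateField.mem_bot.1 hk

theorem exists_aeval_eq_of_equivariant [Algebra K L] [IsGalois K L] {S : Finset L} {f : L → L}
    (hS : ∀ (σ : L ≃ₐ[K] L), ∀ y ∈ S, σ y ∈ S)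
    (hf : ∀ (σ : L ≃ₐ[K] L), ∀ y ∈ S, f (σ y) = σ (f y)) :
    ∃ h : K[X], ∀ y ∈ S, aeval y h = f y := by
  classical
  set H := Lagrange.interpolate S id f
  have hH (y) (hy : y ∈ S) : eval y H = f y :=
    Lagrange.eval_interpolate_at_node f Function.injective_id.injOn hy
  have hfix (σ : L ≃ₐ[K] L) : H.map (σ : L →+* L) = H := by
    refine Lagrange.eq_interpolate_of_eval_eq f Function.injective_id.injOn
      (degree_map_le.trans_lt (Lagrange.degree_interpolate_lt f Function.injective_id.injOn))
      fun y hy => ?_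
    obtain ⟨z, hz, rfl⟩ : ∃ z ∈ S, σ z = y := ⟨σ.symm y, hS _ y hy, σ.apply_symm_apply y⟩
    rw [id_eq, hf σ z hz, ← hH z hz]
    exact eval_map_apply (σ : L →+* L) z
  obtain ⟨h, hh⟩ := exists_map_eq_of_forall_map_eq hfix
  refine ⟨h, fun y hy => ?_⟩
  rw [← hH y hy, ← hh, eval_map_algebraMap]

end SimpleSpectrum

section Orbits

open Polynomial IntermediateField

/-- The field containing the eigenvalues of a matrix over `𝔽_p`. -/
abbrev FpBar (p : ℕ) [Fact p.Prime] : Type := AlgebraicClosure (ZMod p)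

variable {p : ℕ} [Fact p.Prime] {x y z : FpBar p}

theorem mem_galOrbit_self (x : FpBar p) : x ∈ galOrbit p x := MulAction.mem_orbit_self x

theorem mem_galOrbit_iff : y ∈ galOrbit p x ↔ ∃ σ : FpBar p ≃ₐ[ZMod p] FpBar p, σ x = y := Iff.rfl

theorem galOrbit_eq_of_mem (h : y ∈ galOrbit p x) : galOrbit p y = galOrbit p x :=
  MulAction.orbit_eq_iff.2 h

theorem inv_mem_galOrbit_inv (h : y ∈ galOrbit p x) : y⁻¹ ∈ galOrbit p x⁻¹ := by
  obtain ⟨σ, rfl⟩ := mem_galOrbit_iff.1 h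
  exact ⟨σ, map_inv₀ σ x⟩

theorem galOrbit_inv (x : FpBar p) : galOrbit p x⁻¹ = (galOrbit p x)⁻¹ := by
  ext y
  refine ⟨fun h => ?_, fun h => ?_⟩
  · rw [Set.mem_inv]
    simpa only [inv_inv] using inv_mem_galOrbit_inv h
  · simpa only [inv_inv] using inv_mem_galOrbit_inv (Set.mem_inv.1 h)

theorem mem_sympOrbit_self (x : FpBar p) : x ∈ sympOrbit p x := Or.inl (mem_galOrbit_self x)

theorem sympOrbit_inv (x : FpBar p) : sympOrbit p x⁻¹ = sympOrbit p x := by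
  rw [sympOrbit, sympOrbit, inv_inv, Set.union_comm]

theorem sympOrbit_eq_of_mem (h : y ∈ sympOrbit p x) : sympOrbit p y = sympOrbit p x := by
  have key {x y : FpBar p} (h : y ∈ galOrbit p x) : sympOrbit p y = sympOrbit p x := by
    rw [sympOrbit, sympOrbit, galOrbit_eq_of_mem h, galOrbit_eq_of_mem (inv_mem_galOrbit_inv h)]
  rcases h with h | h
  · exact key h
  · rw [key h, sympOrbit_inv]

theorem apply_mem_sympOrbit_iff (σ : FpBar p ≃ₐ[ZMod p] FpBar p) :
    σ y ∈ sympOrbit p x ↔ y ∈ sympOrbit p x := by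
  have h : sympOrbit p (σ y) = sympOrbit p y := sympOrbit_eq_of_mem (Or.inl ⟨σ, rfl⟩)
  refine ⟨fun hσ => ?_, fun hy => ?_⟩
  · rw [← sympOrbit_eq_of_mem hσ, h]
    exact mem_sympOrbit_self y
  · rw [← sympOrbit_eq_of_mem hy, ← h]
    exact mem_sympOrbit_self (σ y)

theorem galOrbit_eq_rootSet (x : FpBar p) :
    galOrbit p x = (minpoly (ZMod p) x).rootSet (FpBar p) := by
  have hx : IsIntegral (ZMod p) x := Algebra.IsIntegral.isIntegral x
  ext y
  rw [galOrbit, ← Normal.minpoly_eq_iff_mem_orbit, mem_rootSet_of_ne (minpoly.ne_zero hx)]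
  refine ⟨fun h => h ▸ minpoly.aeval _ _, fun h => ?_⟩
  exact (minpoly.eq_of_irreducible_of_monic (minpoly.irreducible hx) h (minpoly.monic hx)).symm

theorem finite_galOrbit (x : FpBar p) : (galOrbit p x).Finite := by
  rw [galOrbit_eq_rootSet]
  exact rootSet_finite _ _

theorem ncard_galOrbit (x : FpBar p) :
    (galOrbit p x).ncard = Module.finrank (ZMod p) (ZMod p)⟮x⟯ := by
  rw [adjoin.finrank (Algebra.IsIntegral.isIntegral x), galOrbit_eq_rootSet,
    ← Nat.card_coe_set_eq, Nat.card_eq_fintype_card,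
    card_rootSet_eq_natDegree (Algebra.IsSeparable.isSeparable (ZMod p) x) (IsAlgClosed.splits _)]

theorem ncard_galOrbit_inv (x : FpBar p) : (galOrbit p x⁻¹).ncard = (galOrbit p x).ncard := by
  rw [galOrbit_inv, ← Set.image_inv_eq_inv, Set.ncard_image_of_injective _ inv_injective]

theorem ncard_sympOrbit_of_inv_mem (h : x⁻¹ ∈ galOrbit p x) :
    (sympOrbit p x).ncard = (galOrbit p x).ncard := by
  rw [sympOrbit, galOrbit_eq_of_mem h, Set.union_self]

theorem disjoint_galOrbit_inv (h : x⁻¹ ∉ galOrbit p x) :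
    Disjoint (galOrbit p x) (galOrbit p x⁻¹) := by
  rw [Set.disjoint_left]
  intro y hy hy'
  apply h
  rw [← galOrbit_eq_of_mem hy, galOrbit_eq_of_mem hy']
  exact mem_galOrbit_self _

theorem ncard_sympOrbit_of_inv_notMem (h : x⁻¹ ∉ galOrbit p x) :
    (sympOrbit p x).ncard = 2 * (galOrbit p x).ncard := by
  rw [sympOrbit, Set.ncard_union_eq (disjoint_galOrbit_inv h) (finite_galOrbit _)
    (finite_galOrbit _), ncard_galOrbit_inv, two_mul]

theorem aeval_algEquiv_apply (σ : FpBar p ≃ₐ[ZMod p] FpBar p) (y : FpBar p) (h : (ZMod p)[X]) :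
    aeval (σ y) h = σ (aeval y h) :=
  aeval_algHom_apply σ.toAlgHom y h

theorem aeval_pow_prime_pow (y : FpBar p) (h : (ZMod p)[X]) (k : ℕ) :
    aeval (y ^ p ^ k) h = aeval y h ^ p ^ k := by
  have := aeval_algHom_apply (FiniteField.frobeniusAlgHom (ZMod p) (FpBar p) ^ k) y h
  simpa only [AlgHom.coe_pow, FiniteField.coe_frobeniusAlgHom, ZMod.card, pow_iterate] using this

theorem mem_adjoin_simple_iff_exists_aeval :
    z ∈ (ZMod p)⟮y⟯ ↔ ∃ g : (ZMod p)[X], aeval y g = z := by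
  rw [← mem_toSubalgebra, adjoin_simple_toSubalgebra_of_isAlgebraic
    (Algebra.IsAlgebraic.isAlgebraic y), Algebra.adjoin_singleton_eq_range_aeval]
  rfl

instance finiteDimensional_adjoin_simple (y : FpBar p) :
    FiniteDimensional (ZMod p) (ZMod p)⟮y⟯ :=
  adjoin.finiteDimensional (Algebra.IsIntegral.isIntegral y)

instance finite_adjoin_simple (y : FpBar p) : Finite (ZMod p)⟮y⟯ :=
  Module.finite_of_finite (ZMod p)

theorem natCard_adjoin_simple (y : FpBar p) :
    Nat.card (ZMod p)⟮y⟯ = p ^ (galOrbit p y).ncard := by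
  rw [Module.natCard_eq_pow_finrank (K := ZMod p), Nat.card_zmod, ncard_galOrbit]

theorem mem_adjoin_simple_iff_pow_eq_self :
    z ∈ (ZMod p)⟮y⟯ ↔ z ^ p ^ (galOrbit p y).ncard = z := by
  have := Fintype.ofFinite (ZMod p)⟮y⟯
  rw [← natCard_adjoin_simple, Nat.card_eq_fintype_card]
  constructor
  · exact fun hz => congrArg Subtype.val (FiniteField.pow_card (⟨z, hz⟩ : (ZMod p)⟮y⟯))
  · intro hz
    have hsplit : (X ^ Fintype.card (ZMod p)⟮y⟯ - X : (ZMod p)⟮y⟯[X]).Splits := by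
      simpa using IsSplittingField.splits (ZMod p)⟮y⟯
        (X ^ Fintype.card (ZMod p)⟮y⟯ - X : (ZMod p)⟮y⟯[X])
    obtain ⟨w, rfl⟩ := hsplit.mem_range_of_isRoot
      (FiniteField.X_pow_card_sub_X_ne_zero _ Fintype.one_lt_card)
      (i := algebraMap (ZMod p)⟮y⟯ (FpBar p)) (x := z) (by simp [hz])
    exact w.2

theorem exists_pow_eq_of_mem_galOrbit (h : z ∈ galOrbit p y) :
    ∃ k < (galOrbit p y).ncard, y ^ p ^ k = z := by
  obtain ⟨σ, rfl⟩ := mem_galOrbit_iff.1 h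
  obtain ⟨⟨k, hk⟩, hkσ⟩ := (FiniteField.bijective_frobeniusAlgEquivOfAlgebraic_pow (ZMod p)
    (ZMod p)⟮y⟯).2 (σ.restrictNormal (ZMod p)⟮y⟯)
  refine ⟨k, by rwa [ncard_galOrbit], ?_⟩
  have hy := σ.restrictNormal_commutes (ZMod p)⟮y⟯ ⟨y, mem_adjoin_simple_self _ y⟩
  rw [← hkσ, AlgEquiv.coe_pow, FiniteField.coe_frobeniusAlgEquivOfAlgebraic_iterate,
    ZMod.card] at hy
  exact hy

theorem ncard_galOrbit_dvd_of_pow_eq_self {j : ℕ} (h : y ^ p ^ j = y) :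
    (galOrbit p y).ncard ∣ j := by
  rw [ncard_galOrbit, ← FiniteField.orderOf_frobeniusAlgHom, orderOf_dvd_iff_pow_eq_one]
  refine adjoin_algHom_ext _ fun x hx => Subtype.ext ?_
  obtain rfl : x = y := hx
  rw [AlgHom.coe_pow, FiniteField.coe_frobeniusAlgHom, ZMod.card, pow_iterate]
  exact h

theorem inv_eq_pow_of_inv_mem_galOrbit (hne : y⁻¹ ≠ y) (h : y⁻¹ ∈ galOrbit p y) {m : ℕ}
    (hm : (galOrbit p y).ncard = 2 * m) : y⁻¹ = y ^ p ^ m := by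
  obtain ⟨k, hk, hky⟩ := exists_pow_eq_of_mem_galOrbit h
  have hdvd : 2 * m ∣ 2 * k := by
    rw [← hm]
    apply ncard_galOrbit_dvd_of_pow_eq_self
    rw [two_mul, pow_add, pow_mul, hky, inv_pow, hky, inv_inv]
  have hk0 : k ≠ 0 := by
    rintro rfl
    rw [pow_zero, pow_one] at hky
    exact hne hky.symm
  obtain ⟨c, hc⟩ := (Nat.mul_dvd_mul_iff_left two_pos).1 hdvd
  have hkm : k = m := by
    have : c < 2 := by
      by_contra! hc2
      nlinarith
    interval_cases c <;> omega
  rw [← hky, hkm]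

end Orbits

section SymplecticForm

variable {p : ℕ} [Fact p.Prime] {d : ℕ}

theorem dotProduct_J_mulVec_self {R ι : Type*} [CommRing R] [Fintype ι] [DecidableEq ι]
    (v : ι ⊕ ι → R) : v ⬝ᵥ (J ι R *ᵥ v) = 0 := by
  rw [J, fromBlocks_mulVec]
  simp only [dotProduct, Fintype.sum_sum_type, zero_mulVec, neg_mulVec, one_mulVec, zero_add,
    add_zero, Sum.elim_inl, Sum.elim_inr, Pi.neg_apply, Function.comp_apply]
  rw [← Finset.sum_add_distrib]
  exact Finset.sum_eq_zero fun _ _ => by ring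

theorem isUnit_J (R ι : Type*) [CommRing R] [Fintype ι] [DecidableEq ι] : IsUnit (J ι R) :=
  (isUnit_iff_isUnit_det _).2 (isUnit_det_J ι R)

open Polynomial in
theorem sympForm_vecMul_aeval (A : SpP p d) (h : (ZMod p)[X]) (m n : PhaseP p d) :
    sympForm (m ᵥ* aeval A.1 h) n = sympForm m (n ᵥ* aeval A⁻¹.1 h) := by
  have hpow (k : ℕ) (m n : PhaseP p d) :
      sympForm (m ᵥ* A.1 ^ k) n = sympForm m (n ᵥ* A⁻¹.1 ^ k) := by
    induction k generalizing m n with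
    | zero => rw [pow_zero, pow_zero, vecMul_one, vecMul_one]
    | succ k ih =>
      rw [pow_succ, pow_succ', ← vecMul_vecMul, ← vecMul_vecMul, ← ih,
        ← sympForm_vecMul_vecMul A _ (n ᵥ* _), vecMul_inv_vecMul]
  induction h using Polynomial.induction_on' with
  | add f g hf hg =>
    rw [map_add, map_add, vecMul_add, vecMul_add, sympForm_add_left, sympForm_add_right, hf, hg]
  | monomial k a =>
    rw [aeval_monomial, aeval_monomial, ← Algebra.smul_def, ← Algebra.smul_def, vecMul_smul,
      vecMul_smul, sympForm_smul_left, sympForm_smul_right, hpow]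

open Polynomial in
theorem aeval_mem_symplecticGroup_iff (A : SpP p d) (h : (ZMod p)[X]) :
    aeval A.1 h ∈ symplecticGroup (Fin d) (ZMod p) ↔ aeval A.1 h * aeval A⁻¹.1 h = 1 := by
  rw [mem_symplecticGroup_iff]
  simp only [sympForm_vecMul_aeval, vecMul_vecMul]
  refine ⟨fun H => Matrix.ext_of_single_vecMul fun i => ?_, fun H m n => by rw [H, vecMul_one]⟩
  rw [vecMul_one, ← sub_eq_zero]
  refine eq_zero_of_sympForm_eq_zero fun m => ?_
  rw [sympForm_swap, sympForm_sub_right, H, sub_self, neg_zero]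

open Polynomial in
theorem aeval_mem_heckeGroup {A : SpP p d} {h : (ZMod p)[X]}
    (hsp : aeval A.1 h ∈ symplecticGroup (Fin d) (ZMod p)) :
    (⟨aeval A.1 h, hsp⟩ : SpP p d) ∈ heckeGroup A := by
  rw [Subgroup.mem_centralizer_singleton_iff]
  refine Subtype.ext (?_ : aeval A.1 h * A.1 = A.1 * aeval A.1 h)
  simpa only [map_mul, aeval_X] using congrArg (aeval A.1) (mul_comm h X)

end SymplecticForm

section EigenFrame

variable {p : ℕ} [Fact p.Prime] {d : ℕ}

/-- A basis of eigenvectors of `A` over the algebraic closure, for pairwise distinct eigenvalues: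
the rows of `P` are the eigenvectors and `x` lists the eigenvalues. -/
structure EigenFrame (A : SpP p d) where
  P : (Matrix (Fin d ⊕ Fin d) (Fin d ⊕ Fin d) (FpBar p))ˣ
  x : Fin d ⊕ Fin d → FpBar p
  injective : Function.Injective x
  conj_eq : P.val * A.1.map (algebraMap (ZMod p) (FpBar p)) * P⁻¹.val = diagonal x

theorem nonempty_eigenFrame {A : SpP p d} (h : (eigenvaluesP A).Nodup) :
    Nonempty (EigenFrame A) := by
  rw [eigenvaluesP, Polynomial.aroots, ← charpoly_map] at h
  obtain ⟨P, x, hx, hP⟩ := exists_conj_eq_diagonal (IsAlgClosed.splits _) h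
  exact ⟨⟨P, x, hx, hP⟩⟩

namespace EigenFrame

open Polynomial

variable {A : SpP p d} (D : EigenFrame A)

/-- The embedding `B ↦ P B P⁻¹` of matrices over `𝔽_p`, which diagonalizes `A`. -/
def conj : Matrix (Fin d ⊕ Fin d) (Fin d ⊕ Fin d) (ZMod p) →ₐ[ZMod p]
    Matrix (Fin d ⊕ Fin d) (Fin d ⊕ Fin d) (FpBar p) :=
  (MulSemiringAction.toAlgHom (ZMod p) _ (ConjAct.toConjAct D.P)).comp
    (Algebra.ofId (ZMod p) (FpBar p)).mapMatrix

theorem conj_apply (B : Matrix (Fin d ⊕ Fin d) (Fin d ⊕ Fin d) (ZMod p)) :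
    D.conj B = D.P.val * B.map (algebraMap (ZMod p) (FpBar p)) * D.P⁻¹.val := rfl

theorem conj_self : D.conj A.1 = diagonal D.x := D.conj_eq

theorem conj_injective : Function.Injective D.conj := by
  intro B C h
  rw [conj_apply, conj_apply] at h
  exact Matrix.map_injective (algebraMap (ZMod p) (FpBar p)).injective
    (D.P.mul_right_inj.1 (D.P⁻¹.mul_left_inj.1 h))

theorem det_conj (B : Matrix (Fin d ⊕ Fin d) (Fin d ⊕ Fin d) (ZMod p)) :
    (D.conj B).det = algebraMap (ZMod p) (FpBar p) B.det := by
  rw [conj_apply, det_units_conj]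
  exact (RingHom.map_det _ _).symm

theorem conj_aeval (h : (ZMod p)[X]) :
    D.conj (aeval A.1 h) = diagonal fun i => aeval (D.x i) h := by
  rw [← aeval_algHom_apply, conj_self, aeval_diagonal]

theorem eigenvaluesP_eq : eigenvaluesP A = Finset.univ.val.map D.x := by
  rw [eigenvaluesP, aroots, ← charpoly_map, ← charpoly_units_conj D.P, ← coe_units_inv, D.conj_eq,
    charpoly_diagonal, ← roots_multiset_prod_X_sub_C (Finset.univ.val.map D.x), Multiset.map_map]
  rfl

theorem mem_eigenvaluesP_iff {y : FpBar p} : y ∈ eigenvaluesP A ↔ ∃ i, D.x i = y := by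
  simp only [D.eigenvaluesP_eq, Multiset.mem_map, Finset.mem_val, Finset.mem_univ, true_and]

/- The Gram matrix of the eigenvectors is invertible, has zeros on the diagonal, and its `(i, j)`
entry is multiplied by `x i * x j` under the action of `A`. -/
theorem exists_mul_eq_one (i : Fin d ⊕ Fin d) : ∃ j, j ≠ i ∧ D.x i * D.x j = 1 := by
  set Abar := A.1.map (algebraMap (ZMod p) (FpBar p))
  set G := D.P.val * J (Fin d) (FpBar p) * D.P.valᵀ with hG
  have hGunit : IsUnit G := (D.P.isUnit.mul (isUnit_J _ _)).mul ((isUnit_transpose _).2 D.P.isUnit)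
  have hGdiag (i) : G i i = 0 := by
    rw [hG, Matrix.mul_assoc]
    exact dotProduct_J_mulVec_self (D.P.val i)
  have hPA : D.P.val * Abar = diagonal D.x * D.P.val := D.P.mul_inv_eq_iff_eq_mul.1 D.conj_eq
  have hinv : diagonal D.x * G * diagonal D.x = G := by
    have hA := SymplecticGroup.mem_iff.1
      (SymplecticGroup.map_mem A.2 (algebraMap (ZMod p) (FpBar p)))
    calc diagonal D.x * G * diagonal D.x
        = diagonal D.x * D.P.val * J (Fin d) (FpBar p) * (diagonal D.x * D.P.val)ᵀ := by
          rw [transpose_mul, diagonal_transpose, hG]; simp only [Matrix.mul_assoc]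
      _ = D.P.val * (Abar * J (Fin d) (FpBar p) * Abarᵀ) * D.P.valᵀ := by
          rw [← hPA, transpose_mul]; simp only [Matrix.mul_assoc]
      _ = G := by rw [hA]
  obtain ⟨j, hj⟩ : ∃ j, G i j ≠ 0 := by
    by_contra! h
    obtain ⟨R, hR⟩ := hGunit.exists_right_inv
    have hii := congrFun₂ hR i i
    simp [Matrix.mul_apply, h] at hii
  refine ⟨j, fun h => hj (h ▸ hGdiag i), mul_right_cancel₀ hj ?_⟩
  have hij := congrFun₂ hinv i j
  rw [mul_diagonal, diagonal_mul] at hij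
  linear_combination hij

theorem x_ne_zero (i : Fin d ⊕ Fin d) : D.x i ≠ 0 := by
  obtain ⟨j, -, hj⟩ := D.exists_mul_eq_one i
  exact left_ne_zero_of_mul_eq_one hj

/-- The same eigenvectors, for the inverse matrix. -/
def inv : EigenFrame A⁻¹ where
  P := D.P
  x := fun i => (D.x i)⁻¹
  injective := inv_injective.comp D.injective
  conj_eq := by
    rw [← conj_apply]
    have hmul : diagonal (fun i => (D.x i)⁻¹) * diagonal D.x = 1 := by
      simp only [diagonal_mul_diagonal, inv_mul_cancel₀ (D.x_ne_zero _), diagonal_one]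
    refine (left_inv_eq_right_inv hmul ?_).symm
    rw [← conj_self, ← map_mul]
    exact (congrArg (fun B : SpP p d => D.conj B.1) (mul_inv_cancel A)).trans (map_one D.conj)

theorem conj_aeval_inv (h : (ZMod p)[X]) :
    D.conj (aeval A⁻¹.1 h) = diagonal fun i => aeval (D.x i)⁻¹ h :=
  D.inv.conj_aeval h

theorem exists_eq_inv (i : Fin d ⊕ Fin d) : ∃ j, D.x j = (D.x i)⁻¹ := by
  obtain ⟨j, -, hj⟩ := D.exists_mul_eq_one i
  exact ⟨j, eq_inv_of_mul_eq_one_right hj⟩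

theorem inv_ne_self (i : Fin d ⊕ Fin d) : (D.x i)⁻¹ ≠ D.x i := by
  obtain ⟨j, hji, hj⟩ := D.exists_mul_eq_one i
  rw [← eq_inv_of_mul_eq_one_right hj]
  exact D.injective.ne hji

theorem exists_eq_apply (σ : FpBar p ≃ₐ[ZMod p] FpBar p) (i : Fin d ⊕ Fin d) :
    ∃ j, D.x j = σ (D.x i) := by
  have hi := D.mem_eigenvaluesP_iff.2 ⟨i, rfl⟩
  rw [eigenvaluesP, mem_aroots] at hi
  rw [← D.mem_eigenvaluesP_iff, eigenvaluesP, mem_aroots, aeval_algEquiv_apply, hi.2, map_zero]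
  exact ⟨hi.1, rfl⟩

open Classical in
theorem exists_aeval_x_eq {f : FpBar p → FpBar p}
    (hf : ∀ (σ : FpBar p ≃ₐ[ZMod p] FpBar p) i, f (σ (D.x i)) = σ (f (D.x i))) :
    ∃ h : (ZMod p)[X], ∀ i, aeval (D.x i) h = f (D.x i) := by
  obtain ⟨h, hh⟩ := exists_aeval_eq_of_equivariant (K := ZMod p) (S := Finset.univ.image D.x)
    (f := f)
    (fun σ y hy => by
      obtain ⟨i, -, rfl⟩ := Finset.mem_image.1 hy
      obtain ⟨j, hj⟩ := D.exists_eq_apply σ i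
      exact hj ▸ Finset.mem_image_of_mem _ (Finset.mem_univ j))
    (fun σ y hy => by
      obtain ⟨i, -, rfl⟩ := Finset.mem_image.1 hy
      exact hf σ i)
  exact ⟨h, fun i => hh _ (Finset.mem_image_of_mem _ (Finset.mem_univ i))⟩

theorem aeval_mem_symplecticGroup_iff_forall (h : (ZMod p)[X]) :
    aeval A.1 h ∈ symplecticGroup (Fin d) (ZMod p) ↔
      ∀ i, aeval (D.x i) h * aeval (D.x i)⁻¹ h = 1 := by
  rw [aeval_mem_symplecticGroup_iff, ← D.conj_injective.eq_iff, map_mul, map_one, conj_aeval,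
    conj_aeval_inv, diagonal_mul_diagonal, ← diagonal_one, diagonal_injective.eq_iff, funext_iff]

include D in
theorem exists_aeval_eq (B : heckeGroup A) : ∃ h : (ZMod p)[X], aeval A.1 h = B.1.1 := by
  have hcomm : Commute A.1 B.1.1 := SympDecomposition.heckeGroup_comm B
  obtain ⟨H, hH⟩ := exists_aeval_eq_of_commute D.injective D.conj_eq
    (hcomm.map (algebraMap (ZMod p) (FpBar p)).mapMatrix)
  exact exists_aeval_eq_of_aeval_map_eq hH

include D in
theorem heckeGroup_mul_comm (B C : heckeGroup A) : B * C = C * B := by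
  obtain ⟨h, hh⟩ := D.exists_aeval_eq B
  obtain ⟨k, hk⟩ := D.exists_aeval_eq C
  refine Subtype.ext (Subtype.ext (?_ : B.1.1 * C.1.1 = C.1.1 * B.1.1))
  rw [← hh, ← hk, ← map_mul, mul_comm, map_mul]

theorem conj_heckeGroup (B : heckeGroup A) :
    D.conj B.1.1 = diagonal fun i => D.conj B.1.1 i i := by
  refine eq_diagonal_of_commute_diagonal D.injective ?_
  rw [← conj_self]
  exact Commute.map (SympDecomposition.heckeGroup_comm B) D.conj

/-- The eigenvalue of an element of the Hecke group at the `i`-th eigenvector. -/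
def heckeEigenvalue (i : Fin d ⊕ Fin d) : heckeGroup A →* (FpBar p)ˣ :=
  MonoidHom.toHomUnits
    { toFun B := D.conj B.1.1 i i
      map_one' := by
        rw [Subgroup.coe_one, Submonoid.coe_one, map_one, one_apply_eq]
      map_mul' B C := by
        rw [Subgroup.coe_mul, Submonoid.coe_mul, map_mul, conj_heckeGroup D B, diagonal_mul,
          diagonal_apply_eq] }

theorem heckeEigenvalue_eq_aeval {B : heckeGroup A} {h : (ZMod p)[X]} (hh : aeval A.1 h = B.1.1)
    (i : Fin d ⊕ Fin d) : (D.heckeEigenvalue i B : FpBar p) = aeval (D.x i) h := by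
  change D.conj B.1.1 i i = _
  rw [← hh, conj_aeval, diagonal_apply_eq]

theorem eq_one_of_heckeEigenvalue_eq_one {B : heckeGroup A}
    (h : ∀ i, D.heckeEigenvalue i B = 1) : B = 1 := by
  refine Subtype.ext (Subtype.ext (D.conj_injective ?_))
  rw [conj_heckeGroup, Subgroup.coe_one, Submonoid.coe_one, map_one, ← diagonal_one]
  exact congrArg diagonal (funext fun i => congrArg Units.val (h i))

include D in
theorem heckeGroup_eq_one_of_pow_prime_eq_one {B : heckeGroup A} (hB : B ^ p = 1) : B = 1 := by
  refine D.eq_one_of_heckeEigenvalue_eq_one fun i => Units.ext ?_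
  have h : (D.heckeEigenvalue i B : FpBar p) ^ p = 1 := by
    rw [← Units.val_pow_eq_pow_val, ← map_pow, hB, map_one, Units.val_one]
  apply frobenius_inj (FpBar p) p
  rw [frobenius_def, h, Units.val_one, map_one]

include D in
theorem coprime_natCard_heckeGroup : p.Coprime (Nat.card (heckeGroup A)) := by
  rw [Nat.Prime.coprime_iff_not_dvd Fact.out]
  intro h
  obtain ⟨B, hB⟩ := exists_prime_orderOf_dvd_card' p h
  rw [D.heckeGroup_eq_one_of_pow_prime_eq_one (orderOf_dvd_iff_pow_eq_one.1 hB.dvd),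
    orderOf_one] at hB
  exact (Fact.out : p.Prime).one_lt.ne hB

include D in
theorem map_heckeGroup_eq_one {M : Type*} [Monoid M] {f : heckeGroup A →* M}
    (hf : ∀ B, f B ^ p = 1) (B : heckeGroup A) : f B = 1 := by
  have hcard : f B ^ Nat.card (heckeGroup A) = 1 := by rw [← map_pow, pow_card_eq_one', map_one]
  have hdvd := Nat.dvd_gcd (orderOf_dvd_of_pow_eq_one (hf B)) (orderOf_dvd_of_pow_eq_one hcard)
  rw [D.coprime_natCard_heckeGroup] at hdvd
  exact orderOf_eq_one_iff.1 (Nat.dvd_one.1 hdvd)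

end EigenFrame

end EigenFrame

section SingleOrbit

namespace EigenFrame

open Polynomial

variable {p : ℕ} [Fact p.Prime] {d : ℕ} {A : SpP p d} (D : EigenFrame A) {i₀ : Fin d ⊕ Fin d}

theorem aeval_mul_aeval_inv_eq_one {B : heckeGroup A} {h : (ZMod p)[X]} (hh : aeval A.1 h = B.1.1)
    (i : Fin d ⊕ Fin d) : aeval (D.x i) h * aeval (D.x i)⁻¹ h = 1 :=
  (D.aeval_mem_symplecticGroup_iff_forall h).1 (hh ▸ B.1.2) i

theorem exists_heckeEigenvalue_eq_aeval {h : (ZMod p)[X]}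
    (hh : ∀ i, aeval (D.x i) h * aeval (D.x i)⁻¹ h = 1) :
    ∃ B, ∀ i, (D.heckeEigenvalue i B : FpBar p) = aeval (D.x i) h := by
  have hsp := (D.aeval_mem_symplecticGroup_iff_forall h).2 hh
  exact ⟨⟨_, aeval_mem_heckeGroup hsp⟩, D.heckeEigenvalue_eq_aeval rfl⟩

theorem heckeEigenvalue_pow_eq_self (B : heckeGroup A) (i : Fin d ⊕ Fin d) :
    (D.heckeEigenvalue i B : FpBar p) ^ p ^ (galOrbit p (D.x i)).ncard =
      D.heckeEigenvalue i B := by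
  obtain ⟨h, hh⟩ := D.exists_aeval_eq B
  rw [← mem_adjoin_simple_iff_pow_eq_self, mem_adjoin_simple_iff_exists_aeval]
  exact ⟨h, (D.heckeEigenvalue_eq_aeval hh i).symm⟩

/- `h(x) h(x⁻¹) = 1`, so that `B = h(A)` is determined by the values of `h` on one Galois orbit of
each symplectic orbit. -/
theorem heckeEigenvalue_injective (hS : ∀ i, D.x i ∈ sympOrbit p (D.x i₀)) :
    Function.Injective (D.heckeEigenvalue i₀) := by
  refine (injective_iff_map_eq_one _).2 fun B hB => D.eq_one_of_heckeEigenvalue_eq_one fun i => ?_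
  obtain ⟨h, hh⟩ := D.exists_aeval_eq B
  have h₀ : aeval (D.x i₀) h = 1 := by rw [← D.heckeEigenvalue_eq_aeval hh, hB, Units.val_one]
  have h₀' : aeval (D.x i₀)⁻¹ h = 1 := by
    simpa only [h₀, one_mul] using D.aeval_mul_aeval_inv_eq_one hh i₀
  refine Units.ext ((D.heckeEigenvalue_eq_aeval hh i).trans ?_)
  rcases hS i with hi | hi <;> obtain ⟨σ, hσ⟩ := mem_galOrbit_iff.1 hi
  · rw [← hσ, aeval_algEquiv_apply, h₀, map_one, Units.val_one]
  · rw [← hσ, aeval_algEquiv_apply, h₀', map_one, Units.val_one]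

theorem eq_zero_or_eq_one_of_vecMul_eq_self (hS : ∀ i, D.x i ∈ sympOrbit p (D.x i₀))
    {B : heckeGroup A} {n : PhaseP p d} (hn : n ᵥ* B.1.1 = n) : n = 0 ∨ B = 1 := by
  refine or_iff_not_imp_left.2 fun hn0 => ?_
  have hdet : (B.1.1 - 1).det = 0 :=
    exists_vecMul_eq_zero_iff.1 ⟨n, hn0, by rw [vecMul_sub, hn, vecMul_one, sub_self]⟩
  have hprod := D.det_conj (B.1.1 - 1)
  rw [hdet, map_zero, map_sub, map_one, conj_heckeGroup, ← diagonal_one, diagonal_sub,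
    det_diagonal] at hprod
  obtain ⟨i, -, hi⟩ := Finset.prod_eq_zero_iff.1 hprod
  refine D.heckeEigenvalue_injective (i₀ := i) (fun j => ?_)
    ((Units.ext (sub_eq_zero.1 hi)).trans (map_one _).symm)
  rw [sympOrbit_eq_of_mem (hS i)]
  exact hS j

theorem range_x_eq_sympOrbit (hS : ∀ i, D.x i ∈ sympOrbit p (D.x i₀)) :
    Set.range D.x = sympOrbit p (D.x i₀) := by
  refine (Set.range_subset_iff.2 hS).antisymm ?_
  obtain ⟨j, hj⟩ := D.exists_eq_inv i₀
  rintro y (hy | hy) <;> obtain ⟨σ, rfl⟩ := mem_galOrbit_iff.1 hy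
  · exact D.exists_eq_apply σ i₀
  · exact hj ▸ D.exists_eq_apply σ j

theorem ncard_sympOrbit (hS : ∀ i, D.x i ∈ sympOrbit p (D.x i₀)) :
    (sympOrbit p (D.x i₀)).ncard = 2 * d := by
  rw [← D.range_x_eq_sympOrbit hS, ← Set.image_univ, Set.ncard_image_of_injective _ D.injective,
    Set.ncard_univ, Nat.card_eq_fintype_card, Fintype.card_sum, Fintype.card_fin, two_mul]

/- On a nonsymmetric orbit the values on `ϑ` are arbitrary and those on `ϑ*` are their inverses. -/
open Classical in
theorem exists_heckeEigenvalue_eq_of_inv_notMem (hS : ∀ i, D.x i ∈ sympOrbit p (D.x i₀))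
    (hns : (D.x i₀)⁻¹ ∉ galOrbit p (D.x i₀)) {g : (ZMod p)[X]} (hg : aeval (D.x i₀) g ≠ 0) :
    ∃ B, (D.heckeEigenvalue i₀ B : FpBar p) = aeval (D.x i₀) g := by
  have hiff (σ : FpBar p ≃ₐ[ZMod p] FpBar p) (y : FpBar p) :
      σ y ∈ galOrbit p (D.x i₀) ↔ y ∈ galOrbit p (D.x i₀) := by
    rw [galOrbit, MulAction.mem_orbit_symm, MulAction.mem_orbit_symm (a₁ := y),
      ← MulAction.orbit_smul σ y]
    rfl
  have hne {y : FpBar p} (hy : y ∈ galOrbit p (D.x i₀)) : aeval y g ≠ 0 := by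
    obtain ⟨σ, rfl⟩ := mem_galOrbit_iff.1 hy
    rwa [aeval_algEquiv_apply, _root_.map_ne_zero]
  have hmem_iff (i) : (D.x i)⁻¹ ∈ galOrbit p (D.x i₀) ↔ D.x i ∉ galOrbit p (D.x i₀) := by
    refine ⟨fun h h' => ?_, fun h => ?_⟩
    · exact Set.disjoint_left.1 (disjoint_galOrbit_inv hns) h (inv_mem_galOrbit_inv h')
    · exact inv_inv (D.x i₀) ▸ inv_mem_galOrbit_inv ((hS i).resolve_left h)
  obtain ⟨h, hh⟩ := D.exists_aeval_x_eq (f := fun y =>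
      if y ∈ galOrbit p (D.x i₀) then aeval y g else (aeval y⁻¹ g)⁻¹) fun σ i => by
    simp only [hiff, apply_ite σ, ← map_inv₀ σ, aeval_algEquiv_apply]
  obtain ⟨B, hB⟩ := D.exists_heckeEigenvalue_eq_aeval (h := h) fun i => by
    obtain ⟨j, hj⟩ := D.exists_eq_inv i
    rw [← hj, hh, hh, hj]
    by_cases hi : D.x i ∈ galOrbit p (D.x i₀)
    · rw [if_pos hi, if_neg fun h' => (hmem_iff i).1 h' hi, inv_inv, mul_inv_cancel₀ (hne hi)]
    · have hi' := (hmem_iff i).2 hi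
      rw [if_neg hi, if_pos hi', inv_mul_cancel₀ (hne hi')]
  exact ⟨B, by rw [hB, hh, if_pos (mem_galOrbit_self _)]⟩

theorem exists_heckeEigenvalue_eq_of_inv_mem (hS : ∀ i, D.x i ∈ sympOrbit p (D.x i₀))
    (hs : (D.x i₀)⁻¹ ∈ galOrbit p (D.x i₀)) {g : (ZMod p)[X]}
    (hg : aeval (D.x i₀) g * aeval (D.x i₀)⁻¹ g = 1) :
    ∃ B, (D.heckeEigenvalue i₀ B : FpBar p) = aeval (D.x i₀) g := by
  obtain ⟨B, hB⟩ := D.exists_heckeEigenvalue_eq_aeval (h := g) fun i => by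
    have hi := hS i
    rw [sympOrbit, galOrbit_eq_of_mem hs, Set.union_self] at hi
    obtain ⟨σ, hσ⟩ := mem_galOrbit_iff.1 hi
    rw [← hσ, ← map_inv₀, aeval_algEquiv_apply, aeval_algEquiv_apply, ← map_mul, hg, map_one]
  exact ⟨B, hB i₀⟩

theorem range_heckeEigenvalue_of_inv_notMem (hS : ∀ i, D.x i ∈ sympOrbit p (D.x i₀))
    (hns : (D.x i₀)⁻¹ ∉ galOrbit p (D.x i₀)) :
    (D.heckeEigenvalue i₀).range = rootsOfUnity (p ^ d - 1) (FpBar p) := by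
  have hd : (galOrbit p (D.x i₀)).ncard = d := by
    have := D.ncard_sympOrbit hS
    rw [ncard_sympOrbit_of_inv_notMem hns] at this
    lia
  have hpow (z : (FpBar p)ˣ) : z ∈ rootsOfUnity (p ^ d - 1) (FpBar p) ↔
      (z : FpBar p) ^ p ^ d = z := by
    rw [mem_rootsOfUnity, ← Units.val_pow_eq_pow_val, Units.val_inj, ← mul_eq_right (b := z),
      pow_sub_one_mul (pow_ne_zero d (Fact.out : p.Prime).ne_zero)]
  ext z
  rw [hpow]
  constructor
  · rintro ⟨B, rfl⟩
    simpa only [hd] using D.heckeEigenvalue_pow_eq_self B i₀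
  · intro hz
    rw [← hd, ← mem_adjoin_simple_iff_pow_eq_self, mem_adjoin_simple_iff_exists_aeval] at hz
    obtain ⟨g, hg⟩ := hz
    obtain ⟨B, hB⟩ := D.exists_heckeEigenvalue_eq_of_inv_notMem hS hns (hg ▸ z.ne_zero)
    exact ⟨B, Units.ext (hB.trans hg)⟩

theorem range_heckeEigenvalue_of_inv_mem (hS : ∀ i, D.x i ∈ sympOrbit p (D.x i₀))
    (hs : (D.x i₀)⁻¹ ∈ galOrbit p (D.x i₀)) :
    (D.heckeEigenvalue i₀).range = rootsOfUnity (p ^ d + 1) (FpBar p) := by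
  have hd : (galOrbit p (D.x i₀)).ncard = 2 * d := by
    rw [← ncard_sympOrbit_of_inv_mem hs, D.ncard_sympOrbit hS]
  have haeval (g : (ZMod p)[X]) : aeval (D.x i₀)⁻¹ g = aeval (D.x i₀) g ^ p ^ d := by
    rw [inv_eq_pow_of_inv_mem_galOrbit (D.inv_ne_self i₀) hs hd, aeval_pow_prime_pow]
  ext z
  rw [mem_rootsOfUnity']
  constructor
  · rintro ⟨B, rfl⟩
    obtain ⟨h, hh⟩ := D.exists_aeval_eq B
    rw [D.heckeEigenvalue_eq_aeval hh, pow_succ', ← haeval, D.aeval_mul_aeval_inv_eq_one hh]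
  · intro hz
    have hz' : (z : FpBar p) ^ p ^ (2 * d) = z := by
      have h : (z : FpBar p) ^ p ^ d = (z : FpBar p)⁻¹ :=
        eq_inv_of_mul_eq_one_left ((pow_succ _ _).symm.trans hz)
      rw [two_mul, pow_add, pow_mul, h, inv_pow, h, inv_inv]
    rw [← hd, ← mem_adjoin_simple_iff_pow_eq_self, mem_adjoin_simple_iff_exists_aeval] at hz'
    obtain ⟨g, hg⟩ := hz'
    obtain ⟨B, hB⟩ := D.exists_heckeEigenvalue_eq_of_inv_mem hS hs (g := g) (by
      rw [haeval, hg, ← pow_succ', hz])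
    exact ⟨B, Units.ext (hB.trans hg)⟩

theorem natCard_heckeGroup_eq_of_range_eq (hS : ∀ i, D.x i ∈ sympOrbit p (D.x i₀)) {n : ℕ}
    [NeZero (n : FpBar p)] (h : (D.heckeEigenvalue i₀).range = rootsOfUnity n (FpBar p)) :
    Nat.card (heckeGroup A) = n := by
  have : NeZero n := NeZero.of_neZero_natCast (FpBar p)
  have hcard := Nat.card_range_of_injective (D.heckeEigenvalue_injective hS)
  rw [← MonoidHom.coe_range, h] at hcard
  exact hcard.symm.trans (HasEnoughRootsOfUnity.natCard_rootsOfUnity (FpBar p) n)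

theorem natCast_prime_pow_eq_zero (i₀ : Fin d ⊕ Fin d) : ((p ^ d : ℕ) : FpBar p) = 0 := by
  have hd : d ≠ 0 := by
    rintro rfl
    exact isEmptyElim i₀
  rw [Nat.cast_pow, CharP.cast_eq_zero, zero_pow hd]

theorem natCard_heckeGroup_of_inv_notMem (hS : ∀ i, D.x i ∈ sympOrbit p (D.x i₀))
    (hns : (D.x i₀)⁻¹ ∉ galOrbit p (D.x i₀)) : Nat.card (heckeGroup A) = p ^ d - 1 := by
  have : NeZero ((p ^ d - 1 : ℕ) : FpBar p) := ⟨by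
    rw [Nat.cast_pred (pow_pos (Fact.out : p.Prime).pos d), natCast_prime_pow_eq_zero i₀, zero_sub]
    exact neg_ne_zero.2 one_ne_zero⟩
  exact D.natCard_heckeGroup_eq_of_range_eq hS (D.range_heckeEigenvalue_of_inv_notMem hS hns)

theorem natCard_heckeGroup_of_inv_mem (hS : ∀ i, D.x i ∈ sympOrbit p (D.x i₀))
    (hs : (D.x i₀)⁻¹ ∈ galOrbit p (D.x i₀)) : Nat.card (heckeGroup A) = p ^ d + 1 := by
  have : NeZero ((p ^ d + 1 : ℕ) : FpBar p) := ⟨by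
    rw [Nat.cast_succ, natCast_prime_pow_eq_zero i₀, zero_add]
    exact one_ne_zero⟩
  exact D.natCard_heckeGroup_eq_of_range_eq hS (D.range_heckeEigenvalue_of_inv_mem hS hs)

end EigenFrame

end SingleOrbit

section QuantizationTrace

variable {p : ℕ} [Fact p.Prime] {d : ℕ} {U : SpP p d →* (HilbertP p d ≃ₗᵢ[ℂ] HilbertP p d)}

/-- A representation of `Sp(2d, 𝔽_p)` by isometries, seen as a representation by linear maps. -/
def quantRep (U : SpP p d →* (HilbertP p d ≃ₗᵢ[ℂ] HilbertP p d)) :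
    SpP p d →* Module.End ℂ (HilbertP p d) where
  toFun B := (U B).toLinearEquiv.toLinearMap
  map_one' := by rw [map_one]; rfl
  map_mul' B C := by rw [map_mul]; rfl

theorem heckeEigenspace_eq_jointEigenspace (U : SpP p d →* (HilbertP p d ≃ₗᵢ[ℂ] HilbertP p d))
    (A : SpP p d) (χ : heckeGroup A →* ℂˣ) :
    heckeEigenspace U A χ = jointEigenspace ((quantRep U).comp (heckeGroup A).subtype) χ := by
  ext ψ
  rw [mem_jointEigenspace]
  rfl

theorem isQuantization_iff_forall_intertwines :
    IsQuantization U ↔ ∀ B, Intertwines B (quantRep U B) := by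
  refine forall_congr' fun B => forall_congr' fun n => ?_
  rw [LinearMap.ext_iff]
  refine forall_congr' fun ψ => ?_
  rw [LinearIsometryEquiv.inv_def, LinearIsometryEquiv.symm_apply_eq]
  rfl

/- Twirling: `U⁻¹ ∑ T(n) U T(-n) = ∑ T(nB) T(-n)`, and only the fixed vectors of `B` contribute to
the trace on the right. -/
theorem IsQuantization.trace_mul_trace_inv (hp : p ≠ 2) (hU : IsQuantization U) {B : SpP p d}
    (hB : ∀ n : PhaseP p d, n ᵥ* B.1 = n → n = 0) :
    LinearMap.trace ℂ _ (quantRep U B) * LinearMap.trace ℂ _ (quantRep U B⁻¹) = 1 := by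
  have hinv : quantRep U B⁻¹ * quantRep U B = 1 := by rw [← map_mul, inv_mul_cancel, map_one]
  have htwirl : ((p : ℂ) ^ d * LinearMap.trace ℂ _ (quantRep U B)) • quantRep U B⁻¹ =
      ∑ n : PhaseP p d, elemOp (n ᵥ* B.1) * elemOp (-n) := by
    rw [← mul_one (quantRep U B⁻¹), ← mul_smul_comm, ← sum_elemOp_mul_mul_elemOp_neg hp,
      Finset.mul_sum]
    refine Finset.sum_congr rfl fun n _ => ?_
    rw [isQuantization_iff_forall_intertwines.1 hU B n, ← mul_assoc, ← mul_assoc, hinv, one_mul]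
  have htrace := congrArg (LinearMap.trace ℂ (HilbertP p d)) htwirl
  rw [map_smul, map_sum, Finset.sum_eq_single 0, zero_vecMul, trace_elemOp_mul_neg hp, if_pos rfl,
    smul_eq_mul, mul_assoc] at htrace
  · exact mul_left_cancel₀ (pow_prime_ne_zero p d) (htrace.trans (mul_one _).symm)
  · exact fun n _ hn => (trace_elemOp_mul_neg hp _ n).trans (if_neg fun h => hn (hB n h))
  · exact fun h => absurd (Finset.mem_univ _) h

theorem EigenFrame.det_quantRep {A : SpP p d} (D : EigenFrame A)
    (U : SpP p d →* (HilbertP p d ≃ₗᵢ[ℂ] HilbertP p d)) (B : heckeGroup A) :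
    LinearMap.det (quantRep U B.1) = 1 := by
  let f : SpP p d →* ℂˣ := (LinearMap.det.comp (quantRep U)).toHomUnits
  exact congrArg Units.val <| D.map_heckeGroup_eq_one (f := f.comp (heckeGroup A).subtype)
    (fun B => map_spP_pow_prime_eq_one f B.1) B

end QuantizationTrace

section OneOrbit

variable {p : ℕ} [Fact p.Prime] {d : ℕ} {A : SpP p d} {ϑ : Set (FpBar p)}

theorem mem_sympOrbits_iff : ϑ ∈ sympOrbits A ↔ ∃ y ∈ eigenvaluesP A, sympOrbit p y = ϑ := by
  simp only [sympOrbits, Finset.mem_image, Multiset.mem_toFinset]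

theorem sympOrbit_eq_of_mem_of_mem_sympOrbits (hϑ : ϑ ∈ sympOrbits A) {y : FpBar p}
    (hy : y ∈ ϑ) : sympOrbit p y = ϑ := by
  obtain ⟨z, -, rfl⟩ := mem_sympOrbits_iff.1 hϑ
  exact sympOrbit_eq_of_mem hy

namespace EigenFrame

variable (D : EigenFrame A)

theorem mem_sympOrbits_iff_exists : ϑ ∈ sympOrbits A ↔ ∃ i, sympOrbit p (D.x i) = ϑ := by
  simp only [mem_sympOrbits_iff, D.mem_eigenvaluesP_iff, exists_exists_eq_and]

theorem exists_eq_of_mem_sympOrbits (hϑ : ϑ ∈ sympOrbits A) {y : FpBar p} (hy : y ∈ ϑ) :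
    ∃ i, D.x i = y := by
  obtain ⟨i, rfl⟩ := D.mem_sympOrbits_iff_exists.1 hϑ
  obtain ⟨j, hj⟩ := D.exists_eq_inv i
  rcases hy with hy | hy <;> obtain ⟨σ, rfl⟩ := mem_galOrbit_iff.1 hy
  · exact D.exists_eq_apply σ i
  · exact hj ▸ D.exists_eq_apply σ j

theorem exists_forall_orderOf_eq_two_iff (hp : p ≠ 2) {i₀ : Fin d ⊕ Fin d}
    (hS : ∀ i, D.x i ∈ sympOrbit p (D.x i₀)) :
    ∃ z : heckeGroup A, ∀ B : heckeGroup A, orderOf B = 2 ↔ B = z := by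
  obtain ⟨z, hz⟩ := D.exists_heckeEigenvalue_eq_aeval (h := -1) fun i => by
    rw [map_neg, map_neg, map_one, map_one, neg_mul_neg, one_mul]
  have hinj := D.heckeEigenvalue_injective hS
  have hz' : D.heckeEigenvalue i₀ z = -1 := Units.ext (by rw [hz, map_neg, map_one]; rfl)
  refine ⟨z, fun B => ?_⟩
  rw [← orderOf_injective _ hinj, ← orderOf_units, CharP.orderOf_eq_two_iff p hp, ← hinj.eq_iff,
    hz', ← Units.val_inj]
  rfl

theorem finrank_heckeEigenspace_of_natCard (hp : p ≠ 2)
    {U : SpP p d →* (HilbertP p d ≃ₗᵢ[ℂ] HilbertP p d)} (hU : IsQuantization U)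
    {i₀ : Fin d ⊕ Fin d} (hS : ∀ i, D.x i ∈ sympOrbit p (D.x i₀)) {ε : ℤ} (hε : ε = 1 ∨ ε = -1)
    (hcard : (Nat.card (heckeGroup A) : ℤ) = (p : ℤ) ^ d - ε) :
    ∃ χ₂ : heckeGroup A →* ℂˣ, (∀ χ : heckeGroup A →* ℂˣ, orderOf χ = 2 ↔ χ = χ₂) ∧
      (∀ χ ≠ χ₂, Module.finrank ℂ (heckeEigenspace U A χ) = 1) ∧
      (Module.finrank ℂ (heckeEigenspace U A χ₂) : ℤ) = 1 + ε := by
  let _ : CommGroup (heckeGroup A) :=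
    { (inferInstance : Group (heckeGroup A)) with mul_comm := D.heckeGroup_mul_comm }
  let _ : Fintype (heckeGroup A) := Fintype.ofFinite _
  obtain ⟨z, hz⟩ := D.exists_forall_orderOf_eq_two_iff hp hS
  rw [show heckeEigenspace U A = _ from funext (heckeEigenspace_eq_jointEigenspace U A)]
  refine exists_orderOf_eq_two_iff_and_finrank_jointEigenspace (D.det_quantRep U) (fun B hB => ?_)
    hε ?_ hz
  · exact hU.trace_mul_trace_inv hp fun n hn =>
      (D.eq_zero_or_eq_one_of_vecMul_eq_self hS hn).resolve_right hB
  · rw [← Nat.card_eq_fintype_card, hcard, finrank_euclideanSpace, Fintype.card_fun, ZMod.card,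
      Fintype.card_fin, Nat.cast_pow]

end EigenFrame

theorem exists_orderOf_eq_two_iff_and_finrank_heckeEigenspace (hp : p ≠ 2)
    {U : SpP p d →* (HilbertP p d ≃ₗᵢ[ℂ] HilbertP p d)} (hU : IsQuantization U)
    (hA : (eigenvaluesP A).Nodup) (hϑ : sympOrbits A = {ϑ}) :
    ∃ χ₂ : heckeGroup A →* ℂˣ,
      (∀ χ : heckeGroup A →* ℂˣ, orderOf χ = 2 ↔ χ = χ₂) ∧
      (∀ χ : heckeGroup A →* ℂˣ, χ ≠ χ₂ → Module.finrank ℂ (heckeEigenspace U A χ) = 1) ∧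
      (IsSymmetricOrbit ϑ → Module.finrank ℂ (heckeEigenspace U A χ₂) = 0) ∧
      (¬ IsSymmetricOrbit ϑ → Module.finrank ℂ (heckeEigenspace U A χ₂) = 2) := by
  obtain ⟨D⟩ := nonempty_eigenFrame hA
  have hϑA : ϑ ∈ sympOrbits A := hϑ ▸ Finset.mem_singleton_self ϑ
  have hx (i) : sympOrbit p (D.x i) = ϑ :=
    Finset.mem_singleton.1 (hϑ ▸ D.mem_sympOrbits_iff_exists.2 ⟨i, rfl⟩)
  have hS (i₀ i) : D.x i ∈ sympOrbit p (D.x i₀) := by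
    rw [hx i₀, ← hx i]
    exact mem_sympOrbit_self _
  by_cases hs : IsSymmetricOrbit ϑ
  · obtain ⟨i₀, hi₀⟩ := D.mem_sympOrbits_iff_exists.1 hϑA
    have hcard := D.natCard_heckeGroup_of_inv_mem (hS i₀) (hs _ (hi₀ ▸ mem_sympOrbit_self _))
    obtain ⟨χ₂, horder, hfinrank, hfinrank₂⟩ := D.finrank_heckeEigenspace_of_natCard hp hU (hS i₀)
      (ε := -1) (Or.inr rfl) (by rw [hcard, Nat.cast_succ, Nat.cast_pow, sub_neg_eq_add])
    exact ⟨χ₂, horder, hfinrank, fun _ => by simpa using hfinrank₂, fun h => absurd hs h⟩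
  · obtain ⟨y, hy, hyinv⟩ : ∃ y ∈ ϑ, y⁻¹ ∉ galOrbit p y := by
      simpa only [IsSymmetricOrbit, not_forall, exists_prop] using hs
    obtain ⟨i₀, rfl⟩ := D.exists_eq_of_mem_sympOrbits hϑA hy
    have hcard := D.natCard_heckeGroup_of_inv_notMem (hS i₀) hyinv
    obtain ⟨χ₂, horder, hfinrank, hfinrank₂⟩ := D.finrank_heckeEigenspace_of_natCard hp hU (hS i₀)
      (ε := 1) (Or.inl rfl)
      (by rw [hcard, Nat.cast_pred (pow_pos (Fact.out : p.Prime).pos d), Nat.cast_pow])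
    exact ⟨χ₂, horder, hfinrank, fun h => absurd h hs, fun _ => by exact_mod_cast hfinrank₂⟩

end OneOrbit

section SymplecticBasis

variable {p : ℕ} [Fact p.Prime] {d m : ℕ}

theorem finrank_phaseP (p d : ℕ) [Fact p.Prime] : Module.finrank (ZMod p) (PhaseP p d) = 2 * d := by
  rw [Module.finrank_fintype_fun_eq_card, Fintype.card_sum, Fintype.card_fin, two_mul]

theorem injective_sympBilin (p d : ℕ) [Fact p.Prime] : Function.Injective (sympBilin p d) :=
  (injective_iff_map_eq_zero _).2 fun _ h => eq_zero_of_sympForm_eq_zero (LinearMap.congr_fun h)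

theorem surjective_sympBilin (p d : ℕ) [Fact p.Prime] : Function.Surjective (sympBilin p d) :=
  (LinearMap.injective_iff_surjective_of_finrank_eq_finrank Subspace.dual_finrank_eq.symm).1
    (injective_sympBilin p d)

section Isometry

variable {φ : PhaseP p m →ₗ[ZMod p] PhaseP p d}
  (hφ : ∀ v w, sympForm (φ v) (φ w) = sympForm v w)
include hφ

theorem injective_of_sympForm_map_eq : Function.Injective φ := by
  refine (injective_iff_map_eq_zero φ).2 fun v hv => eq_zero_of_sympForm_eq_zero fun w => ?_
  rw [← hφ, hv]
  exact LinearMap.congr_fun (map_zero (sympBilin p d)) (φ w)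

theorem exists_forall_sympForm_sub_map_eq_zero (n : PhaseP p d) :
    ∃ r, ∀ v, sympForm (n - φ r) (φ v) = 0 := by
  obtain ⟨r, hr⟩ := surjective_sympBilin p m (sympBilin p d n ∘ₗ φ)
  refine ⟨r, fun v => ?_⟩
  rw [← neg_sub, sympForm_neg_left, sympForm_swap, sympForm_sub_right, sympForm_swap _ (φ r), hφ,
    sympForm_swap _ n, sub_neg_eq_add, neg_add_eq_sub, neg_neg, sub_eq_zero]
  exact (LinearMap.congr_fun hr v).symm

/- Project a vector of `V` outside the range of `φ` to the orthogonal complement of the range, and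
do the same with a partner of it. -/
theorem exists_hyperbolic_pair_orthogonal {V : Submodule (ZMod p) (PhaseP p d)}
    (hV : ∀ n ∈ V, (∀ n' ∈ V, sympForm n n' = 0) → n = 0) (hφV : LinearMap.range φ < V) :
    ∃ e ∈ V, ∃ f ∈ V, sympForm e f = 1 ∧
      (∀ v, sympForm e (φ v) = 0) ∧ ∀ v, sympForm f (φ v) = 0 := by
  have hmem (v) : φ v ∈ V := hφV.le (LinearMap.mem_range_self φ v)
  obtain ⟨x, hx, hxφ⟩ := SetLike.exists_of_lt hφV
  obtain ⟨r, hr⟩ := exists_forall_sympForm_sub_map_eq_zero hφ x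
  obtain ⟨y, hy, hxy⟩ : ∃ y ∈ V, sympForm (x - φ r) y ≠ 0 := by
    by_contra! h
    exact hxφ ⟨r, (sub_eq_zero.1 (hV _ (V.sub_mem hx (hmem r)) h)).symm⟩
  obtain ⟨s, hs⟩ := exists_forall_sympForm_sub_map_eq_zero hφ ((sympForm (x - φ r) y)⁻¹ • y)
  refine ⟨x - φ r, V.sub_mem hx (hmem r), _, V.sub_mem (V.smul_mem _ hy) (hmem s), ?_, hr, hs⟩
  rw [sympForm_sub_right, hr, sub_zero, sympForm_smul_right, inv_mul_cancel₀ hxy]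

end Isometry

theorem sympForm_succ (v w : PhaseP p (m + 1)) :
    sympForm v w = v (Sum.inl 0) * w (Sum.inr 0) - v (Sum.inr 0) * w (Sum.inl 0) +
      sympForm (v ∘ Sum.map Fin.succ Fin.succ) (w ∘ Sum.map Fin.succ Fin.succ) := by
  simp only [sympForm, dotProduct, Function.comp_apply, Fin.sum_univ_succ, Sum.map_inl, Sum.map_inr]
  ring

theorem exists_isometry_succ {V : Submodule (ZMod p) (PhaseP p d)}
    (hV : ∀ n ∈ V, (∀ n' ∈ V, sympForm n n' = 0) → n = 0) {φ : PhaseP p m →ₗ[ZMod p] PhaseP p d}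
    (hφ : ∀ v w, sympForm (φ v) (φ w) = sympForm v w) (hφV : LinearMap.range φ < V) :
    ∃ ψ : PhaseP p (m + 1) →ₗ[ZMod p] PhaseP p d,
      (∀ v w, sympForm (ψ v) (ψ w) = sympForm v w) ∧ LinearMap.range ψ ≤ V := by
  obtain ⟨e, he, f, hf, hef, heφ, hfφ⟩ := exists_hyperbolic_pair_orthogonal hφ hV hφV
  have hfe : sympForm f e = -1 := by rw [sympForm_swap, hef]
  have hφe (v) : sympForm (φ v) e = 0 := by rw [sympForm_swap, heφ, neg_zero]
  have hφf (v) : sympForm (φ v) f = 0 := by rw [sympForm_swap, hfφ, neg_zero]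
  refine ⟨(LinearMap.proj (Sum.inl 0)).smulRight e + (LinearMap.proj (Sum.inr 0)).smulRight f +
    φ ∘ₗ LinearMap.funLeft (ZMod p) (ZMod p) (Sum.map Fin.succ Fin.succ), fun v w => ?_, ?_⟩
  · rw [sympForm_succ]
    simp only [LinearMap.add_apply, LinearMap.smulRight_apply, LinearMap.proj_apply,
      LinearMap.comp_apply, sympForm_add_left, sympForm_add_right, sympForm_smul_left,
      sympForm_smul_right, sympForm_self, hef, hfe, heφ, hfφ, hφe, hφf, hφ, LinearMap.funLeft]
    simp only [LinearMap.coe_mk, AddHom.coe_mk]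
    ring
  · rintro _ ⟨v, rfl⟩
    exact V.add_mem (V.add_mem (V.smul_mem _ he) (V.smul_mem _ hf))
      (hφV.le (LinearMap.mem_range_self φ _))

theorem exists_isometry_range_eq {V : Submodule (ZMod p) (PhaseP p d)}
    (hV : ∀ n ∈ V, (∀ n' ∈ V, sympForm n n' = 0) → n = 0) :
    ∃ (m : ℕ) (φ : PhaseP p m →ₗ[ZMod p] PhaseP p d),
      (∀ v w, sympForm (φ v) (φ w) = sympForm v w) ∧ LinearMap.range φ = V := by
  by_contra! hne
  have exists_isometry (m : ℕ) : ∃ φ : PhaseP p m →ₗ[ZMod p] PhaseP p d,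
      (∀ v w, sympForm (φ v) (φ w) = sympForm v w) ∧ LinearMap.range φ ≤ V := by
    induction m with
    | zero =>
      exact ⟨0, fun v w => by simp [Subsingleton.elim v 0, sympForm],
        LinearMap.range_zero.trans_le bot_le⟩
    | succ m ih =>
      obtain ⟨φ, hφ, hφV⟩ := ih
      exact exists_isometry_succ hV hφ (hφV.lt_of_ne (hne m φ hφ))
  obtain ⟨φ, hφ, -⟩ := exists_isometry (d + 1)
  have hle := LinearMap.finrank_le_finrank_of_injective (injective_of_sympForm_map_eq hφ)
  rw [finrank_phaseP, finrank_phaseP] at hle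
  lia

end SymplecticBasis

section OrbitDecomposition

section Field

variable {K L ι : Type*} [Field K] [Field L] [Fintype ι]

theorem rank_map_ringHom (f : K →+* L) (M : Matrix ι ι K) : (M.map f).rank = M.rank := by
  classical
  obtain ⟨V, U, e, hV, hU, h⟩ := exists_rank_normal_form M
  have hmap (W : Matrix ι ι K) (hW : IsUnit W) : IsUnit (W.map f).det :=
    (isUnit_iff_isUnit_det _).1 (hW.map f.mapMatrix)
  rw [← rank_mul_eq_left_of_isUnit_det _ (M.map f) (hmap U hU),
    ← rank_mul_eq_right_of_isUnit_det _ _ (hmap V hV), ← Matrix.mul_assoc, ← Matrix.map_mul,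
    ← Matrix.map_mul, h, ← submatrix_map, fromBlocks_map, rank_submatrix]
  rw [Matrix.map_one f (map_zero f) (map_one f), Matrix.map_zero f (map_zero f),
    Matrix.map_zero f (map_zero f), Matrix.map_zero f (map_zero f), ← diagonal_one,
    ← diagonal_zero, fromBlocks_diagonal, rank_diagonal, ← Nat.card_eq_fintype_card,
    Nat.card_congr Equiv.subtypeSum]
  simp

theorem mem_iSup_eigenspace_vecMulLinear_iff [DecidableEq ι] {P : (Matrix ι ι L)ˣ}
    {M : Matrix ι ι L} {x : ι → L} (hP : P.val * M * P⁻¹.val = diagonal x) {s : Set L} {v : ι → L} :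
    v ∈ ⨆ y ∈ s, Module.End.eigenspace M.vecMulLinear y ↔
      ∀ i, x i ∉ s → (v ᵥ* P⁻¹.val) i = 0 := by
  constructor
  · suffices h : ⨆ y ∈ s, Module.End.eigenspace M.vecMulLinear y ≤
        (Submodule.pi {i | x i ∉ s} fun _ => ⊥).comap P⁻¹.val.vecMulLinear from fun hv => h hv
    refine iSup₂_le fun y hy v hv i hi => ?_
    rw [Module.End.mem_eigenspace_iff, vecMulLinear_apply] at hv
    have hM : M * P⁻¹.val = P⁻¹.val * diagonal x := by
      rw [← hP, Matrix.mul_assoc P.val, P.inv_mul_cancel_left]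
    have hi' := congrFun (congrArg (· ᵥ* P⁻¹.val) hv) i
    simp only [vecMul_vecMul, hM, smul_vecMul, Pi.smul_apply, smul_eq_mul] at hi'
    rw [← vecMul_vecMul, vecMul_diagonal, mul_comm] at hi'
    exact (mul_eq_mul_right_iff.1 hi').resolve_left fun h => hi (h ▸ hy)
  · intro h
    have hM : P.val * M = diagonal x * P.val := P.mul_inv_eq_iff_eq_mul.1 hP
    rw [← vecMul_one v, ← P.inv_mul, ← vecMul_vecMul, vecMul_eq_sum]
    refine Submodule.sum_mem _ fun i _ => ?_
    by_cases hi : x i ∈ s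
    · refine Submodule.smul_mem _ _ (Submodule.mem_iSup_of_mem (x i)
        (Submodule.mem_iSup_of_mem hi (Module.End.mem_eigenspace_iff.2 ?_)))
      rw [vecMulLinear_apply]
      exact (congrFun hM i).trans (funext fun j => diagonal_mul _ _ i j)
    · rw [h i hi, zero_smul]
      exact Submodule.zero_mem _

end Field

variable {p : ℕ} [Fact p.Prime] {d : ℕ}

namespace EigenFrame

open Polynomial

variable {A : SpP p d} (D : EigenFrame A)

/-- The symplectic orbit of an eigenvalue. -/
def orbit (i : Fin d ⊕ Fin d) : sympOrbits A :=
  ⟨sympOrbit p (D.x i), D.mem_sympOrbits_iff_exists.2 ⟨i, rfl⟩⟩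

theorem orbit_eq_iff {i : Fin d ⊕ Fin d} {ϑ : sympOrbits A} : D.orbit i = ϑ ↔ D.x i ∈ ϑ.1 := by
  refine ⟨?_, fun h => Subtype.ext (sympOrbit_eq_of_mem_of_mem_sympOrbits ϑ.2 h)⟩
  rintro rfl
  exact mem_sympOrbit_self _

theorem image_x_orbit (ϑ : sympOrbits A) : D.x '' {i | D.orbit i = ϑ} = ϑ.1 := by
  ext y
  simp only [orbit_eq_iff]
  refine ⟨fun ⟨_, hi, hiy⟩ => hiy ▸ hi, fun hy => ?_⟩
  obtain ⟨i, rfl⟩ := D.exists_eq_of_mem_sympOrbits ϑ.2 hy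
  exact ⟨i, hy, rfl⟩

open Classical in
theorem card_filter_orbit_eq (ϑ : sympOrbits A) :
    (Finset.univ.filter fun i => D.orbit i = ϑ).card = ϑ.1.ncard := by
  rw [← D.image_x_orbit ϑ, Set.ncard_image_of_injective _ D.injective,
    Set.ncard_eq_toFinset_card', Set.toFinset_ofPred]

include D in
theorem sum_ncard_sympOrbits : ∑ ϑ : sympOrbits A, ϑ.1.ncard = 2 * d := by
  classical
  simp only [← D.card_filter_orbit_eq]
  rw [← Finset.card_eq_sum_card_fiberwise fun _ _ => Finset.mem_coe.2 (Finset.mem_univ _),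
    Finset.card_univ, Fintype.card_sum, Fintype.card_fin, two_mul]

open Classical in
theorem exists_aeval_x_eq_ite_orbit (ϑ : sympOrbits A) :
    ∃ h : (ZMod p)[X], ∀ i, aeval (D.x i) h = if D.orbit i = ϑ then 1 else 0 := by
  obtain ⟨y, -, hy⟩ := mem_sympOrbits_iff.1 ϑ.2
  obtain ⟨h, hh⟩ := D.exists_aeval_x_eq (f := fun z => if z ∈ sympOrbit p y then 1 else 0)
    fun σ i => by rw [apply_ite σ, map_one, map_zero]; simp only [apply_mem_sympOrbit_iff]
  simp only [hy] at hh
  exact ⟨h, by simpa only [orbit_eq_iff] using hh⟩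

/-- A polynomial that is one on the orbit `ϑ` and zero on the other orbits. -/
def orbitPoly (ϑ : sympOrbits A) : (ZMod p)[X] := (D.exists_aeval_x_eq_ite_orbit ϑ).choose

open Classical in
theorem aeval_orbitPoly (ϑ : sympOrbits A) (i : Fin d ⊕ Fin d) :
    aeval (D.x i) (D.orbitPoly ϑ) = if D.orbit i = ϑ then 1 else 0 :=
  (D.exists_aeval_x_eq_ite_orbit ϑ).choose_spec i

/-- The projection onto `E_ϑ` along the other orbit spaces, as a matrix acting on the right. -/
def orbitProj (ϑ : sympOrbits A) : Matrix (Fin d ⊕ Fin d) (Fin d ⊕ Fin d) (ZMod p) :=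
  aeval A.1 (D.orbitPoly ϑ)

open Classical in
theorem conj_orbitProj (ϑ : sympOrbits A) :
    D.conj (D.orbitProj ϑ) = diagonal fun i => if D.orbit i = ϑ then 1 else 0 := by
  simp only [orbitProj, conj_aeval, aeval_orbitPoly]

theorem orbitProj_mul_self (ϑ : sympOrbits A) : D.orbitProj ϑ * D.orbitProj ϑ = D.orbitProj ϑ := by
  classical
  refine D.conj_injective ?_
  simp only [map_mul, conj_orbitProj, diagonal_mul_diagonal, mul_ite, mul_one, mul_zero,
    ← ite_and, and_self]

theorem orbitProj_mul_of_ne {ϑ ϑ' : sympOrbits A} (h : ϑ ≠ ϑ') :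
    D.orbitProj ϑ * D.orbitProj ϑ' = 0 := by
  classical
  refine D.conj_injective ?_
  rw [map_mul, conj_orbitProj, conj_orbitProj, diagonal_mul_diagonal, map_zero, ← diagonal_zero]
  refine congrArg diagonal (funext fun i => ?_)
  rw [ite_zero_mul_ite_zero, if_neg]
  rintro ⟨rfl, rfl⟩
  exact h rfl

theorem sum_orbitProj : ∑ ϑ, D.orbitProj ϑ = 1 := by
  classical
  refine D.conj_injective ?_
  simp only [orbitProj, ← map_sum, conj_aeval]
  simp only [map_sum, aeval_orbitPoly, Finset.sum_ite_eq, Finset.mem_univ, if_true, diagonal_one,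
    map_one]

theorem sum_vecMul_orbitProj (n : PhaseP p d) : ∑ ϑ, n ᵥ* D.orbitProj ϑ = n := by
  rw [← vecMul_sum, sum_orbitProj, vecMul_one]

/- `A` and `A⁻¹` have the same orbit projections, since orbits are closed under inversion. -/
theorem sympForm_vecMul_orbitProj (ϑ : sympOrbits A) (m n : PhaseP p d) :
    sympForm (m ᵥ* D.orbitProj ϑ) n = sympForm m (n ᵥ* D.orbitProj ϑ) := by
  classical
  have hinv : aeval A⁻¹.1 (D.orbitPoly ϑ) = D.orbitProj ϑ := by
    refine D.conj_injective ?_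
    rw [conj_aeval_inv, conj_orbitProj]
    refine congrArg diagonal (funext fun i => ?_)
    obtain ⟨j, hj⟩ := D.exists_eq_inv i
    have hij : D.orbit j = D.orbit i := Subtype.ext (by simp only [orbit, hj, sympOrbit_inv])
    rw [← hj, aeval_orbitPoly, hij]
  rw [orbitProj, sympForm_vecMul_aeval, hinv]
  rfl

theorem mem_orbitSpace_iff (ϑ : sympOrbits A) {n : PhaseP p d} :
    n ∈ orbitSpace A.1 ϑ.1 ↔ n ᵥ* D.orbitProj ϑ = n := by
  classical
  set f := algebraMap (ZMod p) (FpBar p)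
  have hproj : (f ∘ n) ᵥ* (D.orbitProj ϑ).map f ᵥ* D.P⁻¹.val =
      ((f ∘ n) ᵥ* D.P⁻¹.val) ᵥ* D.conj (D.orbitProj ϑ) := by
    rw [conj_apply, ← vecMul_vecMul, ← vecMul_vecMul, vecMul_vecMul _ D.P⁻¹.val, D.P.inv_mul,
      vecMul_one]
  have hinj : n ᵥ* D.orbitProj ϑ = n ↔
      ((f ∘ n) ᵥ* D.P⁻¹.val) ᵥ* D.conj (D.orbitProj ϑ) = (f ∘ n) ᵥ* D.P⁻¹.val := by
    rw [← hproj, (vecMul_injective_of_isUnit D.P⁻¹.isUnit).eq_iff,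
      ← (f.injective.comp_left (α := Fin d ⊕ Fin d)).eq_iff]
    rw [show f ∘ (n ᵥ* D.orbitProj ϑ) = _ from funext (RingHom.map_vecMul f (D.orbitProj ϑ) n)]
  rw [hinj, conj_orbitProj, funext_iff]
  refine (mem_iSup_eigenspace_vecMulLinear_iff D.conj_eq).trans (forall_congr' fun i => ?_)
  rw [vecMul_diagonal, mul_ite, mul_one, mul_zero, ← orbit_eq_iff, ite_eq_left_iff]
  exact imp_congr_right fun _ => eq_comm

theorem vecMul_orbitProj_mem (ϑ : sympOrbits A) (n : PhaseP p d) :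
    n ᵥ* D.orbitProj ϑ ∈ orbitSpace A.1 ϑ.1 := by
  rw [D.mem_orbitSpace_iff, vecMul_vecMul, D.orbitProj_mul_self]

include D in
theorem finrank_orbitSpace (ϑ : sympOrbits A) :
    Module.finrank (ZMod p) (orbitSpace A.1 ϑ.1) = ϑ.1.ncard := by
  classical
  have hrange : orbitSpace A.1 ϑ.1 = LinearMap.range (D.orbitProj ϑ).vecMulLinear := by
    ext n
    refine ⟨fun hn => ⟨n, (D.mem_orbitSpace_iff ϑ).1 hn⟩, ?_⟩
    rintro ⟨n, rfl⟩
    exact D.vecMul_orbitProj_mem ϑ n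
  rw [hrange, range_vecMulLinear, ← rank_eq_finrank_span_row,
    ← rank_map_ringHom (algebraMap (ZMod p) (FpBar p)),
    ← rank_mul_eq_right_of_isUnit_det D.P.val _ ((isUnit_iff_isUnit_det _).1 D.P.isUnit),
    ← rank_mul_eq_left_of_isUnit_det D.P⁻¹.val _ ((isUnit_iff_isUnit_det _).1 D.P⁻¹.isUnit),
    ← conj_apply, conj_orbitProj, rank_diagonal, Fintype.card_subtype, ← D.card_filter_orbit_eq]
  simp only [ne_eq, ite_eq_right_iff, one_ne_zero, imp_false, not_not]

include D in
theorem eq_zero_of_mem_orbitSpace (ϑ : sympOrbits A) {m : PhaseP p d}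
    (hm : m ∈ orbitSpace A.1 ϑ.1) (h : ∀ n ∈ orbitSpace A.1 ϑ.1, sympForm m n = 0) : m = 0 := by
  refine eq_zero_of_sympForm_eq_zero fun n => ?_
  rw [← (D.mem_orbitSpace_iff ϑ).1 hm, D.sympForm_vecMul_orbitProj]
  exact h _ (D.vecMul_orbitProj_mem ϑ n)

include D in
theorem exists_isometry_range_eq_orbitSpace (ϑ : sympOrbits A) :
    2 * halfDim ϑ.1 = ϑ.1.ncard ∧ ∃ φ : PhaseP p (halfDim ϑ.1) →ₗ[ZMod p] PhaseP p d,
      (∀ v w, sympForm (φ v) (φ w) = sympForm v w) ∧ LinearMap.range φ = orbitSpace A.1 ϑ.1 := by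
  obtain ⟨m, φ, hφ, hrange⟩ :=
    exists_isometry_range_eq fun n hn h => D.eq_zero_of_mem_orbitSpace ϑ hn h
  have hm : ϑ.1.ncard = 2 * m := by
    rw [← D.finrank_orbitSpace, ← hrange,
      LinearMap.finrank_range_of_inj (injective_of_sympForm_map_eq hφ), finrank_phaseP]
  obtain rfl : m = halfDim ϑ.1 := by rw [halfDim, hm, Nat.mul_div_cancel_left _ two_pos]
  exact ⟨hm.symm, φ, hφ, hrange⟩

include D in
theorem sum_halfDim : ∑ ϑ : sympOrbits A, halfDim ϑ.1 = d := by
  refine Nat.eq_of_mul_eq_mul_left two_pos ?_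
  rw [← D.sum_ncard_sympOrbits, Finset.mul_sum]
  exact Finset.sum_congr rfl fun ϑ _ => (D.exists_isometry_range_eq_orbitSpace ϑ).1

theorem exists_linearEquiv_pi_map_eq_vecMul_orbitProj {m : sympOrbits A → ℕ}
    {φ : (ϑ : sympOrbits A) → PhaseP p (m ϑ) →ₗ[ZMod p] PhaseP p d}
    (hinj : ∀ ϑ, Function.Injective (φ ϑ))
    (hrange : ∀ ϑ, LinearMap.range (φ ϑ) = orbitSpace A.1 ϑ.1) :
    ∃ c : PhaseP p d ≃ₗ[ZMod p] ((ϑ : sympOrbits A) → PhaseP p (m ϑ)),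
      ∀ n ϑ, φ ϑ (c n ϑ) = n ᵥ* D.orbitProj ϑ := by
  classical
  have hφ (ϑ v) : φ ϑ v ᵥ* D.orbitProj ϑ = φ ϑ v :=
    (D.mem_orbitSpace_iff ϑ).1 (hrange ϑ ▸ LinearMap.mem_range_self (φ ϑ) v)
  have hproj (c ϑ) : LinearMap.lsum (ZMod p) _ (ZMod p) φ c ᵥ* D.orbitProj ϑ = φ ϑ (c ϑ) := by
    rw [LinearMap.lsum_apply, LinearMap.sum_apply, sum_vecMul, Finset.sum_eq_single ϑ]
    · exact hφ ϑ (c ϑ)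
    · intro ϑ' _ h
      rw [LinearMap.comp_apply, ← hφ, vecMul_vecMul, D.orbitProj_mul_of_ne h, vecMul_zero]
    · exact fun h => absurd (Finset.mem_univ ϑ) h
  choose c hc using fun n ϑ => LinearMap.mem_range.1 (hrange ϑ ▸ D.vecMul_orbitProj_mem ϑ n)
  have hbij : Function.Bijective (LinearMap.lsum (ZMod p) _ (ZMod p) φ) := by
    refine ⟨fun v w h => funext fun ϑ => hinj ϑ ?_, fun n => ⟨c n, ?_⟩⟩
    · rw [← hproj, h, hproj]
    · rw [← D.sum_vecMul_orbitProj (LinearMap.lsum _ _ _ φ _)]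
      simp only [hproj, hc, D.sum_vecMul_orbitProj]
  refine ⟨(LinearEquiv.ofBijective _ hbij).symm, fun n ϑ => ?_⟩
  rw [← hproj]
  exact congrArg (· ᵥ* D.orbitProj ϑ) ((LinearEquiv.ofBijective _ hbij).apply_symm_apply n)

include D in
theorem nonempty_sympDecomposition : Nonempty (SympDecomposition A) := by
  choose φ hφ hrange using fun ϑ => (D.exists_isometry_range_eq_orbitSpace ϑ).2
  have hinj (ϑ) := injective_of_sympForm_map_eq (hφ ϑ)
  obtain ⟨c, hc⟩ := D.exists_linearEquiv_pi_map_eq_vecMul_orbitProj hinj hrange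
  refine ⟨⟨c, fun ϑ n => ?_, fun m n => ?_⟩⟩
  · have hzero (ϑ') : c n ϑ' = 0 ↔ n ᵥ* D.orbitProj ϑ' = 0 := by
      rw [← hc, map_eq_zero_iff _ (hinj ϑ')]
    simp only [D.mem_orbitSpace_iff, hzero]
    refine ⟨fun h ϑ' hne => ?_, fun h => ?_⟩
    · rw [← h, vecMul_vecMul, D.orbitProj_mul_of_ne hne.symm, vecMul_zero]
    · conv_rhs => rw [← D.sum_vecMul_orbitProj n]
      exact (Fintype.sum_eq_single ϑ h).symm
  · conv_lhs => rw [← D.sum_vecMul_orbitProj n]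
    refine (map_sum (sympBilin p d m) _ _).trans (Finset.sum_congr rfl fun ϑ _ => ?_)
    rw [← hφ, hc, hc, D.sympForm_vecMul_orbitProj, vecMul_vecMul, D.orbitProj_mul_self]
    rfl

end EigenFrame

end OrbitDecomposition

section Gluing

namespace SympDecomposition

open Polynomial

variable {p : ℕ} [Fact p.Prime] {d : ℕ} {A : SpP p d} (S : SympDecomposition A)

theorem incl_vecMul_aeval (ϑ : sympOrbits A) (v : PhaseP p (halfDim ϑ.1)) (h : (ZMod p)[X]) :
    S.incl ϑ v ᵥ* aeval A.1 h = S.incl ϑ (v ᵥ* aeval (S.comp ϑ).1 h) := by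
  induction h using Polynomial.induction_on with
  | C a =>
    rw [aeval_C, aeval_C, Algebra.algebraMap_eq_smul_one, Algebra.algebraMap_eq_smul_one,
      vecMul_smul, vecMul_smul, vecMul_one, vecMul_one, map_smul]
  | add f g hf hg => rw [map_add, vecMul_add, hf, hg, map_add, vecMul_add, map_add]
  | monomial n a hn =>
    rw [pow_succ, ← mul_assoc, map_mul, ← vecMul_vecMul, hn, aeval_X, S.incl_vecMul rfl,
      map_mul _ _ X, aeval_X, ← vecMul_vecMul]
    rfl

theorem aeval_x_charpoly_comp (D : EigenFrame A) {ϑ : sympOrbits A} {i : Fin d ⊕ Fin d}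
    (hi : D.orbit i = ϑ) : aeval (D.x i) (S.comp ϑ).1.charpoly = 0 := by
  have hzero : D.orbitProj ϑ * aeval A.1 (S.comp ϑ).1.charpoly = 0 := by
    refine Matrix.ext_of_single_vecMul fun j => ?_
    rw [← vecMul_vecMul, ← S.incl_coord (D.vecMul_orbitProj_mem ϑ (Pi.single j 1)),
      incl_vecMul_aeval, aeval_self_charpoly, vecMul_zero, map_zero, vecMul_zero]
  have hconj := congrArg D.conj hzero
  rw [EigenFrame.orbitProj, ← map_mul (aeval A.1), D.conj_aeval, map_zero, ← diagonal_zero] at hconj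
  have hi' := congrFun (diagonal_injective hconj) i
  rwa [map_mul, D.aeval_orbitPoly, if_pos hi, one_mul] at hi'

open Classical in
theorem eigenvaluesP_comp (D : EigenFrame A) (ϑ : sympOrbits A) :
    eigenvaluesP (S.comp ϑ) =
      ((Finset.univ.filter fun i => D.orbit i = ϑ).map ⟨D.x, D.injective⟩).val := by
  refine (Multiset.eq_of_le_of_card_le ?_ ?_).symm
  · rw [Multiset.le_iff_subset (Finset.nodup _)]
    intro y hy
    rw [Finset.mem_val] at hy
    obtain ⟨i, hi, rfl⟩ := Finset.mem_map.1 hy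
    exact mem_aroots.2 ⟨(charpoly_monic _).ne_zero,
      S.aeval_x_charpoly_comp D (Finset.mem_filter.1 hi).2⟩
  · refine (card_roots' _).trans_eq ?_
    rw [natDegree_map, charpoly_natDegree_eq_dim, Fintype.card_sum, Fintype.card_fin, ← two_mul,
      (D.exists_isometry_range_eq_orbitSpace ϑ).1, Finset.card_val, Finset.card_map,
      D.card_filter_orbit_eq]

theorem nodup_eigenvaluesP_comp (D : EigenFrame A) (ϑ : sympOrbits A) :
    (eigenvaluesP (S.comp ϑ)).Nodup := by
  classical
  exact S.eigenvaluesP_comp D ϑ ▸ Finset.nodup _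

theorem mem_eigenvaluesP_comp_iff (D : EigenFrame A) {ϑ : sympOrbits A} {y : FpBar p} :
    y ∈ eigenvaluesP (S.comp ϑ) ↔ y ∈ ϑ.1 := by
  classical
  rw [S.eigenvaluesP_comp D, Finset.mem_val, ← D.image_x_orbit]
  simp only [Finset.mem_map, Finset.mem_filter_univ, Function.Embedding.coeFn_mk, Set.mem_image,
    Set.mem_ofPred_eq]

theorem sympOrbits_comp (D : EigenFrame A) (ϑ : sympOrbits A) :
    sympOrbits (S.comp ϑ) = {ϑ.1} := by
  ext ϑ'
  rw [mem_sympOrbits_iff, Finset.mem_singleton]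
  simp only [S.mem_eigenvaluesP_comp_iff D]
  constructor
  · rintro ⟨y, hy, rfl⟩
    exact sympOrbit_eq_of_mem_of_mem_sympOrbits ϑ.2 hy
  · rintro rfl
    obtain ⟨y, -, hy⟩ := mem_sympOrbits_iff.1 ϑ.2
    exact ⟨y, hy ▸ mem_sympOrbit_self y, hy⟩

theorem sum_incl_coord (n : PhaseP p d) : ∑ ϑ, S.incl ϑ (S.coord n ϑ) = n := by
  refine S.coord.injective (funext fun ϑ => ?_)
  rw [map_sum, Finset.sum_apply, Finset.sum_eq_single ϑ, coord_incl_self]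
  · exact fun ϑ' _ h => S.coord_incl_ne h.symm _
  · exact fun h => absurd (Finset.mem_univ ϑ) h

theorem coord_vecMul {B : Matrix (Fin d ⊕ Fin d) (Fin d ⊕ Fin d) (ZMod p)}
    (h : A.1 * B = B * A.1) (n : PhaseP p d) (ϑ : sympOrbits A) :
    S.coord (n ᵥ* B) ϑ = S.coord n ϑ ᵥ* S.compMatrix B ϑ := by
  conv_lhs => rw [← S.sum_incl_coord n, sum_vecMul, map_sum]
  rw [Finset.sum_apply, Finset.sum_eq_single ϑ, S.incl_vecMul h, coord_incl_self]
  · exact fun ϑ' _ hne => S.incl_vecMul h ϑ' _ ▸ S.coord_incl_ne hne.symm _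
  · exact fun h => absurd (Finset.mem_univ ϑ) h

/-- The linear map of the phase space that acts on the coordinates in each `E_ϑ` by `g ϑ`. -/
def glueLinearMap (g : (ϑ : sympOrbits A) → SpP p (halfDim ϑ.1)) :
    PhaseP p d →ₗ[ZMod p] PhaseP p d :=
  S.coord.symm.toLinearMap ∘ₗ
    LinearMap.piMap (fun ϑ => (g ϑ).1.vecMulLinear) ∘ₗ S.coord.toLinearMap

theorem coord_glueLinearMap (g : (ϑ : sympOrbits A) → SpP p (halfDim ϑ.1)) (n : PhaseP p d)
    (ϑ : sympOrbits A) : S.coord (S.glueLinearMap g n) ϑ = S.coord n ϑ ᵥ* (g ϑ).1 :=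
  congrFun (S.coord.apply_symm_apply _) ϑ

theorem sympForm_glueLinearMap (g : (ϑ : sympOrbits A) → SpP p (halfDim ϑ.1)) (m n : PhaseP p d) :
    sympForm (S.glueLinearMap g m) (S.glueLinearMap g n) = sympForm m n := by
  simp only [S.form_eq, coord_glueLinearMap, sympForm_vecMul_vecMul]

theorem spP_ext_coord {B C : SpP p d} (h : ∀ n ϑ, S.coord (n ᵥ* B.1) ϑ = S.coord (n ᵥ* C.1) ϑ) :
    B = C :=
  spP_ext fun n => S.coord.injective (funext (h n))

/-- The homomorphism `∏_ϑ Sp(2d_ϑ, 𝔽_p) → Sp(2d, 𝔽_p)` by which `g` acts on the coordinates in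
each `E_ϑ` by `g ϑ`. -/
def glue : ((ϑ : sympOrbits A) → SpP p (halfDim ϑ.1)) →* SpP p d :=
  MonoidHom.mk' (fun g => spOfLinearMap (S.glueLinearMap g) (S.sympForm_glueLinearMap g))
    fun g h => S.spP_ext_coord fun n ϑ => by
      simp only [vecMul_mul_spP, vecMul_spOfLinearMap, coord_glueLinearMap, Pi.mul_apply]

theorem coord_vecMul_glue (g : (ϑ : sympOrbits A) → SpP p (halfDim ϑ.1)) (n : PhaseP p d)
    (ϑ : sympOrbits A) : S.coord (n ᵥ* (S.glue g).1) ϑ = S.coord n ϑ ᵥ* (g ϑ).1 :=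
  (congrArg (fun m => S.coord m ϑ) (vecMul_spOfLinearMap _ (S.sympForm_glueLinearMap g) n)).trans
    (S.coord_glueLinearMap g n ϑ)

theorem glue_comp : S.glue S.comp = A :=
  S.spP_ext_coord fun n ϑ => (S.coord_vecMul_glue _ n ϑ).trans (S.coord_vecMul rfl n ϑ).symm

theorem glue_heckeComp (B : heckeGroup A) : S.glue (fun ϑ => (S.heckeComp ϑ B).1) = B.1 :=
  S.spP_ext_coord fun n ϑ =>
    (S.coord_vecMul_glue _ n ϑ).trans (S.coord_vecMul (heckeGroup_comm B) n ϑ).symm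

theorem glue_mem_heckeGroup (g : (ϑ : sympOrbits A) → heckeGroup (S.comp ϑ)) :
    S.glue (fun ϑ => (g ϑ).1) ∈ heckeGroup A := by
  have hcomm : (fun ϑ => (g ϑ).1) * S.comp = S.comp * fun ϑ => (g ϑ).1 :=
    funext fun ϑ => Subgroup.mem_centralizer_singleton_iff.1 (g ϑ).2
  have hglue := congrArg S.glue hcomm
  rw [map_mul, map_mul, glue_comp] at hglue
  exact Subgroup.mem_centralizer_singleton_iff.2 hglue

/-- The isomorphism `C_p(A) ≃ ∏_ϑ C_p(A_ϑ)`, `B ↦ (B_ϑ)_ϑ`. -/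
def heckeEquiv : heckeGroup A ≃* ((ϑ : sympOrbits A) → heckeGroup (S.comp ϑ)) where
  toFun B ϑ := S.heckeComp ϑ B
  invFun g := ⟨S.glue fun ϑ => (g ϑ).1, S.glue_mem_heckeGroup g⟩
  left_inv B := Subtype.ext (S.glue_heckeComp B)
  right_inv g := funext fun ϑ => Subtype.ext <| spP_ext fun v =>
    (S.vecMul_compMatrix _ ϑ v).trans <| by
      rw [coord_vecMul_glue, coord_incl_self]
  map_mul' B C := funext fun ϑ => map_mul (S.heckeComp ϑ) B C

theorem prodChar_apply (χ : (ϑ : sympOrbits A) → heckeGroup (S.comp ϑ) →* ℂˣ) (B : heckeGroup A) :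
    S.prodChar χ B = ∏ ϑ, χ ϑ (S.heckeComp ϑ B) :=
  MonoidHom.finsetProd_apply _ _ _

theorem prodChar_bijective : Function.Bijective S.prodChar := by
  classical
  let e : ((ϑ : sympOrbits A) → heckeGroup (S.comp ϑ) →* ℂˣ) ≃ (heckeGroup A →* ℂˣ) :=
    (Equiv.subtypeUnivEquiv fun χ => fun _ _ _ _ _ => Commute.all _ _).symm.trans
      (MonoidHom.noncommPiCoprodEquiv.trans (S.heckeEquiv.symm.monoidHomCongrLeftEquiv))
  have he : S.prodChar = e := by
    funext χ
    ext1 B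
    rw [prodChar_apply]
    exact (Finset.noncommProd_eq_prod _ _).symm
  exact he ▸ e.bijective

end SympDecomposition

end Gluing

section TensorProducts

section Field

variable {ι K : Type*} [Field K] {M κ : ι → Type*} [∀ i, AddCommGroup (M i)] [∀ i, Module K (M i)]
  {v : ∀ i, κ i → M i}

theorem linearIndependent_tprod [Finite ι] (h : ∀ i, LinearIndependent K (v i)) :
    LinearIndependent K fun f : ∀ i, κ i => PiTensorProduct.tprod K fun i => v i (f i) := by
  let e : (∀ i, κ i) → ∀ i, (h i).linearIndepOn_id.extend (Set.subset_univ _) := fun f i =>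
    ⟨v i (f i), (h i).linearIndepOn_id.subset_extend _ ⟨f i, rfl⟩⟩
  have e_injective : Function.Injective e := fun f g hfg =>
    funext fun i => (h i).injective (congrArg Subtype.val (congrFun hfg i))
  convert! (Basis.piTensorProduct fun i =>
    Module.Basis.extend (h i).linearIndepOn_id).linearIndependent.comp e e_injective using 2 with f
  simp only [Function.comp_apply, Basis.piTensorProduct_apply, Module.Basis.extend_apply_self, e]

theorem range_mapIncl_eq_span_tprod [Finite ι] {W : ∀ i, Submodule K (M i)}
    (h : ∀ i, Submodule.span K (Set.range (v i)) = W i) :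
    LinearMap.range (PiTensorProduct.mapIncl W) = Submodule.span K
      (Set.range fun f : ∀ i, κ i => PiTensorProduct.tprod K fun i => v i (f i)) := by
  obtain rfl : (fun i => Submodule.span K (Set.range (v i))) = W := funext h
  rw [LinearMap.range_eq_map, ← PiTensorProduct.submodule_span_eq_top
    (g := fun i j => ⟨v i j, Submodule.subset_span ⟨j, rfl⟩⟩) fun i =>
      (Submodule.span_range_subtype_eq_top_iff _ _).2 rfl, Submodule.map_span, ← Set.range_comp]
  refine congrArg _ (congrArg _ (funext fun f => ?_))
  exact PiTensorProduct.map_tprod _ _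

theorem exists_monoidHom_units_eq_smul {G V : Type*} [Group G] [AddCommGroup V] [Module K V]
    [Nontrivial V] {ρ σ : G →* Module.End K V} (h : ∀ g, ∃ c : K, ρ g = c • σ g) :
    ∃ c : G →* Kˣ, ∀ g, ρ g = c g • σ g := by
  choose c hc using h
  have smul_injective (g : G) {a b : K} (hab : a • σ g = b • σ g) : a = b := by
    refine smul_left_injective K (?_ : σ g ≠ 0) hab
    exact ((Group.isUnit g).map σ).ne_zero
  let f : G →* K :=
    { toFun := c
      map_one' := smul_injective 1 (by rw [← hc, one_smul, map_one, map_one])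
      map_mul' := fun g k => smul_injective (g * k) (by
        rw [← hc, map_mul, map_mul, hc, hc k, smul_mul_smul_comm]) }
  exact ⟨f.toHomUnits, hc⟩

end Field

section TensorRepresentation

variable {ι : Type*} {G V : ι → Type*} [∀ i, Group (G i)] [∀ i, AddCommGroup (V i)]
  [∀ i, Module ℂ (V i)] (ρ : ∀ i, G i →* Module.End ℂ (V i)) (χ : ∀ i, G i →* ℂˣ)

/-- The external tensor product of representations, as a representation of the product group. -/
def tensorRep : (∀ i, G i) →* Module.End ℂ (PiTensorProduct ℂ V) :=
  PiTensorProduct.mapMonoidHom.comp (MonoidHom.piMap ρ)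

theorem tensorRep_apply (g : ∀ i, G i) :
    tensorRep ρ g = PiTensorProduct.map fun i => ρ i (g i) := rfl

variable [Fintype ι]

/-- The external product of linear characters, as a character of the product group. -/
def tensorChar : (∀ i, G i) →* ℂˣ :=
  ∏ i, (χ i).comp (Pi.evalMonoidHom G i)

theorem tensorChar_apply (g : ∀ i, G i) : tensorChar χ g = ∏ i, χ i (g i) :=
  MonoidHom.finsetProd_apply _ _ _

theorem charProj_tensorRep [DecidableEq ι] [∀ i, Fintype (G i)] :
    charProj (tensorRep ρ) (tensorChar χ) =
      PiTensorProduct.map fun i => charProj (ρ i) (χ i) := by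
  change _ = PiTensorProduct.mapMultilinear ℂ V V fun i => charProj (ρ i) (χ i)
  simp only [charProj]
  rw [MultilinearMap.map_smul_univ, MultilinearMap.map_sum]
  simp only [MultilinearMap.map_smul_univ, tensorChar_apply, Units.coe_prod, tensorRep_apply,
    Fintype.card_pi, Nat.cast_prod, Finset.prod_inv_distrib]
  rfl

theorem jointEigenspace_tensorRep [∀ i, Finite (G i)] :
    jointEigenspace (tensorRep ρ) (tensorChar χ) =
      LinearMap.range (PiTensorProduct.mapIncl fun i => jointEigenspace (ρ i) (χ i)) := by
  classical
  have := fun i => Fintype.ofFinite (G i)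
  rw [← (isProj_charProj _ _).range, charProj_tensorRep, PiTensorProduct.mapIncl,
    PiTensorProduct.map_range_eq_span_tprod, PiTensorProduct.map_range_eq_span_tprod]
  congr 1
  ext t
  constructor
  · rintro ⟨m, rfl⟩
    exact ⟨fun i => ⟨_, (isProj_charProj (ρ i) (χ i)).map_mem (m i)⟩, rfl⟩
  · rintro ⟨m, rfl⟩
    exact ⟨fun i => m i, congrArg _ (funext fun i =>
      (isProj_charProj (ρ i) (χ i)).map_id _ (m i).2)⟩

end TensorRepresentation

end TensorProducts

section TensorIntertwiner

variable {p : ℕ} [Fact p.Prime] {d : ℕ} {A : SpP p d}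

/-- The representation `⨂_ϑ U_ϑ` of `∏_ϑ Sp(2d_ϑ, 𝔽_p)`, transported by `𝒰⁻¹` to the space on which
`U` represents `Sp(2d, 𝔽_p)`. -/
def tensorQuantRep (U : (d : ℕ) → SpP p d →* (HilbertP p d ≃ₗᵢ[ℂ] HilbertP p d))
    (𝒰 : HilbertP p d ≃ₗ[ℂ]
      PiTensorProduct ℂ fun ϑ : sympOrbits A => HilbertP p (halfDim ϑ.1)) :
    ((ϑ : sympOrbits A) → SpP p (halfDim ϑ.1)) →* Module.End ℂ (HilbertP p d) :=
  ((𝒰.symm.conjAlgEquiv ℂ).toMulEquiv.toMonoidHom).comp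
    (tensorRep fun ϑ : sympOrbits A => quantRep (U (halfDim ϑ.1)))

namespace SympDecomposition

namespace IsTensorIntertwiner

variable {S : SympDecomposition A}
  {𝒰 : HilbertP p d ≃ₗ[ℂ] PiTensorProduct ℂ fun ϑ : sympOrbits A => HilbertP p (halfDim ϑ.1)}
  {U : (d : ℕ) → SpP p d →* (HilbertP p d ≃ₗᵢ[ℂ] HilbertP p d)}

theorem elemOp_eq (h𝒰 : S.IsTensorIntertwiner 𝒰) (n : PhaseP p d) :
    elemOp n = 𝒰.symm.conjAlgEquiv ℂ (PiTensorProduct.map fun ϑ => elemOp (S.coord n ϑ)) := by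
  ext1 ψ
  exact 𝒰.eq_symm_apply.2 (h𝒰.intertwines n ψ)

theorem intertwines_tensorQuantRep (h𝒰 : S.IsTensorIntertwiner 𝒰)
    (hU : ∀ d, IsQuantization (U d)) (g : (ϑ : sympOrbits A) → SpP p (halfDim ϑ.1)) :
    Intertwines (S.glue g) (tensorQuantRep U 𝒰 g) := by
  intro n
  rw [h𝒰.elemOp_eq, h𝒰.elemOp_eq]
  refine (map_mul (𝒰.symm.conjAlgEquiv ℂ) _ _).symm.trans
    (Eq.trans (congrArg _ ?_) (map_mul (𝒰.symm.conjAlgEquiv ℂ) _ _))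
  rw [tensorRep_apply, ← PiTensorProduct.map_mul, ← PiTensorProduct.map_mul]
  refine congrArg _ (funext fun ϑ => ?_)
  rw [coord_vecMul_glue]
  exact isQuantization_iff_forall_intertwines.1 (hU _) (g ϑ) _

theorem exists_quantRep_glue_eq_smul (hp : p ≠ 2) (h𝒰 : S.IsTensorIntertwiner 𝒰)
    (hU : ∀ d, IsQuantization (U d)) :
    ∃ c : ((ϑ : sympOrbits A) → SpP p (halfDim ϑ.1)) →* ℂˣ,
      ∀ g, quantRep (U d) (S.glue g) = c g • tensorQuantRep U 𝒰 g :=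
  exists_monoidHom_units_eq_smul (ρ := (quantRep (U d)).comp S.glue) fun g =>
    (h𝒰.intertwines_tensorQuantRep hU g).exists_eq_smul hp
      ((Group.isUnit g).map (tensorQuantRep U 𝒰)).ne_zero
      (isQuantization_iff_forall_intertwines.1 (hU d) _)

/- Both sides intertwine the Weyl operators in the same way, so that they differ by a character of
`∏_ϑ Sp(2d_ϑ, 𝔽_p)`. Its order divides `p`, while that of `C_p(A)` is prime to `p`. -/
theorem quantRep_eq_tensorQuantRep (hp : p ≠ 2) (D : EigenFrame A) (h𝒰 : S.IsTensorIntertwiner 𝒰)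
    (hU : ∀ d, IsQuantization (U d)) (B : heckeGroup A) :
    quantRep (U d) B.1 = tensorQuantRep U 𝒰 fun ϑ => (S.heckeComp ϑ B).1 := by
  classical
  obtain ⟨c, hc⟩ := h𝒰.exists_quantRep_glue_eq_smul hp hU
  have c_pow : c ^ p = 1 := MonoidHom.pi_ext fun ϑ g =>
    map_spP_pow_prime_eq_one
      (c.comp (MonoidHom.mulSingle (fun ϑ : sympOrbits A => SpP p (halfDim ϑ.1)) ϑ)) g
  let f : heckeGroup A →* ℂˣ :=
    c.comp (MonoidHom.pi fun ϑ => (heckeGroup (S.comp ϑ)).subtype.comp (S.heckeComp ϑ))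
  have f_apply : f B = 1 := D.map_heckeGroup_eq_one (f := f) (fun B => DFunLike.congr_fun c_pow _) B
  rw [← S.glue_heckeComp B, hc]
  exact (congrArg (· • _) f_apply).trans (one_smul _ _)

theorem heckeEigenspace_prodChar (hp : p ≠ 2) (D : EigenFrame A) (h𝒰 : S.IsTensorIntertwiner 𝒰)
    (hU : ∀ d, IsQuantization (U d))
    (χ : (ϑ : sympOrbits A) → heckeGroup (S.comp ϑ) →* ℂˣ) :
    heckeEigenspace (U d) A (S.prodChar χ) =
      (jointEigenspace (tensorRep fun ϑ : sympOrbits A => (quantRep (U (halfDim ϑ.1))).comp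
        (heckeGroup (S.comp ϑ)).subtype) (tensorChar χ)).map 𝒰.symm.toLinearMap := by
  ext ψ
  rw [heckeEigenspace_eq_jointEigenspace, Submodule.map_equiv_eq_comap_symm, Submodule.mem_comap,
    mem_jointEigenspace, mem_jointEigenspace, S.heckeEquiv.surjective.forall]
  refine forall_congr' fun B => ?_
  rw [tensorChar_apply, prodChar_apply, ← 𝒰.symm.injective.eq_iff]
  refine Eq.congr (LinearMap.congr_fun (h𝒰.quantRep_eq_tensorQuantRep hp D hU B) ψ) ?_
  exact ((map_smul 𝒰.symm _ _).trans (congrArg _ (𝒰.symm_apply_apply ψ))).symm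

theorem linearIndependent_and_span_heckeEigenspace (hp : p ≠ 2) (D : EigenFrame A)
    (h𝒰 : S.IsTensorIntertwiner 𝒰) (hU : ∀ d, IsQuantization (U d))
    {χ : (ϑ : sympOrbits A) → heckeGroup (S.comp ϑ) →* ℂˣ} {κ : sympOrbits A → Type*}
    {v : (ϑ : sympOrbits A) → κ ϑ → HilbertP p (halfDim ϑ.1)}
    (hv : ∀ ϑ, LinearIndependent ℂ (v ϑ) ∧ Submodule.span ℂ (Set.range (v ϑ)) =
      heckeEigenspace (U (halfDim ϑ.1)) (S.comp ϑ) (χ ϑ)) :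
    LinearIndependent ℂ (fun f : (ϑ : sympOrbits A) → κ ϑ =>
        𝒰.symm (PiTensorProduct.tprod ℂ fun ϑ => v ϑ (f ϑ))) ∧
      Submodule.span ℂ (Set.range fun f : (ϑ : sympOrbits A) → κ ϑ =>
        𝒰.symm (PiTensorProduct.tprod ℂ fun ϑ => v ϑ (f ϑ))) =
        heckeEigenspace (U d) A (S.prodChar χ) := by
  refine ⟨(linearIndependent_tprod fun ϑ => (hv ϑ).1).map' 𝒰.symm.toLinearMap 𝒰.symm.ker, ?_⟩
  rw [h𝒰.heckeEigenspace_prodChar hp D hU, jointEigenspace_tensorRep, range_mapIncl_eq_span_tprod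
    fun ϑ => (hv ϑ).2.trans (heckeEigenspace_eq_jointEigenspace _ _ _), Submodule.map_span,
    ← Set.range_comp]
  rfl

theorem finrank_heckeEigenspace_prodChar (hp : p ≠ 2) (D : EigenFrame A)
    (h𝒰 : S.IsTensorIntertwiner 𝒰) (hU : ∀ d, IsQuantization (U d))
    (χ : (ϑ : sympOrbits A) → heckeGroup (S.comp ϑ) →* ℂˣ) :
    Module.finrank ℂ (heckeEigenspace (U d) A (S.prodChar χ)) =
      ∏ ϑ, Module.finrank ℂ (heckeEigenspace (U (halfDim ϑ.1)) (S.comp ϑ) (χ ϑ)) := by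
  let b (ϑ : sympOrbits A) :=
    Module.finBasis ℂ (heckeEigenspace (U (halfDim ϑ.1)) (S.comp ϑ) (χ ϑ))
  have b_span (ϑ : sympOrbits A) : Submodule.span ℂ (Set.range fun j => (b ϑ j : HilbertP p _)) =
      heckeEigenspace (U (halfDim ϑ.1)) (S.comp ϑ) (χ ϑ) := by
    rw [Set.range_comp', ← Submodule.coe_subtype, ← Submodule.map_span, (b ϑ).span_eq,
      Submodule.map_top, Submodule.range_subtype]
  obtain ⟨hli, hspan⟩ := h𝒰.linearIndependent_and_span_heckeEigenspace hp D hU fun ϑ =>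
    ⟨(b ϑ).linearIndependent.map' (Submodule.subtype _) (Submodule.ker_subtype _), b_span ϑ⟩
  rw [← hspan, finrank_span_eq_card hli, Fintype.card_pi]
  simp only [Fintype.card_fin]

end IsTensorIntertwiner

end SympDecomposition

end TensorIntertwiner

section BlockDecomposition

variable {p : ℕ} [Fact p.Prime] {d : ℕ} {ι : Type*} {k : ι → ℕ}
  (e : (Σ i, Fin (k i)) ≃ Fin d)

/-- The splitting `𝔽_p^d ≃ ∏_i 𝔽_p^{k_i}` along a partition of the coordinates into blocks. -/
def splitVec : (Fin d → ZMod p) ≃ₗ[ZMod p] ((i : ι) → Fin (k i) → ZMod p) :=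
  LinearEquiv.funCongrLeft _ _ e ≪≫ₗ LinearEquiv.piCurry _ fun _ _ => ZMod p

/-- The splitting `𝔽_p^{2d} ≃ ∏_i 𝔽_p^{2k_i}` along a partition of the coordinates into blocks. -/
def splitPhase : PhaseP p d ≃ₗ[ZMod p] ((i : ι) → PhaseP p (k i)) :=
  LinearEquiv.funCongrLeft _ _ ((Equiv.sigmaSumDistrib _ _).trans (e.sumCongr e)) ≪≫ₗ
    LinearEquiv.piCurry _ fun _ _ => ZMod p

theorem splitPhase_comp_inl (n : PhaseP p d) (i : ι) :
    splitPhase e n i ∘ Sum.inl = splitVec e (n ∘ Sum.inl) i := rfl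

theorem splitPhase_comp_inr (n : PhaseP p d) (i : ι) :
    splitPhase e n i ∘ Sum.inr = splitVec e (n ∘ Sum.inr) i := rfl

variable [Fintype ι]

theorem stdAddChar_sum (f : ι → ZMod p) :
    ZMod.stdAddChar (∑ i, f i) = ∏ i, ZMod.stdAddChar (f i) :=
  map_prod (ZMod.stdAddChar (N := p)).toMonoidHom (fun i => Multiplicative.ofAdd (f i)) _

theorem dotProduct_splitVec (y z : Fin d → ZMod p) :
    ∑ i, splitVec e y i ⬝ᵥ splitVec e z i = y ⬝ᵥ z :=
  (Fintype.sum_sigma fun a => y (e a) * z (e a)).symm.trans (e.sum_comp fun j => y j * z j)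

theorem sum_sympForm_splitPhase (m n : PhaseP p d) :
    ∑ i, sympForm (splitPhase e m i) (splitPhase e n i) = sympForm m n := by
  simp only [sympForm, splitPhase_comp_inl, splitPhase_comp_inr, Finset.sum_sub_distrib,
    dotProduct_splitVec]

/-- The isomorphism `⨂_i L²(𝔽_p^{k_i}) ≃ L²(𝔽_p^d)` along a partition of the coordinates into
blocks. -/
def blockTensor : PiTensorProduct ℂ (fun i => HilbertP p (k i)) ≃ₗ[ℂ] HilbertP p d :=
  (Basis.piTensorProduct fun i =>
      (EuclideanSpace.basisFun (Fin (k i) → ZMod p) ℂ).toBasis).equivFun ≪≫ₗ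
    LinearEquiv.funCongrLeft ℂ ℂ (splitVec e).toEquiv ≪≫ₗ (WithLp.linearEquiv 2 ℂ _).symm

theorem blockTensor_tprod (φ : (i : ι) → HilbertP p (k i)) (y : Fin d → ZMod p) :
    blockTensor e (PiTensorProduct.tprod ℂ φ) y = ∏ i, φ i (splitVec e y i) := by
  simp [blockTensor]

theorem inner_blockTensor_tprod (φ φ' : (i : ι) → HilbertP p (k i)) :
    inner ℂ (blockTensor e (PiTensorProduct.tprod ℂ φ))
      (blockTensor e (PiTensorProduct.tprod ℂ φ')) = ∏ i, inner ℂ (φ i) (φ' i) := by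
  classical
  simp only [PiLp.inner_apply, blockTensor_tprod]
  rw [Fintype.prod_sum, ← (splitVec e).toEquiv.sum_comp]
  simp [Finset.prod_mul_distrib]

theorem elemOp_blockTensor (n : PhaseP p d) (x : PiTensorProduct ℂ fun i => HilbertP p (k i)) :
    elemOp n (blockTensor e x) =
      blockTensor e (PiTensorProduct.map (fun i => elemOp (splitPhase e n i)) x) := by
  suffices h : elemOp n ∘ₗ (blockTensor e).toLinearMap =
      (blockTensor e).toLinearMap ∘ₗ PiTensorProduct.map fun i => elemOp (splitPhase e n i) from
    LinearMap.congr_fun h x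
  refine PiTensorProduct.ext (MultilinearMap.ext fun φ => ?_)
  ext y
  simp only [LinearMap.compMultilinearMap_apply, LinearMap.comp_apply, LinearEquiv.coe_coe,
    PiTensorProduct.map_tprod, elemOp_apply, blockTensor_tprod, splitPhase_comp_inl,
    splitPhase_comp_inr, map_add, Pi.add_apply, Finset.prod_mul_distrib, ← stdAddChar_sum]
  simp only [Finset.sum_add_distrib, ← Finset.mul_sum, dotProduct_splitVec]

end BlockDecomposition

section ExistsIntertwiner

variable {p : ℕ} [Fact p.Prime] {d : ℕ} {A : SpP p d}

theorem SympDecomposition.exists_isTensorIntertwiner (S : SympDecomposition A) (D : EigenFrame A)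
    {U : SpP p d →* (HilbertP p d ≃ₗᵢ[ℂ] HilbertP p d)} (hU : IsQuantization U) :
    ∃ 𝒰 : HilbertP p d ≃ₗ[ℂ] PiTensorProduct ℂ fun ϑ : sympOrbits A => HilbertP p (halfDim ϑ.1),
      S.IsTensorIntertwiner 𝒰 := by
  obtain ⟨e⟩ : Nonempty ((Σ ϑ : sympOrbits A, Fin (halfDim ϑ.1)) ≃ Fin d) :=
    ⟨Fintype.equivOfCardEq (by simp only [Fintype.card_sigma, Fintype.card_fin, D.sum_halfDim])⟩
  let f : PhaseP p d ≃ₗ[ZMod p] PhaseP p d := S.coord ≪≫ₗ (splitPhase e).symm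
  have splitPhase_f (n : PhaseP p d) : splitPhase e (f n) = S.coord n :=
    (splitPhase e).apply_symm_apply _
  let g := spOfLinearMap f.toLinearMap fun m n => by
    rw [← sum_sympForm_splitPhase e, S.form_eq]
    exact congrArg₂ (fun a b : (ϑ : sympOrbits A) → PhaseP p (halfDim ϑ.1) =>
      ∑ ϑ, sympForm (a ϑ) (b ϑ)) (splitPhase_f m) (splitPhase_f n)
  have splitPhase_vecMul (n : PhaseP p d) : splitPhase e (n ᵥ* g.1) = S.coord n :=
    (congrArg _ (vecMul_spOfLinearMap _ _ n)).trans (splitPhase_f n)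
  refine ⟨(U g).symm.toLinearEquiv ≪≫ₗ (blockTensor e).symm, fun φ φ' => ?_, fun n ψ => ?_⟩
  · exact ((U g).inner_map_map _ _).trans (inner_blockTensor_tprod e φ φ')
  · change (blockTensor e).symm ((U g).symm (elemOp n ψ)) =
      PiTensorProduct.map (fun ϑ => elemOp (S.coord n ϑ)) ((blockTensor e).symm ((U g).symm ψ))
    rw [LinearEquiv.symm_apply_eq, ← splitPhase_vecMul, ← elemOp_blockTensor,
      LinearEquiv.apply_symm_apply]
    have h := hU g n ((U g).symm ψ)
    rw [LinearIsometryEquiv.apply_symm_apply] at h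
    exact h

end ExistsIntertwiner

section HeckeEigenspaces

theorem linearIndependent_and_span_dite {K V κ : Type*} [Field K] [AddCommGroup V] [Module K V]
    {P : Prop} [Decidable P] {W : Submodule K V} {φ : V} {ψ : κ → V}
    (hW : ¬P → Module.finrank K W = 1) (hφ : ¬P → φ ≠ 0 ∧ φ ∈ W)
    (hψ : P → LinearIndependent K ψ ∧ Submodule.span K (Set.range ψ) = W) :
    LinearIndependent K (fun η : P → κ => if h : P then ψ (η h) else φ) ∧
      Submodule.span K (Set.range fun η : P → κ => if h : P then ψ (η h) else φ) = W := by
  by_cases h : P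
  · simp only [dif_pos h]
    have eval_bijective : Function.Bijective fun η : P → κ => η h :=
      ⟨fun η η' hη => funext fun _ => hη, fun a => ⟨fun _ => a, rfl⟩⟩
    exact ⟨(hψ h).1.comp _ eval_bijective.1,
      (congrArg _ (eval_bijective.2.range_comp ψ)).trans (hψ h).2⟩
  · simp only [dif_neg h]
    have : IsEmpty P := ⟨h⟩
    obtain ⟨φ_ne_zero, φ_mem⟩ := hφ h
    have : FiniteDimensional K W := .of_finrank_pos (by rw [hW h]; exact one_pos)
    refine ⟨.of_subsingleton default φ_ne_zero, ?_⟩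
    rw [Set.range_const]
    exact Submodule.eq_of_le_of_finrank_eq ((Submodule.span_singleton_le_iff_mem _ _).2 φ_mem)
      ((finrank_span_singleton φ_ne_zero).trans (hW h).symm)

variable {p : ℕ} [Fact p.Prime] {d : ℕ} {A : SpP p d}

open Classical in
theorem finrank_heckeEigenspace_of_sympOrbits_eq_singleton (hp : p ≠ 2)
    {U : SpP p d →* (HilbertP p d ≃ₗᵢ[ℂ] HilbertP p d)} (hU : IsQuantization U)
    (hA : (eigenvaluesP A).Nodup) {ϑ : Set (FpBar p)} (hϑ : sympOrbits A = {ϑ})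
    (χ : heckeGroup A →* ℂˣ) :
    Module.finrank ℂ (heckeEigenspace U A χ) =
      if orderOf χ = 2 then if IsSymmetricOrbit ϑ then 0 else 2 else 1 := by
  obtain ⟨χ₂, h_quadratic, h_one, h_zero, h_two⟩ :=
    exists_orderOf_eq_two_iff_and_finrank_heckeEigenspace hp hU hA hϑ
  split_ifs with hχ hsymm
  · exact (h_quadratic χ).1 hχ ▸ h_zero hsymm
  · exact (h_quadratic χ).1 hχ ▸ h_two hsymm
  · exact h_one χ (mt (h_quadratic χ).2 hχ)

theorem existsUnique_orderOf_eq_two (hp : p ≠ 2) (hA : (eigenvaluesP A).Nodup)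
    {ϑ : Set (FpBar p)} (hϑ : sympOrbits A = {ϑ}) :
    ∃! χ₂ : heckeGroup A →* ℂˣ, orderOf χ₂ = 2 := by
  obtain ⟨U, hU⟩ := exists_isQuantization hp d
  obtain ⟨χ₂, h_quadratic, -⟩ :=
    exists_orderOf_eq_two_iff_and_finrank_heckeEigenspace hp hU hA hϑ
  exact ⟨χ₂, (h_quadratic χ₂).2 rfl, fun χ => (h_quadratic χ).1⟩

namespace SympDecomposition

variable {S : SympDecomposition A}
  {U : (d : ℕ) → SpP p d →* (HilbertP p d ≃ₗᵢ[ℂ] HilbertP p d)}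
  {χ : (ϑ : sympOrbits A) → heckeGroup (S.comp ϑ) →* ℂˣ}

open Classical in
theorem finrank_heckeEigenspace_comp (hp : p ≠ 2) (D : EigenFrame A)
    (hU : ∀ d, IsQuantization (U d)) (ϑ : sympOrbits A) (χ : heckeGroup (S.comp ϑ) →* ℂˣ) :
    Module.finrank ℂ (heckeEigenspace (U (halfDim ϑ.1)) (S.comp ϑ) χ) =
      if orderOf χ = 2 then if IsSymmetricOrbit ϑ.1 then 0 else 2 else 1 :=
  finrank_heckeEigenspace_of_sympOrbits_eq_singleton hp (hU _) (S.nodup_eigenvaluesP_comp D ϑ)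
    (S.sympOrbits_comp D ϑ) χ

open Classical in
theorem finrank_heckeEigenspace_prodChar (hp : p ≠ 2) (D : EigenFrame A)
    (hU : ∀ d, IsQuantization (U d))
    (χ : (ϑ : sympOrbits A) → heckeGroup (S.comp ϑ) →* ℂˣ) :
    Module.finrank ℂ (heckeEigenspace (U d) A (S.prodChar χ)) =
      ∏ ϑ, if orderOf (χ ϑ) = 2 then if IsSymmetricOrbit ϑ.1 then 0 else 2 else 1 := by
  obtain ⟨𝒰, h𝒰⟩ := S.exists_isTensorIntertwiner D (hU d)
  rw [h𝒰.finrank_heckeEigenspace_prodChar hp D hU]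
  exact Finset.prod_congr rfl fun ϑ _ => finrank_heckeEigenspace_comp hp D hU ϑ (χ ϑ)

theorem finrank_heckeEigenspace_prodChar_eq_one (hp : p ≠ 2) (D : EigenFrame A)
    (hU : ∀ d, IsQuantization (U d)) (h : ∀ ϑ, orderOf (χ ϑ) ≠ 2) :
    Module.finrank ℂ (heckeEigenspace (U d) A (S.prodChar χ)) = 1 := by
  rw [finrank_heckeEigenspace_prodChar hp D hU]
  exact Finset.prod_eq_one fun ϑ _ => if_neg (h ϑ)

theorem finrank_heckeEigenspace_prodChar_eq_zero (hp : p ≠ 2) (D : EigenFrame A)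
    (hU : ∀ d, IsQuantization (U d)) (h : ∃ ϑ, orderOf (χ ϑ) = 2 ∧ IsSymmetricOrbit ϑ.1) :
    Module.finrank ℂ (heckeEigenspace (U d) A (S.prodChar χ)) = 0 := by
  obtain ⟨ϑ, hχ, hsymm⟩ := h
  rw [finrank_heckeEigenspace_prodChar hp D hU]
  exact Finset.prod_eq_zero (Finset.mem_univ ϑ) (by rw [if_pos hχ, if_pos hsymm])

theorem finrank_heckeEigenspace_prodChar_eq_two_pow (hp : p ≠ 2) (D : EigenFrame A)
    (hU : ∀ d, IsQuantization (U d)) (h : ∀ ϑ, orderOf (χ ϑ) = 2 → ¬IsSymmetricOrbit ϑ.1) :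
    Module.finrank ℂ (heckeEigenspace (U d) A (S.prodChar χ)) =
      2 ^ Fintype.card {ϑ : sympOrbits A // orderOf (χ ϑ) = 2} := by
  classical
  have h_factor (ϑ : sympOrbits A) :
      (if orderOf (χ ϑ) = 2 then if IsSymmetricOrbit ϑ.1 then 0 else 2 else 1) =
        if orderOf (χ ϑ) = 2 then 2 else 1 :=
    ite_congr rfl (fun hχ => if_neg (h ϑ hχ)) fun _ => rfl
  rw [finrank_heckeEigenspace_prodChar hp D hU]
  simp only [h_factor, Finset.prod_ite, Finset.prod_const, one_pow, mul_one,
    Fintype.card_subtype]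

theorem IsTensorIntertwiner.linearIndependent_and_span_dite_tprod (hp : p ≠ 2) (D : EigenFrame A)
    (hU : ∀ d, IsQuantization (U d))
    {𝒰 : HilbertP p d ≃ₗ[ℂ] PiTensorProduct ℂ fun ϑ : sympOrbits A => HilbertP p (halfDim ϑ.1)}
    (h𝒰 : S.IsTensorIntertwiner 𝒰) {κ : Type*}
    {φ : (ϑ : sympOrbits A) → HilbertP p (halfDim ϑ.1)}
    {ψ : (ϑ : sympOrbits A) → κ → HilbertP p (halfDim ϑ.1)}
    (hφ : ∀ ϑ, orderOf (χ ϑ) ≠ 2 →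
      φ ϑ ≠ 0 ∧ φ ϑ ∈ heckeEigenspace (U (halfDim ϑ.1)) (S.comp ϑ) (χ ϑ))
    (hψ : ∀ ϑ, orderOf (χ ϑ) = 2 → LinearIndependent ℂ (ψ ϑ) ∧
      Submodule.span ℂ (Set.range (ψ ϑ)) =
        heckeEigenspace (U (halfDim ϑ.1)) (S.comp ϑ) (χ ϑ)) :
    let Ψ : ({ϑ : sympOrbits A // orderOf (χ ϑ) = 2} → κ) → HilbertP p d :=
      fun η => 𝒰.symm (PiTensorProduct.tprod ℂ fun ϑ =>
        if h : orderOf (χ ϑ) = 2 then ψ ϑ (η ⟨ϑ, h⟩) else φ ϑ)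
    LinearIndependent ℂ Ψ ∧
      Submodule.span ℂ (Set.range Ψ) = heckeEigenspace (U d) A (S.prodChar χ) := by
  classical
  let e : ({ϑ : sympOrbits A // orderOf (χ ϑ) = 2} → κ) ≃
      ((ϑ : sympOrbits A) → orderOf (χ ϑ) = 2 → κ) :=
    { toFun := fun η ϑ h => η ⟨ϑ, h⟩
      invFun := fun f ϑ => f ϑ.1 ϑ.2
      left_inv := fun _ => rfl
      right_inv := fun _ => rfl }
  obtain ⟨hli, hspan⟩ := h𝒰.linearIndependent_and_span_heckeEigenspace hp D hU fun ϑ =>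
    linearIndependent_and_span_dite
      (fun hχ => (finrank_heckeEigenspace_comp hp D hU ϑ (χ ϑ)).trans (if_neg hχ)) (hφ ϑ) (hψ ϑ)
  refine ⟨hli.comp e e.injective, ?_⟩
  rw [← hspan, ← e.surjective.range_comp]
  rfl

end SympDecomposition

end HeckeEigenspaces

end

open scoped TensorProduct in
open Classical in
theorem mainTheorem8 (p : ℕ) [Fact p.Prime] (hp : p ≠ 2) :
    (∀ d : ℕ, ∃ U : SpP p d →* (HilbertP p d ≃ₗᵢ[ℂ] HilbertP p d), IsQuantization U) ∧
    ∀ U : (d : ℕ) → SpP p d →* (HilbertP p d ≃ₗᵢ[ℂ] HilbertP p d),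
      (∀ d, IsQuantization (U d)) →
    ∀ (d : ℕ) (A : SpP p d), (eigenvaluesP A).Nodup →
      -- one irreducible symplectic orbit
      (∀ ϑ : Set (AlgebraicClosure (ZMod p)), sympOrbits A = {ϑ} →
        ∃ χ₂ : heckeGroup A →* ℂˣ,
          (∀ χ : heckeGroup A →* ℂˣ, orderOf χ = 2 ↔ χ = χ₂) ∧
          (∀ χ : heckeGroup A →* ℂˣ, χ ≠ χ₂ →
            Module.finrank ℂ (heckeEigenspace (U d) A χ) = 1) ∧
          (IsSymmetricOrbit ϑ → Module.finrank ℂ (heckeEigenspace (U d) A χ₂) = 0) ∧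
          (¬ IsSymmetricOrbit ϑ → Module.finrank ℂ (heckeEigenspace (U d) A χ₂) = 2)) ∧
      -- the general case
      Nonempty (SympDecomposition A) ∧
      ∀ S : SympDecomposition A,
        (∀ ϑ, ∃! χ₂ : heckeGroup (S.comp ϑ) →* ℂˣ, orderOf χ₂ = 2) ∧
        Function.Bijective S.prodChar ∧
        (∃ 𝒰 : HilbertP p d ≃ₗ[ℂ] (⨂[ℂ] ϑ : sympOrbits A, HilbertP p (halfDim ϑ.1)),
          S.IsTensorIntertwiner 𝒰) ∧
        ∀ χ : (ϑ : sympOrbits A) → heckeGroup (S.comp ϑ) →* ℂˣ,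
          ((∀ ϑ, orderOf (χ ϑ) ≠ 2) →
            Module.finrank ℂ (heckeEigenspace (U d) A (S.prodChar χ)) = 1) ∧
          ((∃ ϑ, orderOf (χ ϑ) = 2 ∧ IsSymmetricOrbit ϑ.1) →
            Module.finrank ℂ (heckeEigenspace (U d) A (S.prodChar χ)) = 0) ∧
          ((∀ ϑ, orderOf (χ ϑ) = 2 → ¬ IsSymmetricOrbit ϑ.1) →
            Module.finrank ℂ (heckeEigenspace (U d) A (S.prodChar χ)) =
              2 ^ Fintype.card {ϑ : sympOrbits A // orderOf (χ ϑ) = 2} ∧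
            ∀ 𝒰 : HilbertP p d ≃ₗ[ℂ] (⨂[ℂ] ϑ : sympOrbits A, HilbertP p (halfDim ϑ.1)),
              S.IsTensorIntertwiner 𝒰 →
            -- `φ ϑ` spans the eigenspace of `χ ϑ` where `χ ϑ` is not quadratic,
            -- `ψ ϑ 0, ψ ϑ 1` is a basis of it where `χ ϑ` is quadratic
            ∀ (φ : (ϑ : sympOrbits A) → HilbertP p (halfDim ϑ.1))
              (ψ : (ϑ : sympOrbits A) → ZMod 2 → HilbertP p (halfDim ϑ.1)),
              (∀ ϑ, orderOf (χ ϑ) ≠ 2 →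
                φ ϑ ≠ 0 ∧ φ ϑ ∈ heckeEigenspace (U (halfDim ϑ.1)) (S.comp ϑ) (χ ϑ)) →
              (∀ ϑ, orderOf (χ ϑ) = 2 → LinearIndependent ℂ (ψ ϑ) ∧
                Submodule.span ℂ (Set.range (ψ ϑ)) =
                  heckeEigenspace (U (halfDim ϑ.1)) (S.comp ϑ) (χ ϑ)) →
              let Ψ : ({ϑ : sympOrbits A // orderOf (χ ϑ) = 2} → ZMod 2) → HilbertP p d :=
                fun η => 𝒰.symm (PiTensorProduct.tprod ℂ fun ϑ =>
                  if h : orderOf (χ ϑ) = 2 then ψ ϑ (η ⟨ϑ, h⟩) else φ ϑ)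
              LinearIndependent ℂ Ψ ∧
                Submodule.span ℂ (Set.range Ψ) = heckeEigenspace (U d) A (S.prodChar χ)) := by
  refine ⟨exists_isQuantization hp, fun U hU d A hA => ?_⟩
  obtain ⟨D⟩ := nonempty_eigenFrame hA
  refine ⟨fun ϑ => exists_orderOf_eq_two_iff_and_finrank_heckeEigenspace hp (hU d) hA,
    D.nonempty_sympDecomposition, fun S => ⟨fun ϑ => ?_, S.prodChar_bijective,
      S.exists_isTensorIntertwiner D (hU d), fun χ => ⟨?_, ?_, fun h => ⟨?_, ?_⟩⟩⟩⟩
  · exact existsUnique_orderOf_eq_two hp (S.nodup_eigenvaluesP_comp D ϑ) (S.sympOrbits_comp D ϑ)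
  · exact SympDecomposition.finrank_heckeEigenspace_prodChar_eq_one hp D hU
  · exact SympDecomposition.finrank_heckeEigenspace_prodChar_eq_zero hp D hU
  · exact SympDecomposition.finrank_heckeEigenspace_prodChar_eq_two_pow hp D hU h
  · exact fun 𝒰 h𝒰 φ ψ hφ hψ => h𝒰.linearIndependent_and_span_dite_tprod hp D hU hφ hψ
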